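/- Let $M$ be a complex manifold (Hausdorff, second countable) of dimension $n$. In local holomorphic coordinates $z^k$ on $M$ let $\zeta_k,\bar\zeta_l$ be the dual fibre coordinates on the cotangent bundle $T^*M$, so that a covector is $\zeta_k\,dz^k+\bar\zeta_l\,d\bar z^l$; summation over repeated indices is understood. Let $g^{lk}$ be a Kähler–Poisson tensor on $M$, that is, a smooth contravariant tensor of type $(1,1)$ ($k$ holomorphic, $l$ antiholomorphic) satisfying the Jacobi identity $$g^{lk}\frac{\partial g^{qp}}{\partial z^k}=g^{qk}\frac{\partial g^{lp}}{\partial z^k},\qquad g^{lk}\frac{\partial g^{qp}}{\partial\bar z^l}=g^{lp}\frac{\partial g^{qk}}{\partial\bar z^l},$$ and let $g^{lk}+\epsilon h^{lk}$, $\epsilon^2=0$, be an infinitesimal deformation of it: $h^{lk}$ is a smooth tensor of type $(1,1)$ with $$g^{lk}\frac{\partial h^{qp}}{\partial z^k}+h^{lk}\frac{\partial g^{qp}}{\partial z^k}=g^{qk}\frac{\partial h^{lp}}{\partial z^k}+h^{qk}\frac{\partial g^{lp}}{\partial z^k},\qquad g^{lk}\frac{\partial h^{qp}}{\partial\bar z^l}+h^{lk}\frac{\partial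 g^{qp}}{\partial\bar z^l}=g^{lp}\frac{\partial h^{qk}}{\partial\bar z^l}+h^{lp}\frac{\partial g^{qk}}{\partial\bar z^l}.$$ Functions are complex-valued. Equip $C^\infty(M)[\epsilon]$ with the $\epsilon$-linear bracket $$\{u,v\}=(g^{lk}+\epsilon h^{lk})\left(\frac{\partial u}{\partial\bar z^l}\frac{\partial v}{\partial z^k}-\frac{\partial v}{\partial\bar z^l}\frac{\partial u}{\partial z^k}\right).$$ Let $Z$ be the zero section of $T^*M$, $I_Z\subset C^\infty(T^*M)$ its vanishing ideal, and $C^\infty(T^*M,Z)=C^\infty(T^*M)/\bigcap_{l\ge1}I_Z^l$, with the Poisson bracket $\{\cdot,\cdot\}_{T^*M}$ induced by the standard symplectic structure of $T^*M$ (normalized by $\{\zeta_k,z^k\}_{T^*M}=1$) and extended $\epsilon$-linearly to $C^\infty(T^*M,Z)[\epsilon]$; let $E$ be the ($\epsilon$-linearly extended) restriction map $C^\infty(T^*M,Z)\to C^\infty(M)$ to $Z\cong M$. A deformation formal symplectic groupoid over $(M,g+\epsilon h)$ on the formal neighbourhood of $Z$ is given by its source and target mappings, that is, by $\epsilon$-linear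 mappings $S,T:C^\infty(M)[\epsilon]\to C^\infty(T^*M,Z)[\epsilon]$ such that for all $u,v\in C^\infty(M)[\epsilon]$ $$E(Su)=u,\quad E(Tu)=u,\quad S(uv)=Su\,Sv,\quad T(uv)=Tu\,Tv,$$ $$S\{u,v\}=\{Su,Sv\}_{T^*M},\quad T\{u,v\}=-\{Tu,Tv\}_{T^*M},\quad \{Su,Tv\}_{T^*M}=0 .$$ It is said to be with separation of variables if $Sa=a$ and $Tb=b$ for all local holomorphic functions $a$ and all local antiholomorphic functions $b$ on $M$ (functions on $M$ are lifted to $T^*M$ by the projection; $S$ and $T$ do not increase supports, so they act on local functions). Then there exists a unique deformation formal symplectic groupoid with separation of variables over $(M,g+\epsilon h)$. In any local holomorphic coordinates its source and target mappings are $$Sf=e^{\mathfrak D+\epsilon\mathfrak E}f,\qquad Tf=e^{\bar{\mathfrak D}+\epsilon\bar{\mathfrak E}}f,$$ where $$\mathfrak D=\zeta_k g^{lk}\frac{\partial}{\partial\bar z^l},\quad \mathfrak E=\zeta_k h^{lk}\frac{\partial}{\partial\bar z^l},\quad \bar{\mathfrak D}=\bar\zeta_l g^{lk}\frac{\partial}{\partial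 z^k},\quad \bar{\mathfrak E}=\bar\zeta_l h^{lk}\frac{\partial}{\partial z^k},$$ and the exponentials are formal series in the fibre variables $\zeta_k,\bar\zeta_l$ (an element of $C^\infty(T^*M,Z)$ is identified locally with its Taylor series in the fibre variables along $Z$). -/

import Mathlib

open scoped Manifold ContDiff Topology DualNumber
open Bundle

noncomputable section

namespace KahlerPoisson

/-! ### Formal neighbourhoods -/

section Formal

variable {EX HX : Type*} [NormedAddCommGroup EX] [NormedSpace ℝ EX] [TopologicalSpace HX]

/-- The algebra `C^∞(X)` of smooth complex-valued functions on a real manifold `X`. -/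
def SmoothFun (I : ModelWithCorners ℝ EX HX) (X : Type*) [TopologicalSpace X]
    [ChartedSpace HX X] : Subalgebra ℂ (X → ℂ) where
  carrier := {f | ContMDiff I 𝓘(ℝ, ℂ) ∞ f}
  mul_mem' {f g} hf hg := by
    have h : ContDiff ℝ ∞ (fun p : ℂ × ℂ => p.1 * p.2) := contDiff_fst.mul contDiff_snd
    exact h.contMDiff.comp (hf.prodMk_space hg)
  add_mem' {f g} hf hg := by
    have h : ContDiff ℝ ∞ (fun p : ℂ × ℂ => p.1 + p.2) := contDiff_fst.add contDiff_snd
    exact h.contMDiff.comp (hf.prodMk_space hg)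
  algebraMap_mem' c := by
    exact (contMDiff_const : ContMDiff I 𝓘(ℝ, ℂ) ∞ (fun _ : X => c))

variable (I : ModelWithCorners ℝ EX HX) {X : Type*} [TopologicalSpace X] [ChartedSpace HX X]

/-- The vanishing ideal of `Y ⊆ X` in `C^∞(X)`. -/
def vanishingIdeal (Y : Set X) : Ideal (SmoothFun I X) where
  carrier := {f | ∀ y ∈ Y, f.1 y = 0}
  add_mem' {f g} hf hg y hy := by simp [hf y hy, hg y hy]
  zero_mem' _ _ := rfl
  smul_mem' c f hf y hy := by simp [hf y hy]

/-- The intersection of all powers of the vanishing ideal of `Y`. -/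
def flatIdeal (Y : Set X) : Ideal (SmoothFun I X) := ⨅ l : ℕ, vanishingIdeal I Y ^ l

/-- The algebra `C^∞(X, Y)` of smooth functions on the formal neighbourhood of `Y` in `X`. -/
abbrev FormalFun (Y : Set X) : Type _ := SmoothFun I X ⧸ flatIdeal I Y

end Formal

/-! ### Complex coordinates -/

/-- The model space `ℂⁿ` of an `n`-dimensional complex manifold. -/
abbrev Cn (n : ℕ) : Type := Fin n → ℂ

variable {n : ℕ}

/-- The operator `∂/∂z^k = (∂/∂x^k - i ∂/∂y^k)/2`. -/
def dz (k : Fin n) (u : Cn n → ℂ) (w : Cn n) : ℂ :=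
  (fderiv ℝ u w (Pi.single k 1) - Complex.I * fderiv ℝ u w (Pi.single k Complex.I)) / 2

/-- The operator `∂/∂z̄^l = (∂/∂x^l + i ∂/∂y^l)/2`. -/
def dzbar (l : Fin n) (u : Cn n → ℂ) (w : Cn n) : ℂ :=
  (fderiv ℝ u w (Pi.single l 1) + Complex.I * fderiv ℝ u w (Pi.single l Complex.I)) / 2

/-- A complex manifold is a smooth real manifold. -/
instance isManifold_real {M : Type*} [TopologicalSpace M] [ChartedSpace (Cn n) M]
    [IsManifold 𝓘(ℂ, Cn n) ω M] : IsManifold 𝓘(ℝ, Cn n) ∞ M := by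
  apply isManifold_of_contDiffOn
  intro e e' he he'
  have h := (contDiffGroupoid ω 𝓘(ℂ, Cn n)).compatible he he'
  rw [contDiffGroupoid, mem_groupoid_of_pregroupoid] at h
  have h1 : ContDiffOn ℂ ω (e.symm ≫ₕ e') (e.symm ≫ₕ e').source := by
    simpa [contDiffPregroupoid] using h.1
  simpa using (h1.restrict_scalars ℝ).of_le le_top

section Manifold

variable (n) (M : Type*) [TopologicalSpace M] [ChartedSpace (Cn n) M]
  [IsManifold 𝓘(ℂ, Cn n) ω M]

/-- The algebra `C^∞(M)` of smooth complex-valued functions on the complex manifold `M`. -/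
abbrev CM : Type _ := SmoothFun 𝓘(ℝ, Cn n) M

/-- The (real) cotangent bundle `T*M`. -/
abbrev Cotangent : Type _ :=
  TotalSpace (Cn n →L[ℝ] ℝ) (fun x : M => TangentSpace 𝓘(ℝ, Cn n) x →L[ℝ] Trivial M ℝ x)

/-- The model with corners of `T*M`. -/
abbrev cotangentModel : ModelWithCorners ℝ (Cn n × (Cn n →L[ℝ] ℝ))
    (ModelProd (Cn n) (Cn n →L[ℝ] ℝ)) :=
  𝓘(ℝ, Cn n).prod 𝓘(ℝ, Cn n →L[ℝ] ℝ)

/-- The zero section `Z` of `T*M`. -/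
def zeroSec : Set (Cotangent n M) := {p | p.2 = 0}

/-- The algebra `C^∞(T*M)`. -/
abbrev CT : Type _ := SmoothFun (cotangentModel n) (Cotangent n M)

/-- The algebra `C^∞(T*M, Z)`. -/
def CTZ : Type _ := FormalFun (cotangentModel n) (zeroSec n M)

instance : CommRing (CTZ n M) :=
  Ideal.Quotient.commRing (flatIdeal (cotangentModel n) (zeroSec n M))

instance : Algebra ℂ (CTZ n M) :=
  Ideal.Quotient.algebra (I := flatIdeal (cotangentModel n) (zeroSec n M)) ℂ

/-- The class in `C^∞(T*M, Z)` of a smooth function on `T*M`. -/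
def toFormal : CT n M →ₐ[ℂ] CTZ n M :=
  Ideal.Quotient.mkₐ ℂ (flatIdeal (cotangentModel n) (zeroSec n M))

/-- Restriction of functions on `T*M` to the zero section, identified with `M`. -/
def restrictZero : CT n M →ₐ[ℂ] CM n M where
  toFun F := ⟨fun x => F.1 (zeroSection (Cn n →L[ℝ] ℝ) _ x),
    ContMDiff.comp (I' := cotangentModel n) F.2
      (contMDiff_zeroSection ℝ (fun x : M => TangentSpace 𝓘(ℝ, Cn n) x →L[ℝ] Trivial M ℝ x))⟩
  map_one' := rfl
  map_mul' _ _ := rfl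
  map_zero' := rfl
  map_add' _ _ := rfl
  commutes' _ := rfl

/-- The unit map `E : C^∞(T*M, Z) → C^∞(M)`, dual to the inclusion of `M` as the zero section. -/
def unitMap : CTZ n M →ₐ[ℂ] CM n M :=
  Ideal.Quotient.liftₐ (flatIdeal (cotangentModel n) (zeroSec n M)) (restrictZero n M) (by
    intro F hF
    have h1 : F ∈ vanishingIdeal (cotangentModel n) (zeroSec n M) := by
      simpa using (Ideal.mem_iInf.1 hF) 1
    exact Subtype.ext (funext fun x => h1 _ rfl))

/-- The pull-back `C^∞(M) → C^∞(T*M)` along the projection, by which functions on `M` are regarded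
as functions on `T*M`. -/
def pullback : CM n M →ₐ[ℂ] CT n M where
  toFun f := ⟨fun p => f.1 p.1,
    ContMDiff.comp (I' := 𝓘(ℝ, Cn n)) f.2
      (contMDiff_proj (fun x : M => TangentSpace 𝓘(ℝ, Cn n) x →L[ℝ] Trivial M ℝ x))⟩
  map_one' := rfl
  map_mul' _ _ := rfl
  map_zero' := rfl
  map_add' _ _ := rfl
  commutes' _ := rfl

/-- The holomorphic coordinate charts of `M`. -/
abbrev holCharts : Set (OpenPartialHomeomorph M (Cn n)) :=
  IsManifold.maximalAtlas 𝓘(ℂ, Cn n) ω M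

end Manifold

/-! ### The Poisson bracket on the cotangent bundle -/

/-- The real covector `Σ ζ_k dz^k + Σ ζ̄_k dz̄^k` on `ℂⁿ`. -/
def covector (ζ : Cn n) : Cn n →L[ℝ] ℝ :=
  (2 : ℝ) • Complex.reCLM.comp
    ((∑ k, ζ k • (ContinuousLinearMap.proj k : Cn n →L[ℂ] ℂ)).restrictScalars ℝ)

section Manifold

variable {M : Type*} [TopologicalSpace M] [ChartedSpace (Cn n) M] [IsManifold 𝓘(ℂ, Cn n) ω M]

/-- The point of `T*M` with coordinates `(z, ζ) = (w, ζ)`, where `z` are the coordinates of the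
chart `φ` and `ζ` the dual fibre coordinates. -/
def cotangentPoint (φ : OpenPartialHomeomorph M (Cn n)) (w ζ : Cn n) : Cotangent n M :=
  ⟨φ.symm w,
    (covector ζ).comp (mfderiv 𝓘(ℝ, Cn n) 𝓘(ℝ, Cn n) φ (φ.symm w))⟩

/-- A function on `T*M` written in the coordinates `(z, ζ)` given by the chart `φ` of `M`. -/
def inChart (φ : OpenPartialHomeomorph M (Cn n)) (F : Cotangent n M → ℂ) (w ζ : Cn n) : ℂ :=
  F (cotangentPoint φ w ζ)

/-- The canonical Poisson bracket in the coordinates `(z, ζ)`, normalized by `{ζ_k, z^k} = 1`. -/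
def canonicalBracket (F G : Cn n → Cn n → ℂ) (w ζ : Cn n) : ℂ :=
  ∑ k, (dz k (F w) ζ * dz k (fun v => G v ζ) w - dz k (fun v => F v ζ) w * dz k (G w) ζ
    + dzbar k (F w) ζ * dzbar k (fun v => G v ζ) w
    - dzbar k (fun v => F v ζ) w * dzbar k (G w) ζ)

/-- `{P, Q}_{T*M} = R` in `C^∞(T*M, Z)`. The bracket on `C^∞(T*M)` is given in every coordinate
chart by the canonical formula and induces the one on the quotient `C^∞(T*M, Z)`. -/
def IsCotangentBracket (P Q R : CTZ n M) : Prop :=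
  ∃ F G H : CT n M, toFormal n M F = P ∧ toFormal n M G = Q ∧ toFormal n M H = R ∧
    ∀ φ ∈ holCharts n M, ∀ w ∈ φ.target, ∀ ζ,
      inChart φ H.1 w ζ = canonicalBracket (inChart φ F.1) (inChart φ G.1) w ζ

/-- `{P, Q}_{T*M} = R` in `C^∞(T*M, Z)[ε]`, for the `ε`-linear extension of the bracket. -/
def IsCotangentBracketEps (P Q R : (CTZ n M)[ε]) : Prop :=
  IsCotangentBracket P.fst Q.fst R.fst ∧
    ∃ A B : CTZ n M, IsCotangentBracket P.fst Q.snd A ∧ IsCotangentBracket P.snd Q.fst B ∧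
      R.snd = A + B

end Manifold

/-! ### Kähler-Poisson tensors and their infinitesimal deformations -/

/-- A smooth contravariant tensor of type `(1,1)` on `M`, given by its components `g^{lk}` in all
holomorphic charts: `coeff φ l k` is a function of the coordinates on `φ.target`, the index `l` is
antiholomorphic and the index `k` holomorphic. -/
structure Tensor11 (n : ℕ) (M : Type*) [TopologicalSpace M] [ChartedSpace (Cn n) M] where
  coeff : OpenPartialHomeomorph M (Cn n) → Fin n → Fin n → Cn n → ℂ
  smooth : ∀ φ ∈ holCharts n M, ∀ l k, ContDiffOn ℝ ∞ (coeff φ l k) φ.target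
  transform : ∀ φ ∈ holCharts n M, ∀ ψ ∈ holCharts n M, ∀ w ∈ (φ.symm ≫ₕ ψ).source, ∀ l k,
    coeff ψ l k (ψ (φ.symm w)) = ∑ q, ∑ p,
      (starRingEnd ℂ) (fderiv ℂ (ψ ∘ φ.symm) w (Pi.single q 1) l) *
        fderiv ℂ (ψ ∘ φ.symm) w (Pi.single p 1) k * coeff φ q p w

section Manifold

variable {M : Type*} [TopologicalSpace M] [ChartedSpace (Cn n) M]

/-- The Jacobi identity for a tensor `g` of type `(1,1)`. -/
def IsKahlerPoisson (g : Tensor11 n M) : Prop :=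
  ∀ φ ∈ holCharts n M, ∀ w ∈ φ.target,
    (∀ l q p, ∑ k, g.coeff φ l k w * dz k (g.coeff φ q p) w =
      ∑ k, g.coeff φ q k w * dz k (g.coeff φ l p) w) ∧
    (∀ k q p, ∑ l, g.coeff φ l k w * dzbar l (g.coeff φ q p) w =
      ∑ l, g.coeff φ l p w * dzbar l (g.coeff φ q k) w)

/-- `g + ε h`, `ε² = 0`, is an infinitesimal deformation of the Kähler-Poisson tensor `g`. -/
def IsInfinitesimalDeformation (g h : Tensor11 n M) : Prop :=
  ∀ φ ∈ holCharts n M, ∀ w ∈ φ.target,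
    (∀ l q p,
      ∑ k, (g.coeff φ l k w * dz k (h.coeff φ q p) w +
        h.coeff φ l k w * dz k (g.coeff φ q p) w) =
      ∑ k, (g.coeff φ q k w * dz k (h.coeff φ l p) w +
        h.coeff φ q k w * dz k (g.coeff φ l p) w)) ∧
    (∀ k q p,
      ∑ l, (g.coeff φ l k w * dzbar l (h.coeff φ q p) w +
        h.coeff φ l k w * dzbar l (g.coeff φ q p) w) =
      ∑ l, (g.coeff φ l p w * dzbar l (h.coeff φ q k) w +
        h.coeff φ l p w * dzbar l (g.coeff φ q k) w))

/-- `{u, v} = b` for the bracket on `C^∞(M)` of the tensor `g`, which is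
`{u, v} = g^{lk} (∂u/∂z̄^l ∂v/∂z^k - ∂v/∂z̄^l ∂u/∂z^k)` in holomorphic coordinates. -/
def IsBracket (g : Tensor11 n M) (u v b : CM n M) : Prop :=
  ∀ φ ∈ holCharts n M, ∀ w ∈ φ.target,
    b.1 (φ.symm w) = ∑ l, ∑ k, g.coeff φ l k w *
      (dzbar l (u.1 ∘ φ.symm) w * dz k (v.1 ∘ φ.symm) w -
        dzbar l (v.1 ∘ φ.symm) w * dz k (u.1 ∘ φ.symm) w)

/-- `{u, v} = b` for the bracket on `C^∞(M)[ε]` of the deformed tensor `g + ε h`. -/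
def IsBracketEps (g h : Tensor11 n M) (u v b : (CM n M)[ε]) : Prop :=
  IsBracket g u.fst v.fst b.fst ∧
    ∃ b₁ b₂ b₃ : CM n M, IsBracket g u.fst v.snd b₁ ∧ IsBracket g u.snd v.fst b₂ ∧
      IsBracket h u.fst v.fst b₃ ∧ b.snd = b₁ + b₂ + b₃

/-! ### Deformation formal symplectic groupoids -/

variable [IsManifold 𝓘(ℂ, Cn n) ω M]

/-- A deformation formal symplectic groupoid over `(M, g + ε h)` on the formal neighbourhood of the
zero section of `T*M`, given by its source and target maps
`S, T : C^∞(M)[ε] → C^∞(T*M, Z)[ε]`. -/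
@[ext]
structure DeformationGroupoid (g h : Tensor11 n M) where
  S : (CM n M)[ε] →ₗ[ℂ] (CTZ n M)[ε]
  T : (CM n M)[ε] →ₗ[ℂ] (CTZ n M)[ε]
  S_eps : ∀ f : (CM n M)[ε], S (DualNumber.eps * f) = DualNumber.eps * S f
  T_eps : ∀ f : (CM n M)[ε], T (DualNumber.eps * f) = DualNumber.eps * T f
  unit_S : ∀ f : (CM n M)[ε], unitMap n M (S f).fst = f.fst ∧ unitMap n M (S f).snd = f.snd
  unit_T : ∀ f : (CM n M)[ε], unitMap n M (T f).fst = f.fst ∧ unitMap n M (T f).snd = f.snd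
  S_mul : ∀ f₁ f₂ : (CM n M)[ε], S (f₁ * f₂) = S f₁ * S f₂
  T_mul : ∀ f₁ f₂ : (CM n M)[ε], T (f₁ * f₂) = T f₁ * T f₂
  S_bracket : ∀ f₁ f₂ : (CM n M)[ε], ∃ b : (CM n M)[ε], IsBracketEps g h f₁ f₂ b ∧
    IsCotangentBracketEps (S f₁) (S f₂) (S b)
  T_bracket : ∀ f₁ f₂ : (CM n M)[ε], ∃ b : (CM n M)[ε], IsBracketEps g h f₁ f₂ b ∧
    IsCotangentBracketEps (T f₁) (T f₂) (-T b)
  S_T_bracket : ∀ f₁ f₂ : (CM n M)[ε], IsCotangentBracketEps (S f₁) (T f₂) 0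

/-- The elements `P`, `Q` of `C^∞(T*M, Z)` coincide on the formal neighbourhood of the zero section
over some neighbourhood of the point `x` of `M`. -/
def AgreeNear (x : M) (P Q : CTZ n M) : Prop :=
  ∃ F G : CT n M, toFormal n M F = P ∧ toFormal n M G = Q ∧
    ∀ᶠ y in 𝓝 x, ∀ p : Cotangent n M, p.1 = y → F.1 p = G.1 p

/-- The function `f` is holomorphic in a neighbourhood of `x`. -/
def HolomorphicNear (f : M → ℂ) (x : M) : Prop :=
  ∀ᶠ y in 𝓝 x, MDifferentiableAt 𝓘(ℂ, Cn n) 𝓘(ℂ, ℂ) f y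

/-- Separation of variables: `S a = a` and `T b = b` for a local holomorphic function `a` and a
local antiholomorphic function `b`. Since `S` and `T` are defined on global functions, and do not
increase supports, a local function near `x` is represented by a global function which coincides
with it near `x`. -/
def DeformationGroupoid.SeparationOfVariables {g h : Tensor11 n M}
    (G : DeformationGroupoid g h) : Prop :=
  (∀ (x : M) (a : CM n M), HolomorphicNear (n := n) a.1 x →
    AgreeNear (n := n) x (G.S (TrivSqZeroExt.inl a)).fst (toFormal n M (pullback n M a)) ∧
    AgreeNear (n := n) x (G.S (TrivSqZeroExt.inl a)).snd 0) ∧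
  (∀ (x : M) (b : CM n M), HolomorphicNear (n := n) (fun y => (starRingEnd ℂ) (b.1 y)) x →
    AgreeNear (n := n) x (G.T (TrivSqZeroExt.inl b)).fst (toFormal n M (pullback n M b)) ∧
    AgreeNear (n := n) x (G.T (TrivSqZeroExt.inl b)).snd 0)

/-! ### The exponential formulas -/

/-- In the coordinates given by the chart `φ`, the element `P` of `C^∞(T*M, Z)` is the formal series
`Σ_r p r` in the fibre variables, `p r` being its homogeneous component of degree `r`: for each
representative `F` of `P`, the Taylor series at `t = 0` of `F(z, t ζ)` is `Σ_r t^r p r (z, ζ)`. -/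
def HasFibreExpansion (φ : OpenPartialHomeomorph M (Cn n)) (P : CTZ n M)
    (p : ℕ → Cn n → Cn n → ℂ) : Prop :=
  ∀ F : CT n M, toFormal n M F = P → ∀ w ∈ φ.target, ∀ ζ, ∀ r : ℕ,
    iteratedDeriv r (fun t : ℝ => inChart φ F.1 w (t • ζ)) 0 / (r.factorial : ℂ) = p r w ζ

/-- The operator `𝔇 = ζ_k g^{lk} ∂/∂z̄^l` in the chart `φ`. -/
def opD (g : Tensor11 n M) (φ : OpenPartialHomeomorph M (Cn n)) (u : Cn n → Cn n → ℂ) :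
    Cn n → Cn n → ℂ :=
  fun w ζ => ∑ k, ∑ l, ζ k * g.coeff φ l k w * dzbar l (fun v => u v ζ) w

/-- The operator `𝔇̄ = ζ̄_l g^{lk} ∂/∂z^k` in the chart `φ`. -/
def opDbar (g : Tensor11 n M) (φ : OpenPartialHomeomorph M (Cn n)) (u : Cn n → Cn n → ℂ) :
    Cn n → Cn n → ℂ :=
  fun w ζ => ∑ l, ∑ k, (starRingEnd ℂ) (ζ l) * g.coeff φ l k w * dz k (fun v => u v ζ) w

end Manifold

/-- The operator `A + ε B`, `ε² = 0`, acting on `u₀ + ε u₁`, which is written as `(u₀, u₁)`. -/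
def addEps {V : Type*} [Add V] (A B : V → V) (u : V × V) : V × V :=
  (A u.1, A u.2 + B u.1)

/-- The term `(A + ε B)^r u / r!` of the series `e^{A + ε B} u`. -/
def expTerm {V : Type*} [AddCommGroup V] [Module ℂ V] (A B : V → V) (u : V × V) (r : ℕ) : V × V :=
  ((r.factorial : ℂ)⁻¹) • (addEps A B)^[r] u

/-- The element `f = f₀ + ε f₁` of `C^∞(M)[ε]` in the coordinates `(z, ζ)` given by the chart `φ`;
it does not depend on `ζ`. -/
def baseInChart {M : Type*} [TopologicalSpace M] [ChartedSpace (Cn n) M]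
    (φ : OpenPartialHomeomorph M (Cn n)) (f : (CM n M)[ε]) :
    (Cn n → Cn n → ℂ) × (Cn n → Cn n → ℂ) :=
  (fun w _ => f.fst.1 (φ.symm w), fun w _ => f.snd.1 (φ.symm w))

/-- In the chart `φ`, the element `P` of `C^∞(T*M, Z)[ε]` is the formal series `e^{A + ε B} f`, where
`A` and `B` are operators of degree one in the fibre variables. -/
def IsExpSeries {M : Type*} [TopologicalSpace M] [ChartedSpace (Cn n) M]
    [IsManifold 𝓘(ℂ, Cn n) ω M] (φ : OpenPartialHomeomorph M (Cn n))
    (A B : (Cn n → Cn n → ℂ) → (Cn n → Cn n → ℂ)) (f : (CM n M)[ε]) (P : (CTZ n M)[ε]) : Prop :=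
  HasFibreExpansion φ P.fst (fun r => (expTerm A B (baseInChart φ f) r).1) ∧
    HasFibreExpansion φ P.snd (fun r => (expTerm A B (baseInChart φ f) r).2)

end KahlerPoisson

end

noncomputable section

set_option linter.unusedSectionVars false

namespace KahlerPoisson

/-! Write `γ = g + εh`. With separation of variables, bracketing `Sf` with `S z^k = z^k` produces
`∂(Sf)/∂ζ_k`, and bracketing it with `T z̄^l = z̄^l` produces `∂(Sf)/∂ζ̄_l`. The groupoid axioms
thus force `a = Sf` to satisfy the source equations `∂a/∂ζ̄_l = 0` and `∂a/∂ζ_k = γ^{lk} ∂a/∂z̄^l`.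
By Euler's formula these express the part of degree `r + 1` in the fibre variables through the part
of degree `r`, so a solution is determined by its restriction to the zero section and has to be the
exponential series (`LocalTensor.Source.coef_eq`). Throughout, `coef r` is `r!` times the
homogeneous part of degree `r`, so it equals the `r`-th iterate of `𝔇 + ε𝔈` with no factorial.

Existence is the solvability of this overdetermined system. Borel's lemma gives, locally, a smooth
`a` whose fibre Taylor series is the exponential; it satisfies only the contracted equation `R a =
(𝔇 + ε𝔈) a`, with `R` the Euler field. The Jacobi identity in the `z̄`-derivatives says that the
fields `X_k = γ^{lk} ∂/∂z̄^l` commute. Hence each defect `δ`, that is `∂a/∂ζ_k - X_k a` or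
`∂a/∂ζ̄_l`, satisfies `R δ + δ = (𝔇 + ε𝔈) δ`. On the degree `r` part the left side multiplies by `r
+ 1`, while the right side comes from degree `r - 1`; so `δ = 0` (`euler_defect`,
`eq_zero_of_euler_add`).

The rest follows from uniqueness. Solutions are closed under sums and products, and, by the Jacobi
identity in the `z`-derivatives, under the canonical bracket (`IsSource.bracket`). A solution of the
source equations commutes with a solution of the target equations by pure algebra
(`algBracket_source_target`). Defining `Sf` as the solution restricting to `f`, each required
identity equates two solutions with the same restriction (`sol_eq`). A holomorphic function lifted
from the base solves the equations, which gives separation of variables. For uniqueness of the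
groupoid, `coef_map_eq` compares two groupoids degree by degree, using brackets with coordinate
functions.

Passing from local to global needs three things. The equations are independent of the chart because
the coordinate change on the cotangent bundle is holomorphic and the tensors transform covariantly
(`SourceAt.comp_coordChange`). Local solutions with equal restrictions differ by flat functions, so
a partition of unity glues them (`exists_isSrc`). Finally `⋂ I_Z^l` is exactly the ideal of
functions flat along `Z` (`flatOver_of_mem_flatIdeal`, `mem_flatIdeal_of_flatOver`), which turns
equality in `C^∞(T*M, Z)` into equality of Taylor series in charts.

A Boolean `σ` treats both maps at once: `true` is the source; `false` is the target, obtained by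
exchanging holomorphic and antiholomorphic variables and transposing the tensors. -/

theorem two_le_infty : (2 : WithTop ℕ∞) ≤ ∞ := WithTop.coe_le_coe.2 le_top

/-! ### Functions that are flat along the zero section -/

section Flat

open Asymptotics Filter Set

variable {E V Y Z : Type} [NormedAddCommGroup E] [NormedSpace ℝ E] [NormedAddCommGroup V]
  [NormedSpace ℝ V] [NormedAddCommGroup Y] [NormedSpace ℝ Y] [NormedAddCommGroup Z]
  [NormedSpace ℝ Z]

/-- `F` is flat along `{ζ = 0}` at the point `(w, 0)`: it decays there faster than every power of
the fibre variable. -/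
def FlatAt (F : E × V → Y) (w : E) : Prop :=
  ∀ N : ℕ, F =O[𝓝 (w, 0)] fun p => ‖p.2‖ ^ N

variable {F G : E × V → Y} {w : E}

theorem FlatAt.of_isBigO {H : E × V → Z} (hF : FlatAt F w) (h : H =O[𝓝 (w, 0)] F) :
    FlatAt H w := fun N => h.trans (hF N)

theorem FlatAt.congr (hF : FlatAt F w) (h : F =ᶠ[𝓝 (w, 0)] G) : FlatAt G w :=
  fun N => (hF N).congr' h EventuallyEq.rfl

theorem flatAt_zero : FlatAt (fun _ : E × V => (0 : Y)) w := fun _ => isBigO_zero _ _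

theorem FlatAt.add (hF : FlatAt F w) (hG : FlatAt G w) : FlatAt (fun p => F p + G p) w :=
  fun N => (hF N).add (hG N)

theorem FlatAt.sub (hF : FlatAt F w) (hG : FlatAt G w) : FlatAt (fun p => F p - G p) w :=
  fun N => (hF N).sub (hG N)

theorem FlatAt.sum {ι : Type*} {s : Finset ι} {F : ι → E × V → Y}
    (h : ∀ i ∈ s, FlatAt (F i) w) : FlatAt (fun p => ∑ i ∈ s, F i p) w :=
  fun N => by simpa only [Finset.sum_fn] using IsBigO.sum fun i hi => h i hi N

theorem FlatAt.clm_comp (L : Y →L[ℝ] Z) (hF : FlatAt F w) : FlatAt (fun p => L (F p)) w :=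
  hF.of_isBigO (L.isBigO_comp _ _)

theorem FlatAt.smul {c : E × V → ℝ} (hc : ContinuousAt c (w, 0)) (hF : FlatAt F w) :
    FlatAt (fun p => c p • F p) w := by
  intro N
  simpa using (hc.isBigO_one ℝ).smul (hF N)

theorem FlatAt.mul_left {c F : E × V → ℂ} (hc : ContinuousAt c (w, 0)) (hF : FlatAt F w) :
    FlatAt (fun p => c p * F p) w := by
  refine hF.of_isBigO ?_
  simpa using (hc.isBigO_one ℝ).mul (isBigO_refl F (𝓝 (w, 0))).norm_right

theorem FlatAt.eq_zero (hF : FlatAt F w) : F (w, 0) = 0 := by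
  have h := (hF 1).eq_zero_imp.self_of_nhds
  exact h (by simp)

theorem FlatAt.comp {E' V' : Type} [NormedAddCommGroup E'] [NormedSpace ℝ E']
    [NormedAddCommGroup V'] [NormedSpace ℝ V'] {Φ : E' × V' → E × V} {w' : E'}
    (hF : FlatAt F w) (hΦ : ContinuousAt Φ (w', 0)) (h0 : Φ (w', 0) = (w, 0))
    (hb : (fun p => (Φ p).2) =O[𝓝 (w', 0)] fun p => p.2) : FlatAt (fun p => F (Φ p)) w' := by
  intro N
  have ht : Tendsto Φ (𝓝 (w', 0)) (𝓝 (w, 0)) := h0 ▸ hΦ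
  exact ((hF N).comp_tendsto ht).trans (hb.norm_norm.pow N)

theorem FlatAt.hasFDerivAt_zero (hF : FlatAt F w) : HasFDerivAt F (0 : E × V →L[ℝ] Y) (w, 0) := by
  have h : F =O[𝓝 (w, (0 : V))] fun p => ‖p - (w, 0)‖ ^ 2 := by
    refine (hF 2).trans (IsBigO.of_bound 1 (Eventually.of_forall fun p => ?_))
    simp only [norm_pow, norm_norm, one_mul]
    gcongr
    simpa using norm_snd_le (p - (w, (0 : V)))
  exact h.hasFDerivAt (by norm_num)

theorem norm_le_of_norm_apply_le {L : Z →L[ℝ] Y} {r C : ℝ} (hr : 0 < r) (hC : 0 ≤ C)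
    (h : ∀ v, ‖v‖ ≤ r → ‖L v‖ ≤ C * r ^ 2) : ‖L‖ ≤ C * r := by
  refine L.opNorm_le_bound (by positivity) fun v => ?_
  rcases eq_or_ne v 0 with rfl | hv
  · simp
  have hv' : 0 < ‖v‖ := norm_pos_iff.2 hv
  have h1 := h ((r / ‖v‖) • v) (by rw [norm_smul]; simp [abs_of_pos hr, hv'.ne'])
  rw [map_smul, norm_smul, Real.norm_of_nonneg (by positivity), div_mul_eq_mul_div,
    div_le_iff₀ hv'] at h1
  have h2 : r * ‖L v‖ ≤ r * (C * r * ‖v‖) := by nlinarith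
  exact le_of_mul_le_mul_left h2 hr

/-- An interpolation inequality: for a `C²` function, the first derivative at a point is bounded by
`sup |F| / r` plus a Lipschitz constant of the derivative times `r`, for every small step `r`.
Choosing `r = ‖ζ‖^N` makes both terms `O(‖ζ‖^N)`. -/
theorem FlatAt.fderiv (hF : FlatAt F w) (hs : ContDiffAt ℝ 2 F (w, 0)) :
    FlatAt (fderiv ℝ F) w := by
  suffices H : ∀ N : ℕ, 1 ≤ N → _root_.fderiv ℝ F =O[𝓝 (w, 0)] fun p => ‖p.2‖ ^ N by
    intro N
    refine (H (N + 1) (by omega)).trans (IsBigO.of_bound 1 ?_)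
    have : ∀ᶠ p : E × V in 𝓝 (w, 0), ‖p.2‖ < 1 :=
      (continuous_snd.norm.tendsto' (w, (0 : V)) 0 (by simp)).eventually_lt_const one_pos
    filter_upwards [this] with p hp
    rw [one_mul, norm_pow, norm_pow, norm_norm]
    exact pow_le_pow_of_le_one (norm_nonneg _) hp.le (by omega)
  intro N hN
  -- Decay of order `2N` is used because the step will be `r = ‖ζ‖^N` and `F = O(r²)` is needed.
  obtain ⟨C, hC, hb⟩ := (hF (2 * N)).exists_pos
  obtain ⟨δ₁, hδ₁, hb⟩ := Metric.eventually_nhds_iff_ball.1 hb.bound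
  obtain ⟨K, t, ht, hK⟩ := (hs.fderiv_right (m := 1) (by norm_num)).exists_lipschitzOnWith
  obtain ⟨δ₂, hδ₂, hb₂⟩ := Metric.mem_nhds_iff.1 ht
  have hd : ∀ᶠ p in 𝓝 (w, (0 : V)), DifferentiableAt ℝ F p :=
    (hs.eventually (by simp)).mono fun p hp => hp.differentiableAt (by norm_num)
  obtain ⟨δ₃, hδ₃, hb₃⟩ := Metric.eventually_nhds_iff_ball.1 hd
  set δ := min (min δ₁ δ₂) (min δ₃ 1) with hδdef
  have hδ : 0 < δ := by positivity
  -- `K` pays for the remainder of the linear approximation. `C * 4 ^ N` bounds each of two values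
  -- of `F`, taken where the fibre norm is at most twice that of `p`.
  refine IsBigO.of_bound (K + 2 * (C * 4 ^ N)) ?_
  filter_upwards [Metric.ball_mem_nhds (w, (0 : V)) (half_pos hδ)] with p hp
  have hp2 : ‖p.2‖ < δ / 2 := by
    have := norm_snd_le (p - (w, (0 : V)))
    rw [Metric.mem_ball, dist_eq_norm] at hp
    simp only [Prod.snd_sub, sub_zero] at this
    linarith
  have hδ1 : δ ≤ 1 := (min_le_right _ _).trans (min_le_right _ _)
  have hsub : ∀ q ∈ Metric.ball (w, (0 : V)) δ, q ∈ Metric.ball (w, (0 : V)) δ₁ ∧ q ∈ t ∧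
      DifferentiableAt ℝ F q := fun q hq =>
    ⟨Metric.ball_subset_ball ((min_le_left _ _).trans (min_le_left _ _)) hq,
      hb₂ (Metric.ball_subset_ball ((min_le_left _ _).trans (min_le_right _ _)) hq),
      hb₃ q (Metric.ball_subset_ball ((min_le_right _ _).trans (min_le_left _ _)) hq)⟩
  have hpδ : p ∈ Metric.ball (w, (0 : V)) δ := Metric.ball_subset_ball (by linarith) hp
  -- On the zero section no step size is available; there the bound by `‖q.2‖ ^ (2 * N)` with `2N ≥
  -- 2` makes the derivative vanish.
  rcases eq_or_ne p.2 0 with h0 | h0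
  · have hflat : HasFDerivAt F (0 : E × V →L[ℝ] Y) p := by
      have h : F =O[𝓝 p] fun q => ‖q - p‖ ^ 2 := by
        refine IsBigO.of_bound C ?_
        filter_upwards [Metric.isOpen_ball.mem_nhds hpδ, Metric.ball_mem_nhds p one_pos]
          with q hq hq1
        refine (hb q (hsub q hq).1).trans ?_
        have hqp : ‖q.2‖ ≤ ‖q - p‖ := by
          simpa [h0] using norm_snd_le (q - p)
        have h1 : ‖q - p‖ ≤ 1 := by rw [← dist_eq_norm]; exact (Metric.mem_ball.1 hq1).le
        simp only [norm_pow, norm_norm]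
        gcongr
        calc ‖q.2‖ ^ (2 * N) ≤ ‖q - p‖ ^ (2 * N) := by gcongr
          _ ≤ ‖q - p‖ ^ 2 := pow_le_pow_of_le_one (norm_nonneg _) h1 (by omega)
      exact h.hasFDerivAt (by norm_num)
    rw [hflat.fderiv, norm_zero]
    positivity
  have hζ : 0 < ‖p.2‖ := norm_pos_iff.2 h0
  -- Since `N ≥ 1` and `‖p.2‖ < 1`, the step is at most `‖p.2‖ < δ / 2`, so the ball of radius `r`
  -- about `p` stays where all the bounds hold.
  set r := ‖p.2‖ ^ N with hr
  have hr0 : 0 < r := by positivity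
  have hrζ : r ≤ ‖p.2‖ := by
    calc r ≤ ‖p.2‖ ^ 1 := pow_le_pow_of_le_one hζ.le (by linarith) hN
      _ = _ := pow_one _
  have hball : ∀ q ∈ Metric.closedBall p r, q ∈ Metric.ball (w, (0 : V)) δ := by
    intro q hq
    rw [Metric.mem_closedBall] at hq
    rw [Metric.mem_ball] at hp ⊢
    linarith [dist_triangle q p (w, (0 : V))]
  have hFq : ∀ q ∈ Metric.closedBall p r, ‖F q‖ ≤ C * 4 ^ N * r ^ 2 := by
    intro q hq
    have h1 : ‖q.2‖ ≤ 2 * ‖p.2‖ := by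
      have h2 := norm_snd_le (q - p)
      rw [Metric.mem_closedBall, dist_eq_norm] at hq
      have h3 : ‖q.2‖ ≤ ‖p.2‖ + ‖(q - p).2‖ := by
        simpa using norm_add_le p.2 (q - p).2
      linarith
    refine (hb q (hsub q (hball q hq)).1).trans ?_
    simp only [norm_pow, norm_norm]
    calc C * ‖q.2‖ ^ (2 * N) ≤ C * (2 * ‖p.2‖) ^ (2 * N) := by gcongr
      _ = C * 4 ^ N * r ^ 2 := by
        rw [hr, mul_pow, pow_mul 2 2 N, ← pow_mul ‖p.2‖ N 2, mul_comm N 2]; norm_num; ring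
  have hmv : ∀ v, ‖v‖ ≤ r → ‖_root_.fderiv ℝ F p v‖ ≤ (K + 2 * (C * 4 ^ N)) * r ^ 2 := by
    intro v hv
    have hpm : p ∈ Metric.closedBall p r := Metric.mem_closedBall_self hr0.le
    have hqm : p + v ∈ Metric.closedBall p r := by simpa [Metric.mem_closedBall] using hv
    have h1 := (convex_closedBall p r).norm_image_sub_le_of_norm_hasFDerivWithin_le'
      (f := F) (f' := _root_.fderiv ℝ F) (φ := _root_.fderiv ℝ F p) (C := K * r)
      (fun q hq => (hsub q (hball q hq)).2.2.hasFDerivAt.hasFDerivWithinAt)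
      (fun q hq => by
        rw [← dist_eq_norm]
        refine (hK.dist_le_mul _ (hsub q (hball q hq)).2.1 _ (hsub p hpδ).2.1).trans ?_
        gcongr
        exact hq) hpm hqm
    rw [add_sub_cancel_left] at h1
    have h2 := hFq p hpm
    have h3 := hFq _ hqm
    have h4 : ‖_root_.fderiv ℝ F p v‖ ≤ ‖F (p + v) - F p - _root_.fderiv ℝ F p v‖ +
        (‖F (p + v)‖ + ‖F p‖) := by
      have h5 : _root_.fderiv ℝ F p v =
          (F (p + v) - F p) - (F (p + v) - F p - _root_.fderiv ℝ F p v) := by abel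
      calc ‖_root_.fderiv ℝ F p v‖
          = ‖(F (p + v) - F p) - (F (p + v) - F p - _root_.fderiv ℝ F p v)‖ := by rw [← h5]
        _ ≤ ‖F (p + v) - F p‖ + ‖F (p + v) - F p - _root_.fderiv ℝ F p v‖ := norm_sub_le _ _
        _ ≤ _ := by linarith [norm_sub_le (F (p + v)) (F p)]
    have h6 : K * r * ‖v‖ ≤ K * r * r := by gcongr
    nlinarith
  have := norm_le_of_norm_apply_le hr0 (by positivity) hmv
  simpa [hr] using this

theorem FlatAt.fderiv_apply (hF : FlatAt F w) (hs : ContDiffAt ℝ 2 F (w, 0)) (v : E × V) :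
    FlatAt (fun p => _root_.fderiv ℝ F p v) w :=
  (hF.fderiv hs).clm_comp (ContinuousLinearMap.apply ℝ Y v)

/-! ### Division of flat functions -/

/-- Division by `ρ ^ k` costs at most `2k` orders of decay, and a flat function has infinitely many
to spare. -/
theorem FlatAt.inv_smul {ρ : E × V → ℝ} (hF : FlatAt F w)
    (hρ : (fun p => ‖p.2‖ ^ 2) =O[𝓝 (w, 0)] ρ) (k : ℕ) :
    FlatAt (fun p => (ρ p ^ k)⁻¹ • F p) w := by
  intro N
  have h1 : F =O[𝓝 (w, 0)] fun p => ρ p ^ k * ‖p.2‖ ^ N := by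
    refine (hF (2 * k + N)).trans ?_
    simp only [pow_add, pow_mul]
    exact (hρ.pow k).mul (isBigO_refl _ _)
  obtain ⟨C, hC, h2⟩ := h1.exists_pos
  refine IsBigO.of_bound C ?_
  filter_upwards [h2.bound] with p hp
  rw [norm_smul, norm_inv]
  rw [norm_mul] at hp
  calc ‖ρ p ^ k‖⁻¹ * ‖F p‖ ≤ ‖ρ p ^ k‖⁻¹ * (C * (‖ρ p ^ k‖ * ‖‖p.2‖ ^ N‖)) := by gcongr
    _ = (‖ρ p ^ k‖⁻¹ * ‖ρ p ^ k‖) * (C * ‖‖p.2‖ ^ N‖) := by ring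
    -- An inequality, not an equality: where `ρ` vanishes the inverse is `0`.
    _ ≤ 1 * (C * ‖‖p.2‖ ^ N‖) := by gcongr; exact inv_mul_le_one
    _ = _ := one_mul _

/-- The derivative of `ρ^{-k} F` is `ρ^{-k} DF - k ρ^{-(k+1)} Dρ ⊗ F`, a difference of two quotients
of the same kind, again with flat numerators. The induction on the order of smoothness therefore
lets `F`, its target space and `k` vary. -/
theorem contDiffOn_nat_inv_pow_smul {W : Set (E × V)} (hW : IsOpen W) {ρ : E × V → ℝ}
    (hρ : ContDiffOn ℝ ∞ ρ W) (hρ0 : ∀ p ∈ W, p.2 ≠ 0 → ρ p ≠ 0)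
    (hρ2 : ∀ w, (w, 0) ∈ W → (fun p => ‖p.2‖ ^ 2) =O[𝓝 (w, 0)] ρ) (m : ℕ) :
    ∀ {Y : Type} [NormedAddCommGroup Y] [NormedSpace ℝ Y] (F : E × V → Y),
      ContDiffOn ℝ ∞ F W → (∀ w, (w, 0) ∈ W → FlatAt F w) → ∀ k : ℕ,
      ContDiffOn ℝ m (fun p => (ρ p ^ k)⁻¹ • F p) W := by
  induction m with
  | zero =>
    intro Y _ _ F hF hflat k
    refine contDiffOn_zero.2 fun p hp => ContinuousAt.continuousWithinAt ?_
    rcases eq_or_ne p.2 0 with h0 | h0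
    · obtain ⟨w, ζ⟩ := p
      obtain rfl : ζ = 0 := h0
      exact ((hflat w hp).inv_smul (hρ2 w hp) k).hasFDerivAt_zero.continuousAt
    · have h1 := (hρ.contDiffAt (hW.mem_nhds hp)).continuousAt
      have h2 := (hF.contDiffAt (hW.mem_nhds hp)).continuousAt
      exact ((h1.pow k).inv₀ (pow_ne_zero k (hρ0 p hp h0))).smul h2
  | succ m ih =>
    intro Y _ _ F hF hflat k
    have hF' : ContDiffOn ℝ ∞ (_root_.fderiv ℝ F) W := hF.fderiv_of_isOpen hW (by simp)
    have hρ' : ContDiffOn ℝ ∞ (_root_.fderiv ℝ ρ) W := hρ.fderiv_of_isOpen hW (by simp)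
    set H : E × V → (E × V →L[ℝ] Y) :=
      fun p => (k : ℝ) • (_root_.fderiv ℝ ρ p).smulRight (F p) with hH
    have hHs : ContDiffOn ℝ ∞ H W := (hρ'.smulRight hF).const_smul (k : ℝ)
    have hat : ∀ p ∈ W, ContDiffAt ℝ ∞ F p := fun p hp => hF.contDiffAt (hW.mem_nhds hp)
    have hHf : ∀ w, (w, 0) ∈ W → FlatAt H w := by
      intro w hw
      have hc := (hρ'.contDiffAt (hW.mem_nhds hw)).continuousAt
      refine (hflat w hw).of_isBigO ?_
      obtain ⟨C, hC⟩ := (hc.isBigO_one ℝ).bound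
      refine IsBigO.of_bound (‖(k : ℝ)‖ * C) ?_
      filter_upwards [hC] with p hp
      rw [hH, norm_smul, ContinuousLinearMap.norm_smulRight_apply, mul_assoc]
      gcongr
      simpa using hp
    have hder : ∀ p ∈ W, HasFDerivAt (fun p => (ρ p ^ k)⁻¹ • F p)
        ((ρ p ^ k)⁻¹ • _root_.fderiv ℝ F p - (ρ p ^ (k + 1))⁻¹ • H p) p := by
      intro p hp
      rcases eq_or_ne p.2 0 with h0 | h0
      · obtain ⟨w, ζ⟩ := p
        obtain rfl : ζ = 0 := h0
        have h1 := ((hflat w hp).inv_smul (hρ2 w hp) k).hasFDerivAt_zero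
        have h2 : _root_.fderiv ℝ F (w, 0) = 0 := (hflat w hp).hasFDerivAt_zero.fderiv
        have h3 : H (w, 0) = 0 := (hHf w hp).eq_zero
        rw [h2, h3, smul_zero, smul_zero, sub_zero]
        exact h1
      · have hne := hρ0 p hp h0
        have h1 := ((hρ.contDiffAt (hW.mem_nhds hp)).differentiableAt (by simp)).hasFDerivAt
        have h2 := ((hat p hp).differentiableAt (by simp)).hasFDerivAt
        have h3 := ((hasDerivAt_inv (pow_ne_zero k hne)).comp_hasFDerivAt p (h1.pow k)).smul h2
        refine h3.congr_fderiv ?_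
        refine ContinuousLinearMap.ext fun v => ?_
        -- The exponent `k - 1` is truncated at `k = 0`, which is harmless because of the factor
        -- `k`.
        have hk : ((ρ p ^ k) ^ 2)⁻¹ * (k * ρ p ^ (k - 1)) = (ρ p ^ (k + 1))⁻¹ * k := by
          rcases k with _ | k
          · simp
          · simp only [Nat.add_sub_cancel]
            field_simp
            ring
        simp only [hH, FunLike.coe_add, FunLike.coe_smul, FunLike.coe_sub, Pi.add_apply,
          Pi.smul_apply, Pi.sub_apply, ContinuousLinearMap.smulRight_apply, Function.comp,
          smul_eq_mul, smul_smul, nsmul_eq_mul]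
        rw [← hk, sub_eq_add_neg, ← neg_smul]
        ring_nf
    have hd1 := ih (_root_.fderiv ℝ F) hF'
      (fun w hw => (hflat w hw).fderiv ((hat _ hw).of_le two_le_infty)) k
    have hd2 := ih H hHs hHf (k + 1)
    rw [show ((m + 1 : ℕ) : WithTop ℕ∞) = m + 1 by simp, contDiffOn_succ_iff_fderiv_of_isOpen hW]
    refine ⟨fun p hp => (hder p hp).differentiableAt.differentiableWithinAt, by simp, ?_⟩
    exact (hd1.sub hd2).congr fun p hp => (hder p hp).fderiv

theorem contDiffOn_inv_pow_smul {W : Set (E × V)} (hW : IsOpen W) {ρ : E × V → ℝ}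
    (hρ : ContDiffOn ℝ ∞ ρ W) (hρ0 : ∀ p ∈ W, p.2 ≠ 0 → ρ p ≠ 0)
    (hρ2 : ∀ w, (w, 0) ∈ W → (fun p => ‖p.2‖ ^ 2) =O[𝓝 (w, 0)] ρ)
    (hF : ContDiffOn ℝ ∞ F W) (hflat : ∀ w, (w, 0) ∈ W → FlatAt F w) (k : ℕ) :
    ContDiffOn ℝ ∞ (fun p => (ρ p ^ k)⁻¹ • F p) W :=
  contDiffOn_infty.2 fun m => contDiffOn_nat_inv_pow_smul hW hρ hρ0 hρ2 m F hF hflat k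

end Flat

/-! ### Coordinates on the cotangent bundle -/

section CotangentCoordinates

open Set Filter

variable {n : ℕ}

variable {M : Type*} [TopologicalSpace M] [ChartedSpace (Cn n) M] [IsManifold 𝓘(ℂ, Cn n) ω M]

theorem contDiffOn_chart_comp_symm {φ ψ : OpenPartialHomeomorph M (Cn n)} (hφ : φ ∈ holCharts n M)
    (hψ : ψ ∈ holCharts n M) : ContDiffOn ℂ ω (ψ ∘ φ.symm) (φ.symm ≫ₕ ψ).source := by
  have h := StructureGroupoid.compatible_of_mem_maximalAtlas hφ hψ
  rw [contDiffGroupoid, mem_groupoid_of_pregroupoid] at h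
  simpa [contDiffPregroupoid] using h.1

theorem mem_real_maximalAtlas {φ : OpenPartialHomeomorph M (Cn n)} (hφ : φ ∈ holCharts n M) :
    φ ∈ IsManifold.maximalAtlas 𝓘(ℝ, Cn n) ∞ M := by
  have key : ∀ {e e' : OpenPartialHomeomorph M (Cn n)}, e ∈ holCharts n M → e' ∈ holCharts n M →
      ContDiffOn ℝ ∞ (e.symm ≫ₕ e') (e.symm ≫ₕ e').source := fun he he' =>
    ((contDiffOn_chart_comp_symm he he').restrict_scalars ℝ).of_le le_top
  rw [IsManifold.maximalAtlas, mem_maximalAtlas_iff]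
  intro e he
  have he' : e ∈ holCharts n M := StructureGroupoid.subset_maximalAtlas _ he
  constructor <;>
  · rw [contDiffGroupoid, mem_groupoid_of_pregroupoid]
    constructor
    · simpa [contDiffPregroupoid] using key (by assumption) (by assumption)
    · simpa [contDiffPregroupoid] using key (by assumption) (by assumption)

theorem contMDiffOn_chart {φ : OpenPartialHomeomorph M (Cn n)} (hφ : φ ∈ holCharts n M) :
    ContMDiffOn 𝓘(ℝ, Cn n) 𝓘(ℝ, Cn n) ∞ φ φ.source :=
  contMDiffOn_of_mem_maximalAtlas (mem_real_maximalAtlas hφ)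

theorem contMDiffOn_chart_symm {φ : OpenPartialHomeomorph M (Cn n)} (hφ : φ ∈ holCharts n M) :
    ContMDiffOn 𝓘(ℝ, Cn n) 𝓘(ℝ, Cn n) ∞ φ.symm φ.target :=
  contMDiffOn_symm_of_mem_maximalAtlas (mem_real_maximalAtlas hφ)

theorem mdifferentiableAt_chart {φ : OpenPartialHomeomorph M (Cn n)} (hφ : φ ∈ holCharts n M)
    {x : M} (hx : x ∈ φ.source) : MDifferentiableAt 𝓘(ℝ, Cn n) 𝓘(ℝ, Cn n) φ x :=
  ((contMDiffOn_chart hφ).contMDiffAt (φ.open_source.mem_nhds hx)).mdifferentiableAt (by simp)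

theorem mdifferentiableAt_chart_symm {φ : OpenPartialHomeomorph M (Cn n)} (hφ : φ ∈ holCharts n M)
    {w : Cn n} (hw : w ∈ φ.target) : MDifferentiableAt 𝓘(ℝ, Cn n) 𝓘(ℝ, Cn n) φ.symm w :=
  ((contMDiffOn_chart_symm hφ).contMDiffAt (φ.open_target.mem_nhds hw)).mdifferentiableAt (by simp)

theorem chartAt_mem_holCharts (x : M) : chartAt (Cn n) x ∈ holCharts n M :=
  IsManifold.chart_mem_maximalAtlas x

theorem contDiffOn_real_chart_comp_symm {φ ψ : OpenPartialHomeomorph M (Cn n)}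
    (hφ : φ ∈ holCharts n M) (hψ : ψ ∈ holCharts n M) :
    ContDiffOn ℝ ∞ (ψ ∘ φ.symm) (φ.symm ≫ₕ ψ).source :=
  ((contDiffOn_chart_comp_symm hφ hψ).restrict_scalars ℝ).of_le le_top

theorem mfderiv_chart_apply {φ ψ : OpenPartialHomeomorph M (Cn n)} (hφ : φ ∈ holCharts n M)
    (hψ : ψ ∈ holCharts n M) {x : M} (hx : x ∈ φ.source) (hx' : x ∈ ψ.source)
    (v : TangentSpace 𝓘(ℝ, Cn n) x) :
    mfderiv 𝓘(ℝ, Cn n) 𝓘(ℝ, Cn n) ψ x v =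
      fderiv ℝ (ψ ∘ φ.symm) (φ x) (mfderiv 𝓘(ℝ, Cn n) 𝓘(ℝ, Cn n) φ x v) := by
  have h1 : MDifferentiableAt 𝓘(ℝ, Cn n) 𝓘(ℝ, Cn n) (ψ ∘ φ.symm) (φ x) := by
    rw [mdifferentiableAt_iff_differentiableAt]
    refine ((contDiffOn_real_chart_comp_symm hφ hψ).contDiffAt
      ((φ.symm ≫ₕ ψ).open_source.mem_nhds ?_)).differentiableAt (by simp)
    simp [hx, hx']
  have h2 := mfderiv_comp x h1 (mdifferentiableAt_chart hφ hx)
  have h3 : mfderiv 𝓘(ℝ, Cn n) 𝓘(ℝ, Cn n) ((ψ ∘ φ.symm) ∘ φ) x =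
      mfderiv 𝓘(ℝ, Cn n) 𝓘(ℝ, Cn n) ψ x := by
    refine Filter.EventuallyEq.mfderiv_eq ?_
    filter_upwards [φ.open_source.mem_nhds hx] with y hy
    simp [hy]
  rw [mfderiv_eq_fderiv] at h2
  exact (congrArg (fun L => L v) h3).symm.trans (congrArg (fun L => L v) h2)

theorem mfderiv_chart_comp_symm {φ : OpenPartialHomeomorph M (Cn n)} (hφ : φ ∈ holCharts n M)
     {w : Cn n} (hw : w ∈ φ.target) (v : Cn n) :
    mfderiv 𝓘(ℝ, Cn n) 𝓘(ℝ, Cn n) φ (φ.symm w) (mfderiv 𝓘(ℝ, Cn n) 𝓘(ℝ, Cn n) φ.symm w v) = v := by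
  have hd : φ.MDifferentiable 𝓘(ℝ, Cn n) 𝓘(ℝ, Cn n) :=
    ⟨fun x hx => (mdifferentiableAt_chart hφ hx).mdifferentiableWithinAt,
      fun w hw => (mdifferentiableAt_chart_symm hφ hw).mdifferentiableWithinAt⟩
  exact congrArg (fun L => L v) (hd.comp_symm_deriv hw)

theorem mfderiv_chart_symm_comp {φ : OpenPartialHomeomorph M (Cn n)} (hφ : φ ∈ holCharts n M)
     {x : M} (hx : x ∈ φ.source) (v : TangentSpace 𝓘(ℝ, Cn n) x) :
    mfderiv 𝓘(ℝ, Cn n) 𝓘(ℝ, Cn n) φ.symm (φ x) (mfderiv 𝓘(ℝ, Cn n) 𝓘(ℝ, Cn n) φ x v) = v := by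
  have hd : φ.MDifferentiable 𝓘(ℝ, Cn n) 𝓘(ℝ, Cn n) :=
    ⟨fun x hx => (mdifferentiableAt_chart hφ hx).mdifferentiableWithinAt,
      fun w hw => (mdifferentiableAt_chart_symm hφ hw).mdifferentiableWithinAt⟩
  exact congrArg (fun L => L v) (hd.symm_comp_deriv hx)

/-- Makes the abstract trivialization of the cotangent bundle explicit: it pulls a covector back by
the inverse of the preferred chart. Smoothness of maps into the bundle can then be read off in
coordinates. -/
theorem inCoordinates_cotangent {x₀ x : M} (hx : x ∈ (chartAt (Cn n) x₀).source)
   (α : TangentSpace 𝓘(ℝ, Cn n) x →L[ℝ] Trivial M ℝ x) (v : Cn n) :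
   ContinuousLinearMap.inCoordinates (Cn n) (fun x : M => TangentSpace 𝓘(ℝ, Cn n) x) ℝ (Trivial M ℝ) x₀ x x₀ x α v
    = α (mfderiv 𝓘(ℝ, Cn n) 𝓘(ℝ, Cn n) (chartAt (Cn n) x₀).symm (chartAt (Cn n) x₀ x) v) := by
  have h := TangentBundle.symmL_trivializationAt (I := 𝓘(ℝ, Cn n)) hx
  simp only [mfld_simps, mfderivWithin_univ] at h
  have h2 := congrArg (fun L => α (L v)) h
  refine Eq.trans ?_ h2
  have h3 : Trivialization.continuousLinearMapAt ℝ (trivializationAt ℝ (Trivial M ℝ) x₀) x =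
      ContinuousLinearMap.id ℝ ℝ := by
    simp
  exact congrArg (fun L => L (α (Trivialization.symmL ℝ (trivializationAt (Cn n) (TangentSpace 𝓘(ℝ, Cn n)) x₀) x v))) h3

/-- The fibre coordinates `ζ` of a covector in the chart `φ`. -/
def fibreCoord (φ : OpenPartialHomeomorph M (Cn n)) (p : Cotangent n M) : Cn n := fun k =>
  ((p.2 (mfderiv 𝓘(ℝ, Cn n) 𝓘(ℝ, Cn n) φ.symm (φ p.1) (Pi.single k 1 : Cn n)) : ℝ) -
    Complex.I * (p.2 (mfderiv 𝓘(ℝ, Cn n) 𝓘(ℝ, Cn n) φ.symm (φ p.1)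
      (Pi.single k Complex.I : Cn n)) : ℝ)) / 2

/-- The coordinates `(z, ζ)` on `T*M` given by the chart `φ`. -/
def cotangentCoord (φ : OpenPartialHomeomorph M (Cn n)) (p : Cotangent n M) : Cn n × Cn n :=
  (φ p.1, fibreCoord φ p)

theorem covector_apply (ζ v : Cn n) : covector ζ v = 2 * (∑ k, ζ k * v k).re := by
  simp [covector]

theorem cotangentCoord_cotangentPoint {φ : OpenPartialHomeomorph M (Cn n)} (hφ : φ ∈ holCharts n M)
    {w : Cn n} (hw : w ∈ φ.target) (ζ : Cn n) :
    cotangentCoord φ (cotangentPoint φ w ζ) = (w, ζ) := by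
  have h1 : φ (cotangentPoint φ w ζ).1 = w := φ.right_inv hw
  refine Prod.ext h1 (funext fun k => ?_)
  have h2 : ∀ v : Cn n, (cotangentPoint φ w ζ).2 (mfderiv 𝓘(ℝ, Cn n) 𝓘(ℝ, Cn n) φ.symm
      (φ (cotangentPoint φ w ζ).1) v) = covector ζ v := by
    intro v
    rw [h1]
    exact congrArg (covector ζ) (mfderiv_chart_comp_symm hφ hw v)
  change (((_ : ℝ) : ℂ) - Complex.I * ((_ : ℝ) : ℂ)) / 2 = _
  rw [h2, h2, covector_apply, covector_apply]
  simp [Pi.single_apply]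
  apply Complex.ext <;> simp

/-- A real covector is determined by its values on `e_k` and `i e_k`, which are twice the real part
and minus twice the imaginary part of `ζ_k`. -/
theorem covector_ext {α : Cn n →L[ℝ] ℝ} {ζ : Cn n}
    (h : ∀ k, ζ k = ((α (Pi.single k 1) : ℝ) - Complex.I * (α (Pi.single k Complex.I) : ℝ)) / 2) :
    covector ζ = α := by
  ext v
  have hv : v = ∑ k, ((v k).re • (Pi.single k 1 : Cn n) +
      (v k).im • (Pi.single k Complex.I : Cn n)) := by
    ext j
    simp only [Finset.sum_apply, Pi.add_apply, Pi.smul_apply, Pi.single_apply, smul_ite, smul_zero,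
      Finset.sum_add_distrib, Finset.sum_ite_eq, Finset.mem_univ, if_true]
    apply Complex.ext <;> simp
  conv_rhs => rw [hv]
  rw [covector_apply, map_sum, Complex.re_sum, Finset.mul_sum]
  refine Finset.sum_congr rfl fun k _ => ?_
  rw [map_add, map_smul, map_smul, h k]
  simp
  ring

theorem cotangentPoint_cotangentCoord {φ : OpenPartialHomeomorph M (Cn n)} (hφ : φ ∈ holCharts n M)
    {p : Cotangent n M} (hp : p.1 ∈ φ.source) :
    cotangentPoint φ (φ p.1) (fibreCoord φ p) = p := by
  obtain ⟨x, α⟩ := p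
  have h1 : covector (fibreCoord φ ⟨x, α⟩) =
      (α.comp (mfderiv 𝓘(ℝ, Cn n) 𝓘(ℝ, Cn n) φ.symm (φ x)) : Cn n →L[ℝ] ℝ) :=
    covector_ext fun k => rfl
  have h2 : ∀ (β : Cn n →L[ℝ] ℝ) (y : M), y = x →
      (⟨y, β.comp (mfderiv 𝓘(ℝ, Cn n) 𝓘(ℝ, Cn n) φ y)⟩ : Cotangent n M) =
        ⟨x, β.comp (mfderiv 𝓘(ℝ, Cn n) 𝓘(ℝ, Cn n) φ x)⟩ := by
    rintro β y rfl; rfl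
  refine (h2 _ _ (φ.left_inv hp)).trans ?_
  rw [h1]
  refine congrArg (TotalSpace.mk x) (ContinuousLinearMap.ext fun v => ?_)
  exact congrArg α (mfderiv_chart_symm_comp hφ hp v)

theorem contDiff_covector : ContDiff ℝ ∞ (covector : Cn n → Cn n →L[ℝ] ℝ) := by
  have h : IsLinearMap ℝ (covector : Cn n → Cn n →L[ℝ] ℝ) := by
    constructor
    · intro a b; ext v
      simp [covector_apply, add_mul, Finset.sum_add_distrib, mul_add]
    · intro c a; ext v
      simp [covector_apply, mul_assoc, ← Finset.mul_sum]
      ring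
  exact (LinearMap.toContinuousLinearMap h.mk').contDiff

theorem contMDiffAt_cotangentPoint {φ : OpenPartialHomeomorph M (Cn n)} (hφ : φ ∈ holCharts n M)
    {p : Cn n × Cn n} (hp : p.1 ∈ φ.target) :
    ContMDiffAt 𝓘(ℝ, Cn n × Cn n) (cotangentModel n) ∞
      (fun q : Cn n × Cn n => cotangentPoint (M := M) φ q.1 q.2) p := by
  have hb : ContMDiffAt 𝓘(ℝ, Cn n × Cn n) 𝓘(ℝ, Cn n) ∞ (fun q : Cn n × Cn n => φ.symm q.1) p :=
    ContMDiffAt.comp p ((contMDiffOn_chart_symm hφ).contMDiffAt (φ.open_target.mem_nhds hp))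
      contDiff_fst.contMDiff.contMDiffAt
  refine (contMDiffAt_hom_bundle _).2 ⟨hb, ?_⟩
  -- The bundle is trivialized by the preferred chart `c`, not by `φ`; in it the covector becomes
  -- `covector ζ` composed with the derivative of `φ ∘ c.symm`, which depends smoothly on the point.
  set c := chartAt (Cn n) (φ.symm p.1) with hc
  have hcm : c ∈ holCharts n M := chartAt_mem_holCharts _
  have hsm : ContDiffAt ℝ ∞ (fun q : Cn n × Cn n =>
      (covector q.2).comp (fderiv ℝ (φ ∘ c.symm) (c (φ.symm q.1)))) p := by
    have hp1 : p.1 ∈ (φ.symm ≫ₕ c).source := by simp [hp, hc]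
    have h1 : ContDiffAt ℝ ∞ (fun q : Cn n × Cn n => c (φ.symm q.1)) p :=
      ContDiffAt.comp (g := c ∘ φ.symm) p ((contDiffOn_real_chart_comp_symm hφ hcm).contDiffAt
        ((φ.symm ≫ₕ c).open_source.mem_nhds hp1)) contDiff_fst.contDiffAt
    have h2 : ContDiffAt ℝ ∞ (fderiv ℝ (φ ∘ c.symm)) (c (φ.symm p.1)) := by
      refine ((contDiffOn_real_chart_comp_symm hcm hφ).fderiv_of_isOpen
        (c.symm ≫ₕ φ).open_source (m := ∞) (by simp)).contDiffAt
        ((c.symm ≫ₕ φ).open_source.mem_nhds ?_)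
      simp [hc, hp]
    exact (contDiff_covector.contDiffAt.comp p contDiff_snd.contDiffAt).clm_comp
      (ContDiffAt.comp p h2 h1)
  refine hsm.contMDiffAt.congr_of_eventuallyEq ?_
  have hev : ∀ᶠ q : Cn n × Cn n in 𝓝 p, q.1 ∈ (φ.symm ≫ₕ c).source :=
    continuous_fst.continuousAt.eventually
      ((φ.symm ≫ₕ c).open_source.mem_nhds (by simp [hp, hc]))
  filter_upwards [hev] with q hq
  have hq1 : q.1 ∈ φ.target := by simpa using hq.1
  have hq2 : φ.symm q.1 ∈ c.source := by simpa using hq.2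
  refine ContinuousLinearMap.ext fun v => ?_
  refine (inCoordinates_cotangent (x₀ := φ.symm p.1) hq2 _ v).trans ?_
  have h3 := mfderiv_chart_apply hcm hφ hq2 (φ.map_target hq1)
    (mfderiv 𝓘(ℝ, Cn n) 𝓘(ℝ, Cn n) c.symm (c (φ.symm q.1)) v)
  have h4 := mfderiv_chart_comp_symm hcm (c.map_source hq2) v
  rw [c.left_inv hq2] at h4
  refine (congrArg (covector q.2) h3).trans ?_
  exact congrArg (fun u => covector q.2 (fderiv ℝ (φ ∘ c.symm) (c (φ.symm q.1)) u)) h4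

theorem contMDiffAt_cotangentCoord {φ : OpenPartialHomeomorph M (Cn n)} (hφ : φ ∈ holCharts n M)
    {p : Cotangent n M} (hp : p.1 ∈ φ.source) :
    ContMDiffAt (cotangentModel n) 𝓘(ℝ, Cn n × Cn n) ∞ (cotangentCoord φ) p := by
  have hpr : ContMDiffAt (cotangentModel n) 𝓘(ℝ, Cn n) ∞ (fun q : Cotangent n M => q.1) p :=
    (contMDiff_proj (fun x : M => TangentSpace 𝓘(ℝ, Cn n) x →L[ℝ] Trivial M ℝ x)).contMDiffAt
  have hb : ContMDiffAt (cotangentModel n) 𝓘(ℝ, Cn n) ∞ (fun q : Cotangent n M => φ q.1) p :=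
    ContMDiffAt.comp p ((contMDiffOn_chart hφ).contMDiffAt (φ.open_source.mem_nhds hp)) hpr
  set c := chartAt (Cn n) p.1 with hc
  have hcm : c ∈ holCharts n M := chartAt_mem_holCharts _
  have hA := ((contMDiffAt_hom_bundle (n := ∞) (IM := cotangentModel n) (IB := 𝓘(ℝ, Cn n))
    (fun q : Cotangent n M => q) (x₀ := p)).1 contMDiffAt_id).2
  have h2 : ContDiffAt ℝ ∞ (fderiv ℝ (c ∘ φ.symm)) (φ p.1) := by
    refine ((contDiffOn_real_chart_comp_symm hφ hcm).fderiv_of_isOpen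
      (φ.symm ≫ₕ c).open_source (m := ∞) (by simp)).contDiffAt
      ((φ.symm ≫ₕ c).open_source.mem_nhds ?_)
    simp [hc, hp]
  have h3 : ContMDiffAt (cotangentModel n) 𝓘(ℝ, Cn n →L[ℝ] Cn n) ∞
      (fun q : Cotangent n M => fderiv ℝ (c ∘ φ.symm) (φ q.1)) p :=
    ContMDiffAt.comp (I' := 𝓘(ℝ, Cn n)) p h2.contMDiffAt hb
  have hβ := hA.clm_comp h3
  have hsec : ContMDiffAt (cotangentModel n) 𝓘(ℝ, Cn n) ∞ (fibreCoord φ) p := by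
    have hL : ContDiff ℝ ∞ (fun β : Cn n →L[ℝ] ℝ => (fun k : Fin n =>
        (((β (Pi.single k 1) : ℝ) : ℂ) - Complex.I * (β (Pi.single k Complex.I) : ℝ)) / 2)) := by
      refine contDiff_pi.2 fun k => ?_
      have hk : ∀ v : Cn n, ContDiff ℝ ∞ (fun β : Cn n →L[ℝ] ℝ => ((β v : ℝ) : ℂ)) := fun v =>
        Complex.ofRealCLM.contDiff.comp (ContinuousLinearMap.apply ℝ ℝ v).contDiff
      exact ((hk _).sub (contDiff_const.mul (hk _))).div_const 2
    refine (ContMDiffAt.comp p hL.contMDiff.contMDiffAt hβ).congr_of_eventuallyEq ?_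
    have hev : ∀ᶠ q : Cotangent n M in 𝓝 p, q.1 ∈ φ.source ∩ c.source :=
      hpr.continuousAt.eventually
        ((φ.open_source.inter c.open_source).mem_nhds ⟨hp, mem_chart_source _ _⟩)
    filter_upwards [hev] with q hq
    have key : ∀ v : Cn n, ContinuousLinearMap.inCoordinates (Cn n)
        (fun x : M => TangentSpace 𝓘(ℝ, Cn n) x) ℝ (Trivial M ℝ) p.1 q.1 p.1 q.1 q.2
        (fderiv ℝ (c ∘ φ.symm) (φ q.1) v) =
        q.2 (mfderiv 𝓘(ℝ, Cn n) 𝓘(ℝ, Cn n) φ.symm (φ q.1) v) := by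
      intro v
      refine (inCoordinates_cotangent (x₀ := p.1) hq.2 _ _).trans ?_
      have h4 := mfderiv_chart_apply hφ hcm hq.1 hq.2
        (mfderiv 𝓘(ℝ, Cn n) 𝓘(ℝ, Cn n) φ.symm (φ q.1) v)
      have h5 := mfderiv_chart_comp_symm hφ (φ.map_source hq.1) v
      rw [φ.left_inv hq.1] at h5
      have h6 := mfderiv_chart_symm_comp hcm hq.2
        (mfderiv 𝓘(ℝ, Cn n) 𝓘(ℝ, Cn n) φ.symm (φ q.1) v)
      refine congrArg q.2 (Eq.trans ?_ h6)
      refine congrArg (mfderiv 𝓘(ℝ, Cn n) 𝓘(ℝ, Cn n) c.symm (c q.1)) (Eq.trans ?_ h4.symm)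
      exact congrArg (fderiv ℝ (c ∘ φ.symm) (φ q.1)) h5.symm
    refine funext fun k => ?_
    refine congrArg₂ (fun a b : ℝ => ((a : ℂ) - Complex.I * (b : ℂ)) / 2) ?_ ?_
    · exact (key _).symm
    · exact (key _).symm
  exact hb.prodMk_space hsec

end CotangentCoordinates

/-! ### Change of coordinates and invariance of the canonical bracket -/

section CoordinateChange

open Set Filter

variable {n : ℕ}

/-- The operator `(∂_v + s ∂_{iv}) / 2`: for `s = -i` it is the derivative along the
`(1,0)`-part of the vector `v`, for `s = i` along its `(0,1)`-part. -/
def wirt (s : ℂ) (v : Cn n × Cn n) (F : Cn n × Cn n → ℂ) (p : Cn n × Cn n) : ℂ :=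
  (fderiv ℝ F p v + s * fderiv ℝ F p (Complex.I • v)) / 2

/-- The vector `∂/∂z^k`. -/
def baseVec (k : Fin n) : Cn n × Cn n := (Pi.single k 1, 0)

/-- The vector `∂/∂ζ_k`. -/
def fibreVec (k : Fin n) : Cn n × Cn n := (0, Pi.single k 1)

theorem sum_smul_baseVec_add (u : Cn n × Cn n) :
    u = ∑ k, (u.1 k • baseVec k + u.2 k • fibreVec k) := by
  refine Prod.ext (funext fun j => ?_) (funext fun j => ?_) <;>
  simp [baseVec, fibreVec, Prod.fst_sum, Prod.snd_sum, Finset.sum_apply, Pi.single_apply]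

/-- The (1,0)-derivative is complex linear in the direction, so it expands in the complex basis. -/
theorem wirt_neg_I (u : Cn n × Cn n) (F : Cn n × Cn n → ℂ) (p : Cn n × Cn n) :
    wirt (-Complex.I) u F p = ∑ k, (u.1 k * wirt (-Complex.I) (baseVec k) F p +
      u.2 k * wirt (-Complex.I) (fibreVec k) F p) := by
  let ℓ : Cn n × Cn n →ₗ[ℂ] ℂ :=
    { toFun := fun v => wirt (-Complex.I) v F p
      map_add' := fun a b => by simp only [wirt, smul_add, map_add]; ring
      map_smul' := fun c a => by
        have hc : ∀ v : Cn n × Cn n, c • v = c.re • v + c.im • (Complex.I • v) := fun v => by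
          rw [← Complex.coe_smul, ← Complex.coe_smul, smul_smul, ← add_smul, Complex.re_add_im]
        simp only [wirt, RingHom.id_apply, smul_eq_mul]
        rw [smul_comm Complex.I c a, hc a, hc (Complex.I • a), smul_smul Complex.I Complex.I]
        simp only [map_add, map_smul, Complex.I_mul_I, neg_one_smul, map_neg, Complex.real_smul]
        rw [show c = c.re + c.im * Complex.I from (Complex.re_add_im c).symm]
        simp only [Complex.add_re, Complex.ofReal_re, Complex.mul_re, Complex.ofReal_im,
          Complex.I_re, Complex.I_im, Complex.add_im, Complex.mul_im]
        ring_nf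
        rw [Complex.I_sq]
        ring_nf }
  have h : ℓ u = _ := congrArg ℓ (sum_smul_baseVec_add u)
  refine h.trans ?_
  rw [map_sum]
  exact Finset.sum_congr rfl fun k _ => by rw [map_add, map_smul, map_smul]; rfl

/-- The (0,1)-derivative is conjugate linear in the direction, hence the conjugated components. -/
theorem wirt_I (u : Cn n × Cn n) (F : Cn n × Cn n → ℂ) (p : Cn n × Cn n) :
    wirt Complex.I u F p = ∑ k, ((starRingEnd ℂ) (u.1 k) * wirt Complex.I (baseVec k) F p +
      (starRingEnd ℂ) (u.2 k) * wirt Complex.I (fibreVec k) F p) := by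
  let ℓ : Cn n × Cn n →ₛₗ[starRingEnd ℂ] ℂ :=
    { toFun := fun v => wirt Complex.I v F p
      map_add' := fun a b => by simp only [wirt, smul_add, map_add]; ring
      map_smul' := fun c a => by
        have hc : ∀ v : Cn n × Cn n, c • v = c.re • v + c.im • (Complex.I • v) := fun v => by
          rw [← Complex.coe_smul, ← Complex.coe_smul, smul_smul, ← add_smul, Complex.re_add_im]
        have hc' : (starRingEnd ℂ) c = c.re - c.im * Complex.I := by
          apply Complex.ext <;> simp
        simp only [wirt, smul_eq_mul]
        rw [smul_comm Complex.I c a, hc a, hc (Complex.I • a), smul_smul Complex.I Complex.I, hc']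
        simp only [map_add, map_smul, Complex.I_mul_I, neg_one_smul, map_neg, Complex.real_smul]
        ring_nf
        rw [Complex.I_sq]
        ring_nf }
  have h : ℓ u = _ := congrArg ℓ (sum_smul_baseVec_add u)
  refine h.trans ?_
  rw [map_sum]
  exact Finset.sum_congr rfl fun k _ => by rw [map_add, map_smulₛₗ, map_smulₛₗ]; rfl

/-- The derivative of `Φ` is complex linear, so it commutes with multiplication by `i` and does not
mix the two types. -/
theorem wirt_comp {s : ℂ} {v : Cn n × Cn n} {F : Cn n × Cn n → ℂ} {Φ : Cn n × Cn n → Cn n × Cn n}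
    {p : Cn n × Cn n} {L : Cn n × Cn n →L[ℂ] Cn n × Cn n} (hΦ : HasFDerivAt Φ L p)
    (hF : DifferentiableAt ℝ F (Φ p)) : wirt s v (fun q => F (Φ q)) p = wirt s (L v) F (Φ p) := by
  have h := (hF.hasFDerivAt.comp p (hΦ.restrictScalars ℝ)).fderiv
  have h' : ∀ u, fderiv ℝ (fun q => F (Φ q)) p u = fderiv ℝ F (Φ p) (L u) := fun u =>
    congrArg (fun T => T u) h
  simp only [wirt, h', map_smul]

/-- The canonical Poisson bracket of functions of `(z, ζ)`. -/
def poisson (F G : Cn n × Cn n → ℂ) (p : Cn n × Cn n) : ℂ :=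
  ∑ k, (wirt (-Complex.I) (fibreVec k) F p * wirt (-Complex.I) (baseVec k) G p -
    wirt (-Complex.I) (baseVec k) F p * wirt (-Complex.I) (fibreVec k) G p +
    wirt Complex.I (fibreVec k) F p * wirt Complex.I (baseVec k) G p -
    wirt Complex.I (baseVec k) F p * wirt Complex.I (fibreVec k) G p)

theorem dz_base_eq_wirt {F : Cn n × Cn n → ℂ} {p : Cn n × Cn n} (hF : DifferentiableAt ℝ F p)
    (k : Fin n) : dz k (fun v => F (v, p.2)) p.1 = wirt (-Complex.I) (baseVec k) F p := by
  have h := (hF.hasFDerivAt.comp p.1 (hasFDerivAt_prodMk_left (𝕜 := ℝ) p.1 p.2)).fderiv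
  have h' : ∀ u, fderiv ℝ (fun v => F (v, p.2)) p.1 u = fderiv ℝ F p (u, 0) := fun u =>
    congrArg (fun T => T u) h
  simp [dz, wirt, h', baseVec, Prod.smul_mk, sub_eq_add_neg, ← Pi.single_smul]

theorem dzbar_base_eq_wirt {F : Cn n × Cn n → ℂ} {p : Cn n × Cn n} (hF : DifferentiableAt ℝ F p)
    (k : Fin n) : dzbar k (fun v => F (v, p.2)) p.1 = wirt Complex.I (baseVec k) F p := by
  have h := (hF.hasFDerivAt.comp p.1 (hasFDerivAt_prodMk_left (𝕜 := ℝ) p.1 p.2)).fderiv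
  have h' : ∀ u, fderiv ℝ (fun v => F (v, p.2)) p.1 u = fderiv ℝ F p (u, 0) := fun u =>
    congrArg (fun T => T u) h
  simp [dzbar, wirt, h', baseVec, Prod.smul_mk, ← Pi.single_smul]

theorem dz_fibre_eq_wirt {F : Cn n × Cn n → ℂ} {p : Cn n × Cn n} (hF : DifferentiableAt ℝ F p)
    (k : Fin n) : dz k (fun v => F (p.1, v)) p.2 = wirt (-Complex.I) (fibreVec k) F p := by
  have h := (hF.hasFDerivAt.comp p.2 (hasFDerivAt_prodMk_right (𝕜 := ℝ) p.1 p.2)).fderiv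
  have h' : ∀ u, fderiv ℝ (fun v => F (p.1, v)) p.2 u = fderiv ℝ F p (0, u) := fun u =>
    congrArg (fun T => T u) h
  simp [dz, wirt, h', fibreVec, Prod.smul_mk, sub_eq_add_neg, ← Pi.single_smul]

theorem dzbar_fibre_eq_wirt {F : Cn n × Cn n → ℂ} {p : Cn n × Cn n} (hF : DifferentiableAt ℝ F p)
    (k : Fin n) : dzbar k (fun v => F (p.1, v)) p.2 = wirt Complex.I (fibreVec k) F p := by
  have h := (hF.hasFDerivAt.comp p.2 (hasFDerivAt_prodMk_right (𝕜 := ℝ) p.1 p.2)).fderiv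
  have h' : ∀ u, fderiv ℝ (fun v => F (p.1, v)) p.2 u = fderiv ℝ F p (0, u) := fun u =>
    congrArg (fun T => T u) h
  simp [dzbar, wirt, h', fibreVec, Prod.smul_mk, ← Pi.single_smul]

theorem canonicalBracket_eq_poisson {F G : Cn n → Cn n → ℂ} {w ζ : Cn n}
    (hF : DifferentiableAt ℝ (fun p : Cn n × Cn n => F p.1 p.2) (w, ζ))
    (hG : DifferentiableAt ℝ (fun p : Cn n × Cn n => G p.1 p.2) (w, ζ)) :
    canonicalBracket F G w ζ =
      poisson (fun p : Cn n × Cn n => F p.1 p.2) (fun p => G p.1 p.2) (w, ζ) := by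
  simp only [poisson, ← dz_base_eq_wirt hF, ← dz_base_eq_wirt hG, ← dz_fibre_eq_wirt hF,
    ← dz_fibre_eq_wirt hG, ← dzbar_base_eq_wirt hF, ← dzbar_base_eq_wirt hG,
    ← dzbar_fibre_eq_wirt hF, ← dzbar_fibre_eq_wirt hG]
  rfl

/-- Linear algebra of the block triangular matrix with diagonal blocks `J`, `B` and off-diagonal
block `K`. It is symplectic exactly when `B` is the inverse transpose of `J` and the product of `B`
with `K` is symmetric; the symmetry cancels the terms that are bilinear in `a` and `b`. -/
theorem sum_symplectic {J K B : Fin n → Fin n → ℂ}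
    (h1 : ∀ i j, ∑ k, B k j * J k i = if i = j then 1 else 0)
    (h2 : ∀ i j, ∑ k, B k j * K k i = ∑ k, B k i * K k j) (a b c d : Fin n → ℂ) :
    ∑ k, ((∑ j, B k j * a j) * (∑ i, (J k i * d i + K k i * b i)) -
      (∑ i, (J k i * c i + K k i * a i)) * (∑ j, B k j * b j)) = ∑ k, (a k * d k - c k * b k) := by
  have e1 : ∀ x y : Fin n → ℂ, ∑ k, (∑ j, B k j * x j) * (∑ i, J k i * y i) = ∑ k, x k * y k := by
    intro x y
    simp only [Finset.sum_mul_sum]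
    calc ∑ k, ∑ j, ∑ i, B k j * x j * (J k i * y i)
        = ∑ j, ∑ i, (∑ k, B k j * J k i) * (x j * y i) := by
          rw [Finset.sum_comm]
          refine Finset.sum_congr rfl fun j _ => ?_
          rw [Finset.sum_comm]
          refine Finset.sum_congr rfl fun i _ => ?_
          rw [Finset.sum_mul]
          exact Finset.sum_congr rfl fun k _ => by ring
      _ = _ := by simp [h1]
  have e2 : ∑ k, (∑ j, B k j * a j) * (∑ i, K k i * b i) =
      ∑ k, (∑ i, K k i * a i) * (∑ j, B k j * b j) := by
    simp only [Finset.sum_mul_sum]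
    calc ∑ k, ∑ j, ∑ i, B k j * a j * (K k i * b i)
        = ∑ j, ∑ i, (∑ k, B k j * K k i) * (a j * b i) := by
          rw [Finset.sum_comm]
          refine Finset.sum_congr rfl fun j _ => ?_
          rw [Finset.sum_comm]
          refine Finset.sum_congr rfl fun i _ => ?_
          rw [Finset.sum_mul]
          exact Finset.sum_congr rfl fun k _ => by ring
      _ = ∑ j, ∑ i, (∑ k, B k i * K k j) * (a j * b i) := by simp only [h2]
      _ = _ := by
          symm
          rw [Finset.sum_comm]
          refine Finset.sum_congr rfl fun j _ => ?_
          rw [Finset.sum_comm]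
          refine Finset.sum_congr rfl fun i _ => ?_
          rw [Finset.sum_mul]
          exact Finset.sum_congr rfl fun k _ => by ring
  have e3 := e1 a d
  have e4 := e1 b c
  simp only [Finset.sum_add_distrib, Finset.sum_sub_distrib, mul_add, add_mul, e3, e2]
  rw [show ∑ k, (∑ i, J k i * c i) * (∑ j, B k j * b j) = ∑ k, c k * b k by
    simpa only [mul_comm] using e4]
  ring

/-- The (1,0) and (0,1) halves of the bracket are preserved separately, the second by the conjugates
of the symplectic relations used for the first. -/
theorem poisson_comp {F G : Cn n × Cn n → ℂ} {Φ : Cn n × Cn n → Cn n × Cn n} {p : Cn n × Cn n}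
    {L : Cn n × Cn n →L[ℂ] Cn n × Cn n} (hΦ : HasFDerivAt Φ L p)
    (hF : DifferentiableAt ℝ F (Φ p)) (hG : DifferentiableAt ℝ G (Φ p))
    (h0 : ∀ k, (L (fibreVec k)).1 = 0)
    (h1 : ∀ i j, ∑ k, (L (fibreVec k)).2 j * (L (baseVec k)).1 i = if i = j then 1 else 0)
    (h2 : ∀ i j, ∑ k, (L (fibreVec k)).2 j * (L (baseVec k)).2 i =
      ∑ k, (L (fibreVec k)).2 i * (L (baseVec k)).2 j) :
    poisson (fun q => F (Φ q)) (fun q => G (Φ q)) p = poisson F G (Φ p) := by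
  have e1 := sum_symplectic h1 h2 (fun k => wirt (-Complex.I) (fibreVec k) F (Φ p))
    (fun k => wirt (-Complex.I) (fibreVec k) G (Φ p))
    (fun k => wirt (-Complex.I) (baseVec k) F (Φ p))
    (fun k => wirt (-Complex.I) (baseVec k) G (Φ p))
  have e2 := sum_symplectic (J := fun k i => (starRingEnd ℂ) ((L (baseVec k)).1 i))
    (K := fun k i => (starRingEnd ℂ) ((L (baseVec k)).2 i))
    (B := fun k i => (starRingEnd ℂ) ((L (fibreVec k)).2 i))
    (fun i j => by
      simpa only [map_sum, map_mul, apply_ite, map_one, map_zero] using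
        congrArg (starRingEnd ℂ) (h1 i j))
    (fun i j => by
      simpa only [map_sum, map_mul] using congrArg (starRingEnd ℂ) (h2 i j))
    (fun k => wirt (Complex.I) (fibreVec k) F (Φ p))
    (fun k => wirt (Complex.I) (fibreVec k) G (Φ p))
    (fun k => wirt (Complex.I) (baseVec k) F (Φ p))
    (fun k => wirt (Complex.I) (baseVec k) G (Φ p))
  have e3 : ∀ A B C D : Fin n → ℂ, ∑ k, (A k - B k + C k - D k) =
      ∑ k, (A k - B k) + ∑ k, (C k - D k) := fun A B C D => by
    rw [← Finset.sum_add_distrib]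
    exact Finset.sum_congr rfl fun k _ => by ring
  simp only [poisson, wirt_comp hΦ hF, wirt_comp hΦ hG]
  rw [e3, e3, ← e1, ← e2]
  congr 1
  · refine Finset.sum_congr rfl fun k _ => ?_
    rw [wirt_neg_I (L (fibreVec k)), wirt_neg_I (L (baseVec k)), wirt_neg_I (L (fibreVec k)),
      wirt_neg_I (L (baseVec k))]
    simp [h0 k]
  · refine Finset.sum_congr rfl fun k _ => ?_
    rw [wirt_I (L (fibreVec k)), wirt_I (L (baseVec k)), wirt_I (L (fibreVec k)),
      wirt_I (L (baseVec k))]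
    simp [h0 k]

variable {M : Type*} [TopologicalSpace M] [ChartedSpace (Cn n) M] [IsManifold 𝓘(ℂ, Cn n) ω M]

/-- The change of the coordinates `(z, ζ)` on `T*M` from the chart `φ` to the chart `ψ`. -/
def coordChange (φ ψ : OpenPartialHomeomorph M (Cn n)) (p : Cn n × Cn n) : Cn n × Cn n :=
  (ψ (φ.symm p.1), fun j => ∑ m, p.2 m *
    fderiv ℂ (φ ∘ ψ.symm) (ψ (φ.symm p.1)) (Pi.single j 1) m)

variable {φ ψ : OpenPartialHomeomorph M (Cn n)}

theorem mem_symm_trans_source {w : Cn n} (hw : w ∈ (φ.symm ≫ₕ ψ).source) :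
    w ∈ φ.target ∧ φ.symm w ∈ ψ.source ∧ ψ (φ.symm w) ∈ (ψ.symm ≫ₕ φ).source := by
  have h1 : w ∈ φ.target := by simpa using hw.1
  have h2 : φ.symm w ∈ ψ.source := by simpa using hw.2
  exact ⟨h1, h2, by simp [h2, h1]⟩

theorem contDiffAt_chart_comp_symm (hφ : φ ∈ holCharts n M) (hψ : ψ ∈ holCharts n M) {w : Cn n}
    (hw : w ∈ (φ.symm ≫ₕ ψ).source) : ContDiffAt ℂ ω (ψ ∘ φ.symm) w :=
  (contDiffOn_chart_comp_symm hφ hψ).contDiffAt ((φ.symm ≫ₕ ψ).open_source.mem_nhds hw)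

theorem fderiv_chart_comp_symm_apply (hφ : φ ∈ holCharts n M) (hψ : ψ ∈ holCharts n M) {w : Cn n}
    (hw : w ∈ (φ.symm ≫ₕ ψ).source) (v : Cn n) :
    fderiv ℂ (ψ ∘ φ.symm) w (fderiv ℂ (φ ∘ ψ.symm) (ψ (φ.symm w)) v) = v := by
  obtain ⟨h1, h2, h3⟩ := mem_symm_trans_source hw
  have d1 := ((contDiffAt_chart_comp_symm hφ hψ hw).differentiableAt (by simp)).hasFDerivAt
  have d2 := ((contDiffAt_chart_comp_symm hψ hφ h3).differentiableAt (by simp)).hasFDerivAt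
  have e : (φ ∘ ψ.symm) (ψ (φ.symm w)) = w := by simp [h1, h2]
  rw [← e] at d1
  have d3 := d1.comp _ d2
  have d4 : HasFDerivAt ((ψ ∘ φ.symm) ∘ (φ ∘ ψ.symm)) (ContinuousLinearMap.id ℂ (Cn n))
      (ψ (φ.symm w)) := by
    refine (hasFDerivAt_id _).congr_of_eventuallyEq ?_
    filter_upwards [(ψ.symm ≫ₕ φ).open_source.mem_nhds h3] with y hy
    obtain ⟨g1, g2, -⟩ := mem_symm_trans_source hy
    simp [g1, g2]
  have h5 := congrArg (fun T => T v) (d3.unique d4)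
  simp only [e] at h5
  exact h5

theorem hasFDerivAt_fderiv_real (hφ : φ ∈ holCharts n M) (hψ : ψ ∈ holCharts n M) {w : Cn n}
    (hw : w ∈ (φ.symm ≫ₕ ψ).source) (v : Cn n) :
    fderiv ℝ (ψ ∘ φ.symm) w v = fderiv ℂ (ψ ∘ φ.symm) w v := by
  have d1 := ((contDiffAt_chart_comp_symm hφ hψ hw).differentiableAt (by simp)).hasFDerivAt
  rw [(d1.restrictScalars ℝ).fderiv]
  rfl

theorem fibreCoord_cotangentPoint (hφ : φ ∈ holCharts n M) (hψ : ψ ∈ holCharts n M) {w : Cn n}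
    (hw : w ∈ (φ.symm ≫ₕ ψ).source) (ζ : Cn n) :
    cotangentCoord ψ (cotangentPoint φ w ζ) = coordChange φ ψ (w, ζ) := by
  obtain ⟨h1, h2, h3⟩ := mem_symm_trans_source hw
  refine Prod.ext rfl (funext fun j => ?_)
  have key : ∀ v : Cn n, (cotangentPoint φ w ζ).2 (mfderiv 𝓘(ℝ, Cn n) 𝓘(ℝ, Cn n) ψ.symm
      (ψ (φ.symm w)) v) = covector ζ (fderiv ℂ (φ ∘ ψ.symm) (ψ (φ.symm w)) v) := by
    intro v
    have e1 := mfderiv_chart_apply hψ hφ h2 (φ.map_target h1)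
      (mfderiv 𝓘(ℝ, Cn n) 𝓘(ℝ, Cn n) ψ.symm (ψ (φ.symm w)) v)
    have e2 := mfderiv_chart_comp_symm hψ (ψ.map_source h2) v
    rw [ψ.left_inv h2] at e2
    rw [← hasFDerivAt_fderiv_real hψ hφ h3]
    refine congrArg (covector ζ) (e1.trans ?_)
    exact congrArg (fderiv ℝ (φ ∘ ψ.symm) (ψ (φ.symm w))) e2
  have hI : (Pi.single j Complex.I : Cn n) = Complex.I • Pi.single j 1 := by
    rw [← Pi.single_smul, smul_eq_mul, mul_one]
  refine (congrArg₂ (fun a b : ℝ => ((a : ℂ) - Complex.I * (b : ℂ)) / 2) (key _) (key _)).trans ?_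
  rw [hI, map_smul, covector_apply, covector_apply]
  simp only [coordChange, Pi.smul_apply, smul_eq_mul]
  rw [show ∑ k, ζ k * (Complex.I * fderiv ℂ (φ ∘ ψ.symm) (ψ (φ.symm w)) (Pi.single j 1) k) =
    Complex.I * ∑ k, ζ k * fderiv ℂ (φ ∘ ψ.symm) (ψ (φ.symm w)) (Pi.single j 1) k by
      rw [Finset.mul_sum]; exact Finset.sum_congr rfl fun k _ => by ring]
  generalize ∑ k, ζ k * fderiv ℂ (φ ∘ ψ.symm) (ψ (φ.symm w)) (Pi.single j 1) k = S
  apply Complex.ext <;> simp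

theorem cotangentPoint_coordChange (hφ : φ ∈ holCharts n M) (hψ : ψ ∈ holCharts n M) {w : Cn n}
    (hw : w ∈ (φ.symm ≫ₕ ψ).source) (ζ : Cn n) :
    cotangentPoint ψ (coordChange φ ψ (w, ζ)).1 (coordChange φ ψ (w, ζ)).2 =
      cotangentPoint φ w ζ := by
  obtain ⟨h1, h2, h3⟩ := mem_symm_trans_source hw
  rw [← fibreCoord_cotangentPoint hφ hψ hw]
  exact cotangentPoint_cotangentCoord hψ h2

/-- The derivative of the coordinate change. -/
def coordChangeDeriv (φ ψ : OpenPartialHomeomorph M (Cn n)) (p : Cn n × Cn n) :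
    Cn n × Cn n →L[ℂ] Cn n × Cn n :=
  ((fderiv ℂ (ψ ∘ φ.symm) p.1).comp (ContinuousLinearMap.fst ℂ _ _)).prod
    (ContinuousLinearMap.pi fun j => ∑ m,
      (fderiv ℂ (φ ∘ ψ.symm) (ψ (φ.symm p.1)) (Pi.single j 1) m •
          ((ContinuousLinearMap.proj m : Cn n →L[ℂ] ℂ).comp (ContinuousLinearMap.snd ℂ _ _)) +
        p.2 m • (ContinuousLinearMap.proj m : Cn n →L[ℂ] ℂ).comp
          ((ContinuousLinearMap.apply ℂ (Cn n) (Pi.single j 1 : Cn n)).comp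
          ((fderiv ℂ (fderiv ℂ (φ ∘ ψ.symm)) (ψ (φ.symm p.1))).comp
            ((fderiv ℂ (ψ ∘ φ.symm) p.1).comp (ContinuousLinearMap.fst ℂ _ _))))))

theorem hasFDerivAt_coordChange (hφ : φ ∈ holCharts n M) (hψ : ψ ∈ holCharts n M)
    {p : Cn n × Cn n} (hp : p.1 ∈ (φ.symm ≫ₕ ψ).source) :
    HasFDerivAt (coordChange φ ψ) (coordChangeDeriv φ ψ p) p := by
  obtain ⟨h1, h2, h3⟩ := mem_symm_trans_source hp
  have d1 := ((contDiffAt_chart_comp_symm hφ hψ hp).differentiableAt (by simp)).hasFDerivAt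
  have d2 : HasFDerivAt (fun q : Cn n × Cn n => ψ (φ.symm q.1)) _ p := d1.comp p hasFDerivAt_fst
  have d3 := (((contDiffAt_chart_comp_symm hψ hφ h3).fderiv_right (m := ω)
    (by simp)).differentiableAt (by simp)).hasFDerivAt
  have d4 : HasFDerivAt (fun q : Cn n × Cn n => fderiv ℂ (φ ∘ ψ.symm) (ψ (φ.symm q.1))) _ p :=
    HasFDerivAt.comp p d3 d2
  refine d2.prodMk (hasFDerivAt_pi.2 fun j => ?_)
  refine (HasFDerivAt.fun_sum fun m _ => ?_)
  have d5 : HasFDerivAt (fun q : Cn n × Cn n => q.2 m)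
      ((ContinuousLinearMap.proj m : Cn n →L[ℂ] ℂ).comp (ContinuousLinearMap.snd ℂ _ _)) p :=
    ((ContinuousLinearMap.proj m : Cn n →L[ℂ] ℂ).comp
      (ContinuousLinearMap.snd ℂ (Cn n) (Cn n))).hasFDerivAt
  have d6 := (((ContinuousLinearMap.proj m : Cn n →L[ℂ] ℂ).comp
    (ContinuousLinearMap.apply ℂ (Cn n) (Pi.single j 1 : Cn n))).hasFDerivAt).comp p d4
  refine (d5.mul d6).congr_fderiv ?_
  rw [add_comm]
  rfl

theorem contDiffAt_coordChange (hφ : φ ∈ holCharts n M) (hψ : ψ ∈ holCharts n M)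
    {p : Cn n × Cn n} (hp : p.1 ∈ (φ.symm ≫ₕ ψ).source) :
    ContDiffAt ℝ ∞ (coordChange φ ψ) p := by
  obtain ⟨h1, h2, h3⟩ := mem_symm_trans_source hp
  have d1 : ContDiffAt ℝ ∞ (ψ ∘ φ.symm) p.1 :=
    ((contDiffAt_chart_comp_symm hφ hψ hp).restrict_scalars ℝ).of_le le_top
  have d2 : ContDiffAt ℝ ∞ (fun q : Cn n × Cn n => ψ (φ.symm q.1)) p :=
    ContDiffAt.comp (g := ψ ∘ φ.symm) p d1 contDiff_fst.contDiffAt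
  have d3 : ContDiffAt ℝ ∞ (fderiv ℂ (φ ∘ ψ.symm)) (ψ (φ.symm p.1)) :=
    (((contDiffAt_chart_comp_symm hψ hφ h3).fderiv_right (m := ω)
      (by simp)).restrict_scalars ℝ).of_le le_top
  have d4 : ContDiffAt ℝ ∞ (fun q : Cn n × Cn n => fderiv ℂ (φ ∘ ψ.symm) (ψ (φ.symm q.1))) p :=
    ContDiffAt.comp p d3 d2
  refine d2.prodMk (contDiffAt_pi.2 fun j => ?_)
  refine ContDiffAt.sum fun m _ => ?_
  have d5 : ContDiffAt ℝ ∞ (fun q : Cn n × Cn n => q.2 m) p := by fun_prop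
  have d6 := ((((ContinuousLinearMap.proj m : Cn n →L[ℂ] ℂ).comp
    (ContinuousLinearMap.apply ℂ (Cn n) (Pi.single j 1 : Cn n))).restrictScalars ℝ).contDiff
    (n := ∞)).contDiffAt.comp p d4
  exact d5.mul d6

theorem coordChangeDeriv_fibreVec (p : Cn n × Cn n) (k : Fin n) :
    coordChangeDeriv φ ψ p (fibreVec k) =
      (0, fun j => fderiv ℂ (φ ∘ ψ.symm) (ψ (φ.symm p.1)) (Pi.single j 1) k) := by
  refine Prod.ext ?_ (funext fun j => ?_)
  · simp [coordChangeDeriv, fibreVec]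
  · simp [coordChangeDeriv, fibreVec, Pi.single_apply]

theorem coordChangeDeriv_baseVec (p : Cn n × Cn n) (k : Fin n) :
    coordChangeDeriv φ ψ p (baseVec k) =
      (fderiv ℂ (ψ ∘ φ.symm) p.1 (Pi.single k 1), fun j => ∑ m, p.2 m *
        fderiv ℂ (fderiv ℂ (φ ∘ ψ.symm)) (ψ (φ.symm p.1))
          (fderiv ℂ (ψ ∘ φ.symm) p.1 (Pi.single k 1)) (Pi.single j 1) m) := by
  refine Prod.ext ?_ (funext fun j => ?_)
  · simp [coordChangeDeriv, baseVec]
  · simp [coordChangeDeriv, baseVec]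

theorem eq_sum_smul_single (v : Cn n) : v = ∑ k, v k • (Pi.single k 1 : Cn n) := by
  refine funext fun j => ?_
  simp [Finset.sum_apply, Pi.single_apply]

/-- The cotangent lift of a holomorphic coordinate change is symplectic. The symmetry required of
the off-diagonal block is that of the second derivative of the inverse change. -/
theorem poisson_coordChange (hφ : φ ∈ holCharts n M) (hψ : ψ ∈ holCharts n M)
    {p : Cn n × Cn n} (hp : p.1 ∈ (φ.symm ≫ₕ ψ).source) {F G : Cn n × Cn n → ℂ}
    (hF : DifferentiableAt ℝ F (coordChange φ ψ p))
    (hG : DifferentiableAt ℝ G (coordChange φ ψ p)) :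
    poisson (fun q => F (coordChange φ ψ q)) (fun q => G (coordChange φ ψ q)) p =
      poisson F G (coordChange φ ψ p) := by
  obtain ⟨g1, g2, g3⟩ := mem_symm_trans_source hp
  have hsum : ∀ j, ∑ k, fderiv ℂ (φ ∘ ψ.symm) (ψ (φ.symm p.1)) (Pi.single j 1) k •
      fderiv ℂ (ψ ∘ φ.symm) p.1 (Pi.single k 1) = Pi.single j 1 := by
    intro j
    have h := fderiv_chart_comp_symm_apply hφ hψ hp (Pi.single j 1)
    rw [eq_sum_smul_single (fderiv ℂ (φ ∘ ψ.symm) (ψ (φ.symm p.1)) (Pi.single j 1)), map_sum] at h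
    simpa only [map_smul] using h
  -- Contracting with the inverse Jacobian removes the chain-rule factor and leaves a bare second
  -- derivative.
  have hK : ∀ i j, ∑ k, (coordChangeDeriv φ ψ p (fibreVec k)).2 j *
      (coordChangeDeriv φ ψ p (baseVec k)).2 i = ∑ m, p.2 m *
        fderiv ℂ (fderiv ℂ (φ ∘ ψ.symm)) (ψ (φ.symm p.1)) (Pi.single j 1) (Pi.single i 1) m := by
    intro i j
    simp only [coordChangeDeriv_fibreVec, coordChangeDeriv_baseVec, Finset.mul_sum]
    rw [Finset.sum_comm]
    refine Finset.sum_congr rfl fun m _ => ?_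
    conv_rhs => rw [← hsum j]
    simp only [map_sum, map_smul, FunLike.coe_sum, FunLike.coe_smul, Finset.sum_apply,
      Pi.smul_apply, smul_eq_mul, Finset.mul_sum]
    exact Finset.sum_congr rfl fun k _ => by ring
  refine poisson_comp (hasFDerivAt_coordChange hφ hψ hp) hF hG
    (fun k => by rw [coordChangeDeriv_fibreVec]) (fun i j => ?_) (fun i j => ?_)
  · simp only [coordChangeDeriv_fibreVec, coordChangeDeriv_baseVec]
    have h := congrFun (hsum j) i
    simpa [Finset.sum_apply, Pi.single_apply] using h
  · rw [hK, hK]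
    have hs : IsSymmSndFDerivAt ℂ (φ ∘ ψ.symm) (ψ (φ.symm p.1)) :=
      (contDiffAt_chart_comp_symm hψ hφ g3).isSymmSndFDerivAt (by simp)
    exact Finset.sum_congr rfl fun m _ => by rw [hs.eq]

end CoordinateChange

/-! ### Taylor coefficients in the fibre variables -/

section FibreTaylor

open Set Filter TopologicalSpace

variable {n : ℕ}

/-- The part of the space of coordinates `(z, ζ)` that lies over `U`. -/
def tube (U : Opens (Cn n)) : Set (Cn n × Cn n) := (U : Set (Cn n)) ×ˢ univ

theorem isOpen_tube (U : Opens (Cn n)) : IsOpen (tube U) := U.isOpen.prod isOpen_univ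

theorem mem_tube {U : Opens (Cn n)} {p : Cn n × Cn n} : p ∈ tube U ↔ p.1 ∈ U := by
  simp [tube]

/-- The derivative of order `r` at `t = 0` of `t ↦ F(w, t ζ)`. -/
def fibreTaylor (r : ℕ) (F : Cn n × Cn n → ℂ) (w ζ : Cn n) : ℂ :=
  iteratedDeriv r (fun t : ℝ => F (w, t • ζ)) 0

variable {U : Opens (Cn n)} {F G : Cn n × Cn n → ℂ} {w ζ : Cn n}

theorem contDiffAt_of_tube (hF : ContDiffOn ℝ ∞ F (tube U)) (hw : w ∈ U) (ζ : Cn n) :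
    ContDiffAt ℝ ∞ F (w, ζ) := hF.contDiffAt ((isOpen_tube U).mem_nhds (mem_tube.2 hw))

theorem differentiableAt_of_tube (hF : ContDiffOn ℝ ∞ F (tube U)) (hw : w ∈ U) (ζ : Cn n) :
    DifferentiableAt ℝ F (w, ζ) := (contDiffAt_of_tube hF hw ζ).differentiableAt (by simp)

theorem contDiffOn_fderiv_apply (hF : ContDiffOn ℝ ∞ F (tube U)) (v : Cn n × Cn n) :
    ContDiffOn ℝ ∞ (fun p => fderiv ℝ F p v) (tube U) :=
  (hF.fderiv_of_isOpen (isOpen_tube U) (m := ∞) (by simp)).clm_apply contDiffOn_const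

theorem contDiff_line (hF : ContDiffOn ℝ ∞ F (tube U)) (hw : w ∈ U) (ζ : Cn n) :
    ContDiff ℝ ∞ (fun t : ℝ => F (w, t • ζ)) :=
  contDiff_iff_contDiffAt.2 fun t => ContDiffAt.comp t (contDiffAt_of_tube hF hw (t • ζ))
    (contDiffAt_const.prodMk (contDiffAt_id.smul contDiffAt_const))

theorem fibreTaylor_zero (F : Cn n × Cn n → ℂ) (w ζ : Cn n) : fibreTaylor 0 F w ζ = F (w, 0) := by
  simp [fibreTaylor]

theorem fibreTaylor_congr (h : EqOn F G (tube U)) (hw : w ∈ U) (r : ℕ) (ζ : Cn n) :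
    fibreTaylor r F w ζ = fibreTaylor r G w ζ := by
  have : (fun t : ℝ => F (w, t • ζ)) = fun t : ℝ => G (w, t • ζ) :=
    funext fun t => h (mem_tube.2 hw)
  rw [fibreTaylor, this, fibreTaylor]

theorem fibreTaylor_succ (hF : ContDiffOn ℝ ∞ F (tube U)) (hw : w ∈ U) (r : ℕ) (ζ : Cn n) :
    fibreTaylor (r + 1) F w ζ = fibreTaylor r (fun p => fderiv ℝ F p (0, ζ)) w ζ := by
  rw [fibreTaylor, iteratedDeriv_succ', fibreTaylor]
  congr 1
  funext t
  have h1 : HasDerivAt (fun t : ℝ => ((w, t • ζ) : Cn n × Cn n)) (0, ζ) t := by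
    simpa using (hasDerivAt_const t w).prodMk ((hasDerivAt_id t).smul_const ζ)
  exact ((differentiableAt_of_tube hF hw (t • ζ)).hasFDerivAt.comp_hasDerivAt t h1).deriv

theorem fibreTaylor_add (hF : ContDiffOn ℝ ∞ F (tube U)) (hG : ContDiffOn ℝ ∞ G (tube U))
    (hw : w ∈ U) (r : ℕ) (ζ : Cn n) :
    fibreTaylor r (fun p => F p + G p) w ζ = fibreTaylor r F w ζ + fibreTaylor r G w ζ :=
  iteratedDeriv_fun_add ((contDiff_line hF hw ζ).of_le (by exact_mod_cast le_top)).contDiffAt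
    ((contDiff_line hG hw ζ).of_le (by exact_mod_cast le_top)).contDiffAt

theorem fibreTaylor_base_mul (f : Cn n → ℂ) (F : Cn n × Cn n → ℂ) (w : Cn n) (r : ℕ) (ζ : Cn n) :
    fibreTaylor r (fun p => f p.1 * F p) w ζ = f w * fibreTaylor r F w ζ :=
  iteratedDeriv_const_mul_field (f w) _

theorem fibreTaylor_sum {ι : Type*} {s : Finset ι} {F : ι → Cn n × Cn n → ℂ}
    (hF : ∀ i ∈ s, ContDiffOn ℝ ∞ (F i) (tube U)) (hw : w ∈ U) (r : ℕ) (ζ : Cn n) :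
    fibreTaylor r (fun p => ∑ i ∈ s, F i p) w ζ = ∑ i ∈ s, fibreTaylor r (F i) w ζ :=
  iteratedDeriv_fun_sum fun i hi =>
    ((contDiff_line (hF i hi) hw ζ).of_le (by exact_mod_cast le_top)).contDiffAt

/-- On the line `t ↦ tζ` the linear function is `t L ζ`, and the derivative of order `r + 1` of `t
f(t)` at `0` is `(r + 1) f^{(r)}(0)`. -/
theorem fibreTaylor_zeta_mul (L : Cn n →L[ℝ] ℂ) (r : ℕ) :
    ∀ {F : Cn n × Cn n → ℂ}, ContDiffOn ℝ ∞ F (tube U) → ∀ {w}, w ∈ U → ∀ ζ,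
    fibreTaylor (r + 1) (fun p => L p.2 * F p) w ζ = (r + 1) * (L ζ * fibreTaylor r F w ζ) := by
  have hLs : ContDiffOn ℝ ∞ (fun p : Cn n × Cn n => L p.2) (tube U) :=
    (L.contDiff.comp contDiff_snd).contDiffOn
  have key : ∀ {F : Cn n × Cn n → ℂ}, ContDiffOn ℝ ∞ F (tube U) → ∀ {w}, w ∈ U → ∀ ζ r,
      fibreTaylor (r + 1) (fun p => L p.2 * F p) w ζ = L ζ * fibreTaylor r F w ζ +
        fibreTaylor r (fun p => L p.2 * fderiv ℝ F p (0, ζ)) w ζ := by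
    intro F hF w hw ζ r
    rw [fibreTaylor_succ (hLs.mul hF) hw,
      ← fibreTaylor_base_mul (fun _ => L ζ),
      ← fibreTaylor_add (contDiffOn_const.mul hF) (hLs.mul (contDiffOn_fderiv_apply hF _)) hw]
    refine fibreTaylor_congr (fun p hp => ?_) hw r ζ
    have h1 : HasFDerivAt (fun p : Cn n × Cn n => L p.2)
        (L.comp (ContinuousLinearMap.snd ℝ (Cn n) (Cn n))) p :=
      (L.comp (ContinuousLinearMap.snd ℝ (Cn n) (Cn n))).hasFDerivAt
    have h2 := (differentiableAt_of_tube hF (mem_tube.1 hp) p.2).hasFDerivAt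
    have h3 := (h1.mul h2).fderiv
    refine (congrArg (fun T => T (0, ζ)) h3).trans ?_
    simp
    ring
  induction r with
  | zero =>
    intro F hF w hw ζ
    rw [key hF hw, fibreTaylor_zero, fibreTaylor_zero]
    simp
  | succ r ih =>
    intro F hF w hw ζ
    rw [key hF hw, ih (contDiffOn_fderiv_apply hF _) hw, ← fibreTaylor_succ hF hw]
    push_cast
    ring

theorem fderiv_fderiv_comm (hF : ContDiffOn ℝ ∞ F (tube U)) {p : Cn n × Cn n} (hp : p ∈ tube U)
    (u v : Cn n × Cn n) :
    fderiv ℝ (fun q => fderiv ℝ F q u) p v = fderiv ℝ (fun q => fderiv ℝ F q v) p u := by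
  have h := contDiffAt_of_tube hF (mem_tube.1 hp) p.2
  have h1 : DifferentiableAt ℝ (fderiv ℝ F) p :=
    (h.fderiv_right (m := ∞) (by simp)).differentiableAt (by simp)
  have h2 : ∀ a b, fderiv ℝ (fun q => fderiv ℝ F q a) p b = fderiv ℝ (fderiv ℝ F) p b a := by
    intro a b
    rw [fderiv_clm_apply h1 (differentiableAt_const a)]
    simp
  rw [h2, h2]
  exact (h.isSymmSndFDerivAt (by simpa using two_le_infty)).eq v u

/-- Base and fibre derivatives commute. Differentiability of the coefficient in the base point is
carried along in the same induction. -/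
theorem fibreTaylor_fderiv_base (r : ℕ) :
    ∀ {F : Cn n × Cn n → ℂ}, ContDiffOn ℝ ∞ F (tube U) → ∀ {w}, w ∈ U → ∀ ζ v : Cn n,
    HasFDerivAt (fun w' => fibreTaylor r F w' ζ)
      (fderiv ℝ (fun w' => fibreTaylor r F w' ζ) w) w ∧
    fibreTaylor r (fun p => fderiv ℝ F p (v, 0)) w ζ =
      fderiv ℝ (fun w' => fibreTaylor r F w' ζ) w v := by
  induction r with
  | zero =>
    intro F hF w hw ζ v
    simp only [fibreTaylor_zero]
    have h := (differentiableAt_of_tube hF hw 0).hasFDerivAt.comp w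
      (hasFDerivAt_prodMk_left (𝕜 := ℝ) w (0 : Cn n))
    exact ⟨h.differentiableAt.hasFDerivAt, (congrArg (fun T => T v) h.fderiv).symm⟩
  | succ r ih =>
    intro F hF w hw ζ v
    have hev : (fun w' => fibreTaylor (r + 1) F w' ζ) =ᶠ[𝓝 w]
        fun w' => fibreTaylor r (fun p => fderiv ℝ F p (0, ζ)) w' ζ := by
      filter_upwards [U.isOpen.mem_nhds hw] with w' hw'
      exact fibreTaylor_succ hF hw' r ζ
    obtain ⟨h1, h2⟩ := ih (contDiffOn_fderiv_apply hF (0, ζ)) hw ζ v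
    rw [hev.fderiv_eq]
    refine ⟨h1.congr_of_eventuallyEq hev, ?_⟩
    rw [← h2, fibreTaylor_succ (contDiffOn_fderiv_apply hF _) hw]
    exact fibreTaylor_congr (fun p hp => fderiv_fderiv_comm hF hp _ _) hw r ζ

theorem exists_cutoff (U : Opens (Cn n)) (hw : w ∈ U) : ∃ χ : Cn n → ℝ, ContDiff ℝ ∞ χ ∧
    HasCompactSupport χ ∧ tsupport χ ⊆ U ∧ ∀ᶠ w' in 𝓝 w, χ w' = 1 := by
  obtain ⟨δ, hδ, hδU⟩ := Metric.nhds_basis_closedBall.mem_iff.1 (U.isOpen.mem_nhds hw)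
  let f : ContDiffBump w := ⟨δ / 2, δ, half_pos hδ, half_lt_self hδ⟩
  exact ⟨f, f.contDiff, f.hasCompactSupport, by rw [f.tsupport_eq]; exact hδU, f.eventuallyEq_one⟩

theorem contDiff_cutoff_mul {χ : Cn n → ℝ} (hχ : ContDiff ℝ ∞ χ) (hsupp : tsupport χ ⊆ U)
    (hF : ContDiffOn ℝ ∞ F (tube U)) :
    ContDiff ℝ ∞ (fun p : Cn n × Cn n => (χ p.1 : ℂ) * F p) := by
  have hχ' : ContDiff ℝ ∞ (fun p : Cn n × Cn n => (χ p.1 : ℂ)) :=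
    Complex.ofRealCLM.contDiff.comp (hχ.comp contDiff_fst)
  refine contDiff_iff_contDiffAt.2 fun p => ?_
  by_cases hp : p.1 ∈ U
  · exact hχ'.contDiffAt.mul (contDiffAt_of_tube hF hp p.2)
  · have hp' : p.1 ∈ (tsupport χ)ᶜ := fun h => hp (hsupp h)
    have hev : ∀ᶠ q : Cn n × Cn n in 𝓝 p, q.1 ∈ (tsupport χ)ᶜ :=
      continuous_fst.continuousAt.eventually
        ((isClosed_tsupport χ).isOpen_compl.mem_nhds hp')
    refine (contDiffAt_const (c := (0 : ℂ))).congr_of_eventuallyEq ?_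
    filter_upwards [hev] with q hq
    simp [image_eq_zero_of_notMem_tsupport hq]

theorem iteratedDeriv_line {F : Cn n × Cn n → ℂ} (hF : ContDiff ℝ ∞ F) (a v : Cn n × Cn n) (r : ℕ)
    (t : ℝ) : iteratedDeriv r (fun t : ℝ => F (a + t • v)) t =
      iteratedFDeriv ℝ r F (a + t • v) fun _ => v := by
  let L : ℝ →L[ℝ] Cn n × Cn n := ContinuousLinearMap.toSpanSingleton ℝ v
  have h1 := L.iteratedFDeriv_comp_right (n := ∞) (f := fun q => F (a + q))
    (hF.comp (contDiff_const.add contDiff_id)) t (i := r) (by exact_mod_cast le_top)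
  have h2 : (fun t : ℝ => F (a + t • v)) = (fun q => F (a + q)) ∘ L := by
    funext t; simp [L]
  rw [iteratedDeriv_eq_iteratedFDeriv, h2, h1, iteratedFDeriv_comp_add_left]
  simp [L]

theorem fibreTaylor_eq_iteratedFDeriv (hF : ContDiff ℝ ∞ F) (r : ℕ) (w ζ : Cn n) :
    fibreTaylor r F w ζ = iteratedFDeriv ℝ r F (w, 0) fun _ => (0, ζ) := by
  have h := iteratedDeriv_line hF (w, 0) (0, ζ) r 0
  simpa [fibreTaylor] using h

/-- Taylor's formula along the segment from `(w', 0)` to `(w', ζ)`: all coefficients vanish, and the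
remainder is `O(‖ζ‖^{N+1})` uniformly in `w'` since the derivatives are bounded on a compact ball. A
cutoff in the base first replaces `F` by a globally smooth function. -/
theorem flatAt_of_fibreTaylor_eq_zero (hF : ContDiffOn ℝ ∞ F (tube U))
    (h : ∀ r, ∀ w ∈ U, ∀ ζ, fibreTaylor r F w ζ = 0) (hw : w ∈ U) : FlatAt F w := by
  obtain ⟨χ, hχ, hχc, hχU, hχ1⟩ := exists_cutoff U hw
  set G : Cn n × Cn n → ℂ := fun p => (χ p.1 : ℂ) * F p with hG
  have hGs : ContDiff ℝ ∞ G := contDiff_cutoff_mul hχ hχU hF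
  have hG0 : ∀ r w ζ, fibreTaylor r G w ζ = 0 := by
    intro r w ζ
    rw [hG, fibreTaylor_base_mul (fun w => (χ w : ℂ)) F w r ζ]
    by_cases hw : w ∈ U
    · rw [h r w hw, mul_zero]
    · rw [image_eq_zero_of_notMem_tsupport fun h => hw (hχU h), Complex.ofReal_zero, zero_mul]
  have hGF : G =ᶠ[𝓝 (w, 0)] F := by
    have : ∀ᶠ q : Cn n × Cn n in 𝓝 (w, 0), χ q.1 = 1 :=
      (continuous_fst.tendsto (w, (0 : Cn n))).eventually hχ1
    filter_upwards [this] with q hq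
    simp [hG, hq]
  refine FlatAt.congr (fun N => ?_) hGF
  suffices H : ∀ N : ℕ, G =O[𝓝 (w, 0)] fun p => ‖p.2‖ ^ (N + 1) by
    rcases N with _ | N
    · simpa using hGs.continuous.continuousAt.isBigO_one ℝ
    · exact H N
  intro N
  have hcont : Continuous (iteratedFDeriv ℝ (N + 1) G) :=
    hGs.continuous_iteratedFDeriv (by exact_mod_cast le_top)
  obtain ⟨C, hC⟩ := (isCompact_closedBall (w, (0 : Cn n)) 1).exists_bound_of_continuousOn
    hcont.continuousOn
  refine Asymptotics.IsBigO.of_bound C ?_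
  filter_upwards [Metric.ball_mem_nhds (w, (0 : Cn n)) one_pos] with p hp
  have hline : ContDiff ℝ ∞ (fun t : ℝ => G ((p.1, 0) + t • (0, p.2))) :=
    hGs.comp (contDiff_const.add (contDiff_id.smul contDiff_const))
  have hu : UniqueDiffOn ℝ (Icc (0 : ℝ) 1) := uniqueDiffOn_Icc one_pos
  have hd : ∀ r : ℕ, ∀ y ∈ Icc (0 : ℝ) 1,
      iteratedDerivWithin r (fun t : ℝ => G ((p.1, 0) + t • (0, p.2))) (Icc 0 1) y =
        iteratedFDeriv ℝ r G ((p.1, 0) + y • (0, p.2)) fun _ => (0, p.2) := fun r y hy => by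
    rw [iteratedDerivWithin_eq_iteratedDeriv hu
      (hline.of_le (by exact_mod_cast le_top)).contDiffAt hy, iteratedDeriv_line hGs]
  -- The derivative of order `N + 1` along the segment is the multilinear derivative evaluated on
  -- copies of `(0, ζ)`, hence at most `C ‖ζ‖^{N+1}`.
  have hT := taylor_mean_remainder_bound (f := fun t : ℝ => G ((p.1, 0) + t • (0, p.2)))
    (C := C * ‖p.2‖ ^ (N + 1)) (n := N) zero_le_one
    (hline.of_le (by exact_mod_cast le_top)).contDiffOn (right_mem_Icc.2 zero_le_one) (by
      intro y hy
      rw [hd _ _ hy]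
      refine (ContinuousMultilinearMap.le_opNorm _ _).trans ?_
      have h1 : ‖iteratedFDeriv ℝ (N + 1) G ((p.1, 0) + y • (0, p.2))‖ ≤ C := by
        refine hC _ ?_
        rw [Metric.mem_ball, Prod.dist_eq, max_lt_iff] at hp
        rw [Metric.mem_closedBall, Prod.dist_eq, max_le_iff]
        refine ⟨by simpa using hp.1.le, ?_⟩
        have h2 : ‖p.2‖ < 1 := by simpa using hp.2
        simp only [Prod.smul_mk, Prod.mk_add_mk, zero_add, dist_zero_right, norm_smul,
          Real.norm_of_nonneg hy.1]
        nlinarith [hy.1, hy.2, norm_nonneg p.2]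
      simp only [Finset.prod_const, Finset.card_univ, Fintype.card_fin]
      gcongr
      · exact (norm_nonneg _).trans h1
      · simp [Prod.norm_def])
  have hzero : taylorWithinEval (fun t : ℝ => G ((p.1, 0) + t • (0, p.2))) N (Icc 0 1) 0 1 = 0 := by
    rw [taylor_within_apply]
    refine Finset.sum_eq_zero fun r _ => ?_
    have h3 := hG0 r p.1 p.2
    rw [fibreTaylor_eq_iteratedFDeriv hGs] at h3
    rw [hd r 0 (left_mem_Icc.2 zero_le_one), zero_smul, add_zero, h3, smul_zero]
  rw [hzero] at hT
  have hfin : ‖G p‖ ≤ C * ‖p.2‖ ^ (N + 1) / (N.factorial : ℝ) := by simpa using hT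
  refine hfin.trans ?_
  have hC0 : 0 ≤ C * ‖p.2‖ ^ (N + 1) := by
    have := (norm_nonneg _).trans (hC (w, 0) (Metric.mem_closedBall_self zero_le_one))
    positivity
  rw [norm_pow, norm_norm]
  exact div_le_self hC0 (by exact_mod_cast Nat.one_le_iff_ne_zero.2 (Nat.factorial_ne_zero N))

/-- Converse of the previous statement: derivatives of flat functions are flat, and flat functions
vanish on the zero section. -/
theorem FlatAt.fibreTaylor_eq_zero (r : ℕ) : ∀ {F : Cn n × Cn n → ℂ}, ContDiffOn ℝ ∞ F (tube U) →
    (∀ w ∈ U, FlatAt F w) → ∀ w ∈ U, ∀ ζ, fibreTaylor r F w ζ = 0 := by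
  induction r with
  | zero =>
    intro F hF h w hw ζ
    rw [fibreTaylor_zero, (h w hw).eq_zero]
  | succ r ih =>
    intro F hF h w hw ζ
    rw [fibreTaylor_succ hF hw]
    exact ih (contDiffOn_fderiv_apply hF _) (fun w hw => (h w hw).fderiv_apply
      ((contDiffAt_of_tube hF hw 0).of_le two_le_infty) _) w hw ζ

end FibreTaylor

/-! ### The algebra of formal functions over an open set of the base -/

section FormalTube

open Set Filter TopologicalSpace

variable {n : ℕ} {U : Opens (Cn n)}

variable (U) in
/-- Smooth functions of `(z, ζ)` for `z ∈ U`. -/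
def SmoothTube : Subalgebra ℂ (Cn n × Cn n → ℂ) where
  carrier := {F | ContDiffOn ℝ ∞ F (tube U)}
  mul_mem' hf hg := hf.mul hg
  add_mem' hf hg := hf.add hg
  algebraMap_mem' c := contDiffOn_const (c := c)

variable (U) in
/-- The ideal of functions that are flat along `ζ = 0`. -/
def flatTube : Ideal (SmoothTube U) where
  carrier := {F | ∀ w ∈ U, FlatAt F.1 w}
  add_mem' hf hg w hw := (hf w hw).add (hg w hw)
  zero_mem' _ _ := flatAt_zero
  smul_mem' c _ hf w hw := (hf w hw).mul_left (contDiffAt_of_tube c.2 hw 0).continuousAt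

variable (U) in
/-- The algebra `C^∞(U)[[ζ, ζ̄]]`, realized as a quotient of the algebra of smooth functions. -/
def FormalTube : Type := SmoothTube U ⧸ flatTube U

instance : CommRing (FormalTube U) := inferInstanceAs (CommRing (SmoothTube U ⧸ flatTube U))

instance : Algebra ℂ (FormalTube U) := inferInstanceAs (Algebra ℂ (SmoothTube U ⧸ flatTube U))

variable (U) in
/-- The class of a smooth function. -/
def tubeMk : SmoothTube U →ₐ[ℂ] FormalTube U := Ideal.Quotient.mkₐ ℂ (flatTube U)

theorem tubeMk_surjective : Function.Surjective (tubeMk U) := Ideal.Quotient.mk_surjective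

theorem tubeMk_eq {F G : SmoothTube U} :
    tubeMk U F = tubeMk U G ↔ ∀ w ∈ U, FlatAt (fun p => F.1 p - G.1 p) w :=
  Ideal.Quotient.mk_eq_mk_iff_sub_mem F G

theorem tubeMk_eq_zero {F : SmoothTube U} : tubeMk U F = 0 ↔ ∀ w ∈ U, FlatAt F.1 w :=
  Ideal.Quotient.eq_zero_iff_mem

theorem flatAt_of_eqOn {F : Cn n × Cn n → ℂ} (h : ∀ p ∈ tube U, F p = 0) {w : Cn n} (hw : w ∈ U) :
    FlatAt F w := by
  refine flatAt_zero.congr ?_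
  filter_upwards [(isOpen_tube U).mem_nhds ((mem_tube (p := (w, (0 : Cn n)))).2 hw)] with p hp
  exact (h p hp).symm

theorem tubeMk_eq_of_eqOn {F G : SmoothTube U} (h : EqOn F.1 G.1 (tube U)) :
    tubeMk U F = tubeMk U G :=
  tubeMk_eq.2 fun _ hw => flatAt_of_eqOn (fun _ hp => sub_eq_zero.2 (h hp)) hw

theorem contDiffOn_wirt {F : Cn n × Cn n → ℂ} (hF : ContDiffOn ℝ ∞ F (tube U)) (s : ℂ)
    (v : Cn n × Cn n) : ContDiffOn ℝ ∞ (wirt s v F) (tube U) :=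
  ((contDiffOn_fderiv_apply hF v).add
    (contDiffOn_const.mul (contDiffOn_fderiv_apply hF _))).div_const 2

/-- The operator `wirt s v` on smooth functions. -/
def wirtSmooth (s : ℂ) (v : Cn n × Cn n) (F : SmoothTube U) : SmoothTube U :=
  ⟨wirt s v F.1, contDiffOn_wirt F.2 s v⟩

theorem wirt_add {F G : Cn n × Cn n → ℂ} {p : Cn n × Cn n} (hF : DifferentiableAt ℝ F p)
    (hG : DifferentiableAt ℝ G p) (s : ℂ) (v : Cn n × Cn n) :
    wirt s v (F + G) p = wirt s v F p + wirt s v G p := by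
  simp only [wirt, fderiv_add hF hG, FunLike.coe_add, Pi.add_apply]
  ring

theorem wirt_sub {F G : Cn n × Cn n → ℂ} {p : Cn n × Cn n} (hF : DifferentiableAt ℝ F p)
    (hG : DifferentiableAt ℝ G p) (s : ℂ) (v : Cn n × Cn n) :
    wirt s v (F - G) p = wirt s v F p - wirt s v G p := by
  simp only [wirt, fderiv_sub hF hG, FunLike.coe_sub, Pi.sub_apply]
  ring

theorem wirt_mul {F G : Cn n × Cn n → ℂ} {p : Cn n × Cn n} (hF : DifferentiableAt ℝ F p)
    (hG : DifferentiableAt ℝ G p) (s : ℂ) (v : Cn n × Cn n) :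
    wirt s v (F * G) p = F p * wirt s v G p + G p * wirt s v F p := by
  simp only [wirt, fderiv_mul hF hG, FunLike.coe_add, Pi.add_apply, FunLike.coe_smul, Pi.smul_apply,
    smul_eq_mul]
  ring

theorem wirt_const_smul {F : Cn n × Cn n → ℂ} {p : Cn n × Cn n} (hF : DifferentiableAt ℝ F p)
    (c s : ℂ) (v : Cn n × Cn n) : wirt s v (c • F) p = c * wirt s v F p := by
  simp only [wirt, fderiv_const_smul hF, FunLike.coe_smul, Pi.smul_apply, smul_eq_mul]
  ring

theorem FlatAt.wirt {F : Cn n × Cn n → ℂ} {w : Cn n} (h : FlatAt F w)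
    (hF : ContDiffAt ℝ 2 F (w, 0)) (s : ℂ) (v : Cn n × Cn n) :
    FlatAt (KahlerPoisson.wirt s v F) w := by
  have h1 := (h.fderiv_apply hF v).add ((h.fderiv_apply hF (Complex.I • v)).mul_left
    (continuousAt_const (y := s)))
  refine (h1.mul_left (continuousAt_const (y := (2 : ℂ)⁻¹))).congr ?_
  exact Eventually.of_forall fun p => by
    simp only [KahlerPoisson.wirt, div_eq_inv_mul]

/-- Flatness survives differentiation, so first-order operators descend to the quotient by flat
functions. -/
theorem tubeMk_wirtSmooth_congr {F G : SmoothTube U} (h : tubeMk U F = tubeMk U G) (s : ℂ)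
    (v : Cn n × Cn n) : tubeMk U (wirtSmooth s v F) = tubeMk U (wirtSmooth s v G) := by
  rw [tubeMk_eq] at h ⊢
  intro w hw
  have h1 := (h w hw).wirt ((contDiffAt_of_tube (F.2.sub G.2) hw 0).of_le two_le_infty) s v
  refine h1.congr ?_
  filter_upwards [(isOpen_tube U).mem_nhds ((mem_tube (p := (w, (0 : Cn n)))).2 hw)] with p hp
  exact wirt_sub (differentiableAt_of_tube F.2 (mem_tube.1 hp) p.2)
    (differentiableAt_of_tube G.2 (mem_tube.1 hp) p.2) s v

/-- The linear map `wirt s v` on the algebra of formal functions. -/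
def wirtL (s : ℂ) (v : Cn n × Cn n) : FormalTube U →ₗ[ℂ] FormalTube U :=
  have key : ∀ F : SmoothTube U, tubeMk U (wirtSmooth s v
      (Function.surjInv tubeMk_surjective (tubeMk U F))) = tubeMk U (wirtSmooth s v F) :=
    fun F => tubeMk_wirtSmooth_congr (Function.surjInv_eq tubeMk_surjective _) s v
  { toFun := fun q => tubeMk U (wirtSmooth s v (Function.surjInv tubeMk_surjective q))
    map_add' := fun a b => by
      obtain ⟨F, rfl⟩ := tubeMk_surjective a
      obtain ⟨G, rfl⟩ := tubeMk_surjective b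
      rw [← map_add, key, key, key, ← map_add]
      exact tubeMk_eq_of_eqOn fun p hp =>
        wirt_add (differentiableAt_of_tube F.2 (mem_tube.1 hp) p.2)
          (differentiableAt_of_tube G.2 (mem_tube.1 hp) p.2) s v
    map_smul' := fun c a => by
      obtain ⟨F, rfl⟩ := tubeMk_surjective a
      rw [← map_smul, key, key, RingHom.id_apply, ← map_smul]
      exact tubeMk_eq_of_eqOn fun p hp =>
        wirt_const_smul (differentiableAt_of_tube F.2 (mem_tube.1 hp) p.2) c s v }

theorem wirtL_tubeMk (s : ℂ) (v : Cn n × Cn n) (F : SmoothTube U) :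
    wirtL s v (tubeMk U F) = tubeMk U (wirtSmooth s v F) :=
  tubeMk_wirtSmooth_congr (Function.surjInv_eq tubeMk_surjective _) s v

theorem wirtL_mul (s : ℂ) (v : Cn n × Cn n) (a b : FormalTube U) :
    wirtL s v (a * b) = a * wirtL s v b + b * wirtL s v a := by
  obtain ⟨F, rfl⟩ := tubeMk_surjective a
  obtain ⟨G, rfl⟩ := tubeMk_surjective b
  rw [← map_mul, wirtL_tubeMk, wirtL_tubeMk, wirtL_tubeMk, ← map_mul, ← map_mul, ← map_add]
  exact tubeMk_eq_of_eqOn fun p hp =>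
    wirt_mul (differentiableAt_of_tube F.2 (mem_tube.1 hp) p.2)
      (differentiableAt_of_tube G.2 (mem_tube.1 hp) p.2) s v

/-- The derivation `wirt s v` of the algebra of formal functions. -/
def wirtD (s : ℂ) (v : Cn n × Cn n) : Derivation ℂ (FormalTube U) (FormalTube U) where
  toLinearMap := wirtL s v
  map_one_eq_zero' := by
    have h := wirtL_mul (U := U) s v 1 1
    rw [mul_one, one_mul] at h
    exact left_eq_add.1 h
  leibniz' := wirtL_mul s v

theorem wirtD_tubeMk (s : ℂ) (v : Cn n × Cn n) (F : SmoothTube U) :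
    wirtD s v (tubeMk U F) = tubeMk U (wirtSmooth s v F) := wirtL_tubeMk s v F

theorem fderiv_wirt {F : Cn n × Cn n → ℂ} (hF : ContDiffOn ℝ ∞ F (tube U)) {p : Cn n × Cn n}
    (hp : p ∈ tube U) (s : ℂ) (u v : Cn n × Cn n) :
    fderiv ℝ (wirt s u F) p v = wirt s u (fun q => fderiv ℝ F q v) p := by
  have hd : ∀ a, DifferentiableAt ℝ (fun q => fderiv ℝ F q a) p := fun a =>
    differentiableAt_of_tube (contDiffOn_fderiv_apply hF a) (mem_tube.1 hp) p.2
  have h1 : wirt s u F = fun q => (2 : ℂ)⁻¹ • (fderiv ℝ F q u + s • fderiv ℝ F q (Complex.I • u)) := by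
    funext q
    simp only [wirt, smul_eq_mul]
    ring
  rw [h1, fderiv_fun_const_smul ((hd _).fun_add ((hd _).fun_const_smul s)),
    fderiv_fun_add (hd _) ((hd _).fun_const_smul s), fderiv_fun_const_smul (hd _)]
  simp only [FunLike.coe_add, Pi.add_apply, FunLike.coe_smul, Pi.smul_apply, smul_eq_mul, wirt]
  rw [fderiv_fderiv_comm hF hp u v, fderiv_fderiv_comm hF hp (Complex.I • u) v]
  ring

theorem wirtD_comm (s t : ℂ) (u v : Cn n × Cn n) (q : FormalTube U) :
    wirtD s u (wirtD t v q) = wirtD t v (wirtD s u q) := by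
  obtain ⟨F, rfl⟩ := tubeMk_surjective q
  simp only [wirtD_tubeMk]
  refine tubeMk_eq_of_eqOn fun p hp => ?_
  change wirt s u (wirt t v F.1) p = wirt t v (wirt s u F.1) p
  conv_lhs => rw [wirt, fderiv_wirt F.2 hp, fderiv_wirt F.2 hp]
  conv_rhs => rw [wirt, fderiv_wirt F.2 hp, fderiv_wirt F.2 hp]
  simp only [wirt]
  rw [fderiv_fderiv_comm F.2 hp u v, fderiv_fderiv_comm F.2 hp u (Complex.I • v),
    fderiv_fderiv_comm F.2 hp (Complex.I • u) v,
    fderiv_fderiv_comm F.2 hp (Complex.I • u) (Complex.I • v)]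
  ring

/-- The derivations `∂/∂z^k`. -/
abbrev dZ (k : Fin n) : Derivation ℂ (FormalTube U) (FormalTube U) :=
  wirtD (-Complex.I) (baseVec k)

/-- The derivations `∂/∂z̄^k`. -/
abbrev dZbar (k : Fin n) : Derivation ℂ (FormalTube U) (FormalTube U) :=
  wirtD Complex.I (baseVec k)

/-- The derivations `∂/∂ζ_k`. -/
abbrev dZeta (k : Fin n) : Derivation ℂ (FormalTube U) (FormalTube U) :=
  wirtD (-Complex.I) (fibreVec k)

/-- The derivations `∂/∂ζ̄_k`. -/
abbrev dZetabar (k : Fin n) : Derivation ℂ (FormalTube U) (FormalTube U) :=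
  wirtD Complex.I (fibreVec k)

/-- A function on the base as a formal function. -/
def baseFun (f : Cn n → ℂ) (hf : ContDiffOn ℝ ∞ f U) : FormalTube U :=
  tubeMk U ⟨fun p => f p.1, hf.comp contDiffOn_fst fun _ hp => mem_tube.1 hp⟩

/-- A linear function of the fibre variable as a formal function. -/
def fibreFun (L : Cn n →L[ℝ] ℂ) : FormalTube U :=
  tubeMk U ⟨fun p => L p.2, (L.contDiff.comp contDiff_snd).contDiffOn⟩

/-- The fibre coordinate `ζ_k`. -/
def zeta (k : Fin n) : FormalTube U :=
  fibreFun ((ContinuousLinearMap.proj k : Cn n →L[ℂ] ℂ).restrictScalars ℝ)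

/-- The fibre coordinate `ζ̄_k`. -/
def zetabar (k : Fin n) : FormalTube U :=
  fibreFun (Complex.conjCLE.toContinuousLinearMap.comp
    ((ContinuousLinearMap.proj k : Cn n →L[ℂ] ℂ).restrictScalars ℝ))

theorem wirtD_fibreVec_baseFun (s : ℂ) (k : Fin n) (f : Cn n → ℂ) (hf : ContDiffOn ℝ ∞ f U) :
    wirtD s (fibreVec k) (baseFun f hf) = 0 := by
  rw [baseFun, wirtD_tubeMk, tubeMk_eq_zero]
  intro w hw
  refine flatAt_of_eqOn (fun p hp => ?_) hw
  have hd : HasFDerivAt (fun p : Cn n × Cn n => f p.1)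
      ((fderiv ℝ f p.1).comp (ContinuousLinearMap.fst ℝ _ _)) p :=
    ((hf.contDiffAt (U.isOpen.mem_nhds (mem_tube.1 hp))).differentiableAt
      (by simp)).hasFDerivAt.comp p hasFDerivAt_fst
  simp [wirtSmooth, wirt, hd.fderiv, fibreVec]

theorem wirt_fibreFun (s : ℂ) (v : Cn n × Cn n) (L : Cn n →L[ℝ] ℂ) (p : Cn n × Cn n) :
    wirt s v (fun p => L p.2) p = (L v.2 + s * L (Complex.I • v.2)) / 2 := by
  have hd : HasFDerivAt (fun p : Cn n × Cn n => L p.2)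
      (L.comp (ContinuousLinearMap.snd ℝ (Cn n) (Cn n))) p :=
    (L.comp (ContinuousLinearMap.snd ℝ (Cn n) (Cn n))).hasFDerivAt
  simp [wirt, hd.fderiv]

theorem wirtD_fibreFun (s : ℂ) (v : Cn n × Cn n) (L : Cn n →L[ℝ] ℂ) :
    wirtD s v (fibreFun L : FormalTube U) =
      algebraMap ℂ _ ((L v.2 + s * L (Complex.I • v.2)) / 2) := by
  rw [fibreFun, wirtD_tubeMk, ← (tubeMk U).commutes]
  exact tubeMk_eq_of_eqOn fun p _ => wirt_fibreFun s v L p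

theorem dZeta_zeta (k j : Fin n) :
    dZeta k (zeta j : FormalTube U) = if j = k then 1 else 0 := by
  rw [zeta, dZeta, wirtD_fibreFun]
  by_cases h : j = k <;> simp [fibreVec, h]

theorem dZetabar_zeta (k j : Fin n) : dZetabar k (zeta j : FormalTube U) = 0 := by
  rw [zeta, dZetabar, wirtD_fibreFun]
  by_cases h : j = k <;> simp [fibreVec, h]

theorem dZeta_zetabar (k j : Fin n) : dZeta k (zetabar j : FormalTube U) = 0 := by
  rw [zetabar, dZeta, wirtD_fibreFun]
  by_cases h : j = k <;> simp [fibreVec, h]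

theorem dZetabar_zetabar (k j : Fin n) :
    dZetabar k (zetabar j : FormalTube U) = if j = k then 1 else 0 := by
  rw [zetabar, dZetabar, wirtD_fibreFun]
  by_cases h : j = k <;> simp [fibreVec, h]

theorem wirtD_baseVec_zeta (s : ℂ) (k j : Fin n) :
    wirtD s (baseVec k) (zeta j : FormalTube U) = 0 := by
  rw [zeta, wirtD_fibreFun]
  simp [baseVec]

theorem wirtD_baseVec_zetabar (s : ℂ) (k j : Fin n) :
    wirtD s (baseVec k) (zetabar j : FormalTube U) = 0 := by
  rw [zetabar, wirtD_fibreFun]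
  simp [baseVec]

/-! ### Taylor coefficients of formal functions -/

/-- The Taylor coefficients in the fibre variables of a formal function. -/
def coef (r : ℕ) (w : U) (ζ : Cn n) : FormalTube U →ₗ[ℂ] ℂ :=
  have key : ∀ F : SmoothTube U, fibreTaylor r (Function.surjInv tubeMk_surjective (tubeMk U F)).1 w ζ
      = fibreTaylor r F.1 w ζ := fun F => by
    set G := Function.surjInv tubeMk_surjective (tubeMk U F) with hG
    have h := tubeMk_eq.1 (Function.surjInv_eq tubeMk_surjective (tubeMk U F))
    have h1 := FlatAt.fibreTaylor_eq_zero r (G.2.sub F.2) h w w.2 ζ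
    have h2 := fibreTaylor_add (G.2.sub F.2) F.2 w.2 r ζ
    simp only [sub_add_cancel] at h2
    rw [h2]
    exact (congrArg (· + _) h1).trans (zero_add _)
  { toFun := fun q => fibreTaylor r (Function.surjInv tubeMk_surjective q).1 w ζ
    map_add' := fun a b => by
      obtain ⟨F, rfl⟩ := tubeMk_surjective a
      obtain ⟨G, rfl⟩ := tubeMk_surjective b
      rw [← map_add, key, key, key]
      exact fibreTaylor_add F.2 G.2 w.2 r ζ
    map_smul' := fun c a => by
      obtain ⟨F, rfl⟩ := tubeMk_surjective a
      rw [← map_smul, key, key]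
      exact fibreTaylor_base_mul (fun _ => c) F.1 w r ζ }

theorem coef_tubeMk (r : ℕ) (w : U) (ζ : Cn n) (F : SmoothTube U) :
    coef r w ζ (tubeMk U F) = fibreTaylor r F.1 w ζ := by
  set G := Function.surjInv tubeMk_surjective (tubeMk U F) with hG
  have h := tubeMk_eq.1 (Function.surjInv_eq tubeMk_surjective (tubeMk U F))
  have h1 := FlatAt.fibreTaylor_eq_zero r (G.2.sub F.2) h w w.2 ζ
  have h2 := fibreTaylor_add (G.2.sub F.2) F.2 w.2 r ζ
  simp only [sub_add_cancel] at h2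
  change fibreTaylor r G.1 w ζ = _
  rw [h2]
  exact (congrArg (· + _) h1).trans (zero_add _)

/-- This identifies the quotient with a space of formal power series: a function whose fibre Taylor
coefficients all vanish is flat. Identities between formal functions can then be checked degree by
degree. -/
theorem formalTube_ext {a b : FormalTube U} (h : ∀ r (w : U) ζ, coef r w ζ a = coef r w ζ b) :
    a = b := by
  rw [← sub_eq_zero]
  obtain ⟨F, hF⟩ := tubeMk_surjective (a - b)
  rw [← hF, tubeMk_eq_zero]
  intro w hw
  refine flatAt_of_fibreTaylor_eq_zero F.2 (fun r w hw ζ => ?_) hw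
  rw [← coef_tubeMk r ⟨w, hw⟩, hF, map_sub, h, sub_self]

theorem coef_zero (w : U) (ζ : Cn n) (F : SmoothTube U) : coef 0 w ζ (tubeMk U F) = F.1 (w, 0) := by
  rw [coef_tubeMk, fibreTaylor_zero]

theorem fderiv_eq_wirt (F : Cn n × Cn n → ℂ) (p v : Cn n × Cn n) :
    fderiv ℝ F p v = wirt (-Complex.I) v F p + wirt Complex.I v F p := by
  simp only [wirt]
  ring

/-- Euler's formula: one derivative in `t` is the derivative along `(0, ζ)`, which splits into its
two types. -/
theorem coef_succ (r : ℕ) (w : U) (ζ : Cn n) (q : FormalTube U) :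
    coef (r + 1) w ζ q = ∑ k, (ζ k * coef r w ζ (dZeta k q) +
      (starRingEnd ℂ) (ζ k) * coef r w ζ (dZetabar k q)) := by
  obtain ⟨F, rfl⟩ := tubeMk_surjective q
  simp only [dZeta, dZetabar, wirtD_tubeMk, coef_tubeMk]
  rw [fibreTaylor_succ F.2 w.2]
  have hs := fun s k => contDiffOn_wirt F.2 s (fibreVec k)
  have h1 : (fun p => fderiv ℝ F.1 p (0, ζ)) = fun p => ∑ k, (ζ k * wirt (-Complex.I) (fibreVec k) F.1 p +
      (starRingEnd ℂ) (ζ k) * wirt Complex.I (fibreVec k) F.1 p) := by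
    funext p
    rw [fderiv_eq_wirt, wirt_neg_I, wirt_I, ← Finset.sum_add_distrib]
    simp
  rw [h1, fibreTaylor_sum (fun k _ => (contDiffOn_const.mul (hs _ _)).add
    (contDiffOn_const.mul (hs _ _))) w.2]
  refine Finset.sum_congr rfl fun k _ => ?_
  rw [fibreTaylor_add (contDiffOn_const.mul (hs _ _)) (contDiffOn_const.mul (hs _ _)) w.2]
  exact congrArg₂ (· + ·) (fibreTaylor_base_mul (fun _ => ζ k) _ w r ζ)
    (fibreTaylor_base_mul (fun _ => (starRingEnd ℂ) (ζ k)) _ w r ζ)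

theorem coef_baseFun_mul (r : ℕ) (w : U) (ζ : Cn n) (f : Cn n → ℂ) (hf : ContDiffOn ℝ ∞ f U)
    (q : FormalTube U) : coef r w ζ (baseFun f hf * q) = f w * coef r w ζ q := by
  obtain ⟨F, rfl⟩ := tubeMk_surjective q
  rw [baseFun, ← map_mul, coef_tubeMk, coef_tubeMk]
  exact fibreTaylor_base_mul f F.1 w r ζ

theorem coef_fibreFun_mul (r : ℕ) (w : U) (ζ : Cn n) (L : Cn n →L[ℝ] ℂ) (q : FormalTube U) :
    coef (r + 1) w ζ (fibreFun L * q) = (r + 1) * (L ζ * coef r w ζ q) := by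
  obtain ⟨F, rfl⟩ := tubeMk_surjective q
  rw [fibreFun, ← map_mul, coef_tubeMk, coef_tubeMk]
  exact fibreTaylor_zeta_mul L r F.2 w.2 ζ

theorem coef_zero_fibreFun_mul (w : U) (ζ : Cn n) (L : Cn n →L[ℝ] ℂ) (q : FormalTube U) :
    coef 0 w ζ (fibreFun L * q) = 0 := by
  obtain ⟨F, rfl⟩ := tubeMk_surjective q
  rw [fibreFun, ← map_mul, coef_zero]
  simp

/-- The Taylor coefficients as functions on the base, extended by zero. -/
def coefFun (r : ℕ) (q : FormalTube U) (ζ w : Cn n) : ℂ :=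
  open Classical in if h : w ∈ U then coef r ⟨w, h⟩ ζ q else 0

theorem coefFun_of_mem (r : ℕ) (q : FormalTube U) (ζ : Cn n) (w : U) :
    coefFun r q ζ w = coef r w ζ q := by
  simp [coefFun]

theorem coefFun_tubeMk_eventuallyEq (r : ℕ) (F : SmoothTube U) (ζ : Cn n) (w : U) :
    coefFun r (tubeMk U F) ζ =ᶠ[𝓝 (w : Cn n)] fun w' => fibreTaylor r F.1 w' ζ := by
  filter_upwards [U.isOpen.mem_nhds w.2] with w' hw'
  rw [coefFun_of_mem r _ ζ ⟨w', hw'⟩, coef_tubeMk]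

/-- Derivatives in the base act on formal series coefficientwise. The extension of the coefficient
by zero is differentiated only at points of the open set `U`. -/
theorem coef_wirt_base (s : ℂ) (r : ℕ) (w : U) (ζ : Cn n) (k : Fin n) (q : FormalTube U) :
    coef r w ζ (wirtD s (baseVec k) q) =
      (fderiv ℝ (coefFun r q ζ) w (Pi.single k 1) +
        s * fderiv ℝ (coefFun r q ζ) w (Pi.single k Complex.I)) / 2 := by
  obtain ⟨F, rfl⟩ := tubeMk_surjective q
  rw [wirtD_tubeMk, coef_tubeMk, (coefFun_tubeMk_eventuallyEq r F ζ w).fderiv_eq,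
    ← (fibreTaylor_fderiv_base r F.2 w.2 ζ _).2, ← (fibreTaylor_fderiv_base r F.2 w.2 ζ _).2]
  have hs := fun v => contDiffOn_fderiv_apply F.2 v
  have h1 : (wirtSmooth s (baseVec k) F).1 = fun p => (2 : ℂ)⁻¹ *
      (fderiv ℝ F.1 p (Pi.single k 1, 0) + s * fderiv ℝ F.1 p (Pi.single k Complex.I, 0)) := by
    funext p
    have hI : Complex.I • (baseVec k : Cn n × Cn n) = (Pi.single k Complex.I, 0) := by
      simp [baseVec, Prod.smul_mk, ← Pi.single_smul]
    simp only [wirtSmooth, wirt, hI]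
    rw [baseVec]
    ring
  rw [h1]
  refine (fibreTaylor_base_mul (fun _ => (2 : ℂ)⁻¹) _ (w : Cn n) r ζ).trans ?_
  rw [fibreTaylor_add (hs _) (contDiffOn_const.mul (hs _)) w.2, div_eq_inv_mul]
  congr 2
  exact fibreTaylor_base_mul (fun _ => s) _ (w : Cn n) r ζ

end FormalTube

/-! ### Algebra of commuting derivations -/

section CommutingDerivations

variable {n : ℕ} {R : Type*} [CommRing R] [Algebra ℂ R]
  {dz dzb dt dtb : Fin n → Derivation ℂ R R} {γ : Fin n → Fin n → R}

/-- The canonical bracket for the derivations `dz = ∂/∂z`, `dzb = ∂/∂z̄`, `dt = ∂/∂ζ`,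
`dtb = ∂/∂ζ̄`. -/
def algBracket (dz dzb dt dtb : Fin n → Derivation ℂ R R) (a b : R) : R :=
  ∑ k, (dt k a * dz k b - dz k a * dt k b + dtb k a * dzb k b - dzb k a * dtb k b)

/-- The equations `∂a/∂ζ̄_l = 0`, `∂a/∂ζ_k = γ^{lk} ∂a/∂z̄^l` that characterize the values of a
source map. -/
def IsSource (dzb dt dtb : Fin n → Derivation ℂ R R) (γ : Fin n → Fin n → R) (a : R) : Prop :=
  (∀ l, dtb l a = 0) ∧ ∀ k, dt k a = ∑ l, γ l k * dzb l a

theorem IsSource.add {a b : R} (ha : IsSource dzb dt dtb γ a) (hb : IsSource dzb dt dtb γ b) :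
    IsSource dzb dt dtb γ (a + b) :=
  ⟨fun l => by rw [map_add, ha.1, hb.1, add_zero],
    fun k => by simp only [map_add, ha.2, hb.2, mul_add, Finset.sum_add_distrib]⟩

theorem IsSource.mul {a b : R} (ha : IsSource dzb dt dtb γ a) (hb : IsSource dzb dt dtb γ b) :
    IsSource dzb dt dtb γ (a * b) := by
  refine ⟨fun l => by rw [Derivation.leibniz, ha.1, hb.1]; simp, fun k => ?_⟩
  rw [Derivation.leibniz, ha.2, hb.2]
  simp only [Derivation.leibniz, smul_eq_mul, mul_add, Finset.sum_add_distrib, Finset.mul_sum]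
  congr 1 <;> exact Finset.sum_congr rfl fun l _ => by ring

theorem IsSource.smul {a : R} (c : ℂ) (ha : IsSource dzb dt dtb γ a) :
    IsSource dzb dt dtb γ (c • a) :=
  ⟨fun l => by rw [Derivation.map_smul, ha.1, smul_zero],
    fun k => by simp only [Derivation.map_smul, ha.2, Finset.smul_sum, mul_smul_comm]⟩

theorem algBracket_swap (a b : R) :
    algBracket dz dzb dt dtb a b = algBracket dzb dz dtb dt a b :=
  Finset.sum_congr rfl fun k _ => by ring

/-- Both `∂/∂ζ_m` and `X_m = Σ γ^{lm} ∂/∂z̄^l` are derivations and agree on `a` and `b`. On the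
bracket they could differ only because `X_m` fails to commute with `∂/∂z^k`. The resulting terms are
`γ^{qk} (∂γ^{lm}/∂z^k) ∂_q̄ a ∂_l̄ b` minus the same with `a`, `b` exchanged, and `hJ` says that
this vanishes. -/
theorem IsSource.bracket {a b : R} (ha : IsSource dzb dt dtb γ a) (hb : IsSource dzb dt dtb γ b)
    (c1 : ∀ i j x, dtb i (dt j x) = dt j (dtb i x)) (c2 : ∀ i j x, dtb i (dz j x) = dz j (dtb i x))
    (c3 : ∀ i j x, dt i (dt j x) = dt j (dt i x)) (c4 : ∀ i j x, dt i (dz j x) = dz j (dt i x))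
    (c5 : ∀ i j x, dt i (dzb j x) = dzb j (dt i x))
    (c6 : ∀ i j x, dz i (dzb j x) = dzb j (dz i x)) (hγ : ∀ k i j, dt k (γ i j) = 0)
    (hJ : ∀ l q p, ∑ k, γ l k * dz k (γ q p) = ∑ k, γ q k * dz k (γ l p)) :
    IsSource dzb dt dtb γ (algBracket dz dzb dt dtb a b) := by
  have hab : algBracket dz dzb dt dtb a b = ∑ k, (dt k a * dz k b - dz k a * dt k b) :=
    Finset.sum_congr rfl fun k _ => by rw [ha.1, hb.1]; ring
  rw [hab]
  refine ⟨fun l => ?_, fun m => ?_⟩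
  · rw [map_sum]
    refine Finset.sum_eq_zero fun k _ => ?_
    simp only [map_sub, Derivation.leibniz, smul_eq_mul, c1, c2, ha.1, hb.1, map_zero]
    ring
  have e1 : ∀ x k, dt k (∑ l, γ l m * dzb l x) = ∑ l, γ l m * dzb l (dt k x) := by
    intro x k
    rw [map_sum]
    refine Finset.sum_congr rfl fun l _ => ?_
    simp only [Derivation.leibniz, hγ, smul_eq_mul, c5]
    ring
  have e2 : ∀ x k, dz k (∑ l, γ l m * dzb l x) =
      ∑ l, γ l m * dzb l (dz k x) + ∑ l, dz k (γ l m) * dzb l x := by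
    intro x k
    rw [map_sum, ← Finset.sum_add_distrib]
    refine Finset.sum_congr rfl fun l _ => ?_
    simp only [Derivation.leibniz, smul_eq_mul, c6]
    ring
  have e3 : ∀ x y : R, (∀ k, dt k x = ∑ l, γ l k * dzb l x) →
      ∑ k, dt k x * ∑ l, dz k (γ l m) * dzb l y =
        ∑ q, ∑ l, (∑ k, γ q k * dz k (γ l m)) * (dzb q x * dzb l y) := by
    intro x y hx
    calc ∑ k, dt k x * ∑ l, dz k (γ l m) * dzb l y
        = ∑ k, ∑ q, ∑ l, γ q k * dz k (γ l m) * (dzb q x * dzb l y) := by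
          refine Finset.sum_congr rfl fun k _ => ?_
          rw [hx k, Finset.sum_mul_sum]
          exact Finset.sum_congr rfl fun q _ => Finset.sum_congr rfl fun l _ => by ring
      _ = _ := by
          rw [Finset.sum_comm]
          refine Finset.sum_congr rfl fun q _ => ?_
          rw [Finset.sum_comm]
          exact Finset.sum_congr rfl fun l _ => by rw [Finset.sum_mul]
  -- The Jacobi identity enters only here, as symmetry in the indices `q` and `l`.
  have e4 : ∑ k, dt k a * ∑ l, dz k (γ l m) * dzb l b =
      ∑ k, dt k b * ∑ l, dz k (γ l m) * dzb l a := by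
    rw [e3 a b ha.2, e3 b a hb.2, Finset.sum_comm]
    refine Finset.sum_congr rfl fun q _ => Finset.sum_congr rfl fun l _ => ?_
    rw [hJ l q m]
    ring
  have lhs : dt m (∑ k, (dt k a * dz k b - dz k a * dt k b)) =
      ∑ k, ((∑ l, γ l m * dzb l (dt k a)) * dz k b +
        dt k a * ∑ l, γ l m * dzb l (dz k b) - (∑ l, γ l m * dzb l (dz k a)) * dt k b -
        dz k a * ∑ l, γ l m * dzb l (dt k b)) +
      (∑ k, dt k a * ∑ l, dz k (γ l m) * dzb l b -
        ∑ k, dt k b * ∑ l, dz k (γ l m) * dzb l a) := by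
    rw [map_sum, ← Finset.sum_sub_distrib, ← Finset.sum_add_distrib]
    refine Finset.sum_congr rfl fun k _ => ?_
    simp only [map_sub, Derivation.leibniz, smul_eq_mul]
    rw [c3 m k a, c3 m k b, c4 m k a, c4 m k b, ha.2 m, hb.2 m, e1, e1, e2, e2]
    ring
  rw [lhs, e4, sub_self, add_zero]
  simp only [map_sum, map_sub, Derivation.leibniz, smul_eq_mul, Finset.mul_sum]
  conv_rhs => rw [Finset.sum_comm]
  refine Finset.sum_congr rfl fun k _ => ?_
  simp only [Finset.sum_mul, ← Finset.sum_add_distrib, ← Finset.sum_sub_distrib]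
  exact Finset.sum_congr rfl fun l _ => by ring

/-- After substitution of both sets of equations the two surviving halves of the bracket are the
same sum `γ^{lk} ∂_l̄ a ∂_k b` with opposite signs. No Jacobi identity is needed. -/
theorem algBracket_source_target {a b : R} (ha : IsSource dzb dt dtb γ a)
    (hb : IsSource dz dtb dt (fun k l => γ l k) b) : algBracket dz dzb dt dtb a b = 0 := by
  have h1 : algBracket dz dzb dt dtb a b =
      ∑ k, (∑ l, γ l k * dzb l a) * dz k b - ∑ l, dzb l a * ∑ k, γ l k * dz k b := by
    rw [← Finset.sum_sub_distrib]
    refine Finset.sum_congr rfl fun k _ => ?_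
    rw [ha.1, hb.1, ha.2, hb.2]
    ring
  rw [h1, sub_eq_zero]
  simp only [Finset.sum_mul, Finset.mul_sum]
  rw [Finset.sum_comm]
  exact Finset.sum_congr rfl fun l _ => Finset.sum_congr rfl fun k _ => by ring

variable {z zb : Fin n → R}

/-- The Euler operator `ζ_k ∂/∂ζ_k + ζ̄_k ∂/∂ζ̄_k`. -/
def euler (dt dtb : Fin n → Derivation ℂ R R) (z zb : Fin n → R) (q : R) : R :=
  ∑ k, (z k * dt k q + zb k * dtb k q)

/-- The operator `ζ_k γ^{lk} ∂/∂z̄^l`. -/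
def fibreOp (dzb : Fin n → Derivation ℂ R R) (γ : Fin n → Fin n → R) (z : Fin n → R) (q : R) : R :=
  ∑ k, z k * ∑ l, γ l k * dzb l q

/-- `∂/∂ζ̄_l` lowers the fibre degree by one, so its commutator with the Euler field is itself, and
it commutes with an operator that does not involve `ζ̄`. -/
theorem euler_dtb {q : R} (h : euler dt dtb z zb q = fibreOp dzb γ z q) (l : Fin n)
    (c1 : ∀ i j x, dtb i (dt j x) = dt j (dtb i x))
    (c2 : ∀ i j x, dtb i (dtb j x) = dtb j (dtb i x))
    (c3 : ∀ i j x, dtb i (dzb j x) = dzb j (dtb i x)) (hγ : ∀ k i j, dtb k (γ i j) = 0)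
    (hz : ∀ k j, dtb k (z j) = 0) (hzb : ∀ k j, dtb k (zb j) = if j = k then 1 else 0) :
    euler dt dtb z zb (dtb l q) + dtb l q = fibreOp dzb γ z (dtb l q) := by
  have h1 := congrArg (dtb l) h
  have h2 : dtb l (euler dt dtb z zb q) = euler dt dtb z zb (dtb l q) + dtb l q := by
    simp only [euler, map_sum, map_add, Derivation.leibniz, smul_eq_mul, hz, hzb, c1, c2 l,
      mul_zero, add_zero, mul_ite, mul_one, Finset.sum_add_distrib, Finset.sum_ite_eq',
      Finset.mem_univ, if_true]
    ring
  rw [← h2, h1]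
  simp only [fibreOp, map_sum, Derivation.leibniz, smul_eq_mul, hz, hγ, c3, mul_zero, add_zero]

/-- Apply `∂/∂ζ_k` and `X_k = Σ γ^{lk} ∂/∂z̄^l` to `R q = 𝔇 q`. The first gives `(R + 1) ∂_ζ q = 𝔇
∂_ζ q + X_k q`. The second gives `R X_k q = 𝔇 X_k q`, provided that the fields `X_j` commute, which
is what `hJ` says. Subtract. -/
theorem euler_defect {q : R} (h : euler dt dtb z zb q = fibreOp dzb γ z q) (k : Fin n)
    (c1 : ∀ i j x, dt i (dt j x) = dt j (dt i x)) (c2 : ∀ i j x, dt i (dtb j x) = dtb j (dt i x))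
    (c3 : ∀ i j x, dt i (dzb j x) = dzb j (dt i x))
    (c4 : ∀ i j x, dtb i (dzb j x) = dzb j (dtb i x))
    (c5 : ∀ i j x, dzb i (dzb j x) = dzb j (dzb i x))
    (hγ : ∀ k i j, dt k (γ i j) = 0) (hγ' : ∀ k i j, dtb k (γ i j) = 0)
    (hz : ∀ k j, dt k (z j) = if j = k then 1 else 0) (hzb : ∀ k j, dt k (zb j) = 0)
    (hz' : ∀ k j, dzb k (z j) = 0) (hzb' : ∀ k j, dzb k (zb j) = 0)
    (hJ : ∀ k q p, ∑ l, γ l k * dzb l (γ q p) = ∑ l, γ l p * dzb l (γ q k)) :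
    euler dt dtb z zb (dt k q - ∑ l, γ l k * dzb l q) + (dt k q - ∑ l, γ l k * dzb l q) =
      fibreOp dzb γ z (dt k q - ∑ l, γ l k * dzb l q) := by
  -- Packaging `X_k` as a derivation gives access to the Leibniz rule in the commutator
  -- computations.
  have X : ∀ (k : Fin n), ∃ X : Derivation ℂ R R, ∀ q, X q = ∑ l, γ l k * dzb l q := fun k =>
    ⟨∑ l, γ l k • dzb l, fun q => by
      have h := map_sum (Derivation.coeFnAddMonoidHom (R := ℂ) (A := R) (M := R))
        (fun l => γ l k • dzb l) Finset.univ
      refine (congrFun h q).trans ?_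
      rw [Finset.sum_apply]
      rfl⟩
  choose X hX using X
  have hXz : ∀ k j, X k (z j) = 0 := fun k j => by simp [hX, hz']
  have hXzb : ∀ k j, X k (zb j) = 0 := fun k j => by simp [hX, hzb']
  have hXt : ∀ k j x, X k (dt j x) = dt j (X k x) := fun k j x => by
    simp only [hX, map_sum, Derivation.leibniz, smul_eq_mul, hγ, c3, mul_zero, add_zero]
  have hXtb : ∀ k j x, X k (dtb j x) = dtb j (X k x) := fun k j x => by
    simp only [hX, map_sum, Derivation.leibniz, smul_eq_mul, hγ', c4, mul_zero, add_zero]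
  -- The second-order terms agree because the `∂/∂z̄` commute, the first-order ones by the Jacobi
  -- identity.
  have hXX : ∀ k j x, X k (X j x) = X j (X k x) := fun k j x => by
    have e : ∀ k j, X k (X j x) = ∑ m, ∑ l, γ m j * (γ l k * dzb l (dzb m x)) +
        ∑ m, X k (γ m j) * dzb m x := fun k j => by
      rw [hX j, map_sum, ← Finset.sum_add_distrib]
      refine Finset.sum_congr rfl fun m _ => ?_
      rw [Derivation.leibniz, smul_eq_mul, smul_eq_mul, hX k (dzb m x), Finset.mul_sum]
      ring
    rw [e k j, e j k]
    congr 1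
    · rw [Finset.sum_comm]
      refine Finset.sum_congr rfl fun m _ => Finset.sum_congr rfl fun l _ => ?_
      rw [c5]
      ring
    · refine Finset.sum_congr rfl fun m _ => ?_
      rw [hX, hX, hJ]
  have hop : ∀ x, fibreOp dzb γ z x = ∑ k, z k * X k x := fun x => by simp only [fibreOp, hX]
  rw [← hX]
  rw [hop] at h
  have e1 : dt k (euler dt dtb z zb q) = euler dt dtb z zb (dt k q) + dt k q := by
    simp only [euler, map_sum, map_add, Derivation.leibniz, smul_eq_mul, hz, hzb, c1 k, c2,
      mul_zero, add_zero, mul_ite, mul_one, Finset.sum_add_distrib, Finset.sum_ite_eq',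
      Finset.mem_univ, if_true]
    ring
  have e2 : X k (euler dt dtb z zb q) = euler dt dtb z zb (X k q) := by
    simp only [euler, map_sum, map_add, Derivation.leibniz, smul_eq_mul, hXz, hXzb, hXt, hXtb,
      mul_zero, add_zero]
  have e3 : dt k (∑ j, z j * X j q) = ∑ j, z j * X j (dt k q) + X k q := by
    simp only [map_sum, Derivation.leibniz, smul_eq_mul, hz, hXt, mul_ite, mul_one, mul_zero,
      Finset.sum_add_distrib, Finset.sum_ite_eq', Finset.mem_univ, if_true]
  have e4 : X k (∑ j, z j * X j q) = ∑ j, z j * X j (X k q) := by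
    simp only [map_sum, Derivation.leibniz, smul_eq_mul, hXz, mul_zero, add_zero, hXX k]
  have e5 : euler dt dtb z zb (dt k q - X k q) =
      euler dt dtb z zb (dt k q) - euler dt dtb z zb (X k q) := by
    simp only [euler, map_sub]
    rw [← Finset.sum_sub_distrib]
    exact Finset.sum_congr rfl fun j _ => by ring
  have e6 : ∑ j, z j * X j (dt k q - X k q) =
      ∑ j, z j * X j (dt k q) - ∑ j, z j * X j (X k q) := by
    simp only [map_sub, mul_sub, Finset.sum_sub_distrib]
  rw [hop, e5, e6]
  rw [h] at e1 e2
  rw [e3] at e1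
  rw [e4] at e2
  linear_combination -e1 + e2

end CommutingDerivations

/-! ### Derivations of dual numbers -/

section EpsDerivation

variable {A : Type*} [CommRing A] [Algebra ℂ A]

/-- The element `a + ε b`. -/
def epsMk {A : Type*} (a b : A) : A[ε] := (a, b)

@[simp] theorem fst_epsMk {A : Type*} (a b : A) : (epsMk a b).fst = a := rfl

@[simp] theorem snd_epsMk {A : Type*} (a b : A) : (epsMk a b).snd = b := rfl

theorem fst_dual_mul (a b : A[ε]) : (a * b).fst = a.fst * b.fst := rfl

theorem snd_dual_mul (a b : A[ε]) : (a * b).snd = a.fst * b.snd + a.snd * b.fst := by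
  simp [TrivSqZeroExt.snd_mul, smul_eq_mul, mul_comm]

theorem fst_dual_sum {ι : Type*} (s : Finset ι) (f : ι → A[ε]) :
    (∑ i ∈ s, f i).fst = ∑ i ∈ s, (f i).fst := map_sum (TrivSqZeroExt.fstHom ℂ A A) f s

theorem snd_dual_sum {ι : Type*} (s : Finset ι) (f : ι → A[ε]) :
    (∑ i ∈ s, f i).snd = ∑ i ∈ s, (f i).snd := map_sum (TrivSqZeroExt.sndHom A A) f s

/-- The `ε`-linear extension of a derivation. -/
def epsD (d : Derivation ℂ A A) : Derivation ℂ A[ε] A[ε] :=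
  Derivation.mk'
    { toFun := fun a => epsMk (d a.fst) (d a.snd)
      map_add' := fun a b => TrivSqZeroExt.ext (by simp) (by simp)
      map_smul' := fun c a => TrivSqZeroExt.ext (by simp) (by simp) }
    (fun a b => by
      refine TrivSqZeroExt.ext ?_ ?_
      · simp [smul_eq_mul]
      · simp only [smul_eq_mul, LinearMap.coe_mk, AddHom.coe_mk, snd_epsMk, snd_dual_mul, map_add,
          Derivation.leibniz, TrivSqZeroExt.snd_add, fst_epsMk]
        ring)

@[simp] theorem fst_epsD (d : Derivation ℂ A A) (a : A[ε]) : (epsD d a).fst = d a.fst := rfl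

@[simp] theorem snd_epsD (d : Derivation ℂ A A) (a : A[ε]) : (epsD d a).snd = d a.snd := rfl

theorem epsD_comm {d e : Derivation ℂ A A} (h : ∀ x, d (e x) = e (d x)) (a : A[ε]) :
    epsD d (epsD e a) = epsD e (epsD d a) :=
  TrivSqZeroExt.ext (h _) (h _)

end EpsDerivation

/-! ### Source and target equations over an open set -/

section LocalSource

open Set Filter TopologicalSpace

variable {n : ℕ} {U : Opens (Cn n)}

/-- The sign that distinguishes `∂/∂z̄` (`true`) from `∂/∂z` (`false`). -/
def sg (σ : Bool) : ℂ := cond σ Complex.I (-Complex.I)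

/-- The operators `∂/∂z̄^l` (`true`) and `∂/∂z^l` (`false`) on functions on `ℂⁿ`. -/
def dw (σ : Bool) (l : Fin n) (u : Cn n → ℂ) (w : Cn n) : ℂ :=
  (fderiv ℝ u w (Pi.single l 1) + sg σ * fderiv ℝ u w (Pi.single l Complex.I)) / 2

theorem dw_true (l : Fin n) : dw true l = dzbar l := rfl

theorem dw_false (l : Fin n) : dw false l = dz l := by
  funext u w
  simp only [dw, dz, sg, cond_false]
  ring

theorem dw_congr {σ : Bool} {l : Fin n} {u v : Cn n → ℂ} {w : Cn n} (h : u =ᶠ[𝓝 w] v) :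
    dw σ l u w = dw σ l v w := by
  simp only [dw, h.fderiv_eq]

/-- The derivations `∂/∂z̄` (`true`) and `∂/∂z` (`false`). -/
abbrev dB (σ : Bool) (k : Fin n) : Derivation ℂ (FormalTube U) (FormalTube U) :=
  wirtD (sg σ) (baseVec k)

/-- The derivations `∂/∂ζ̄` (`true`) and `∂/∂ζ` (`false`). -/
abbrev dF (σ : Bool) (k : Fin n) : Derivation ℂ (FormalTube U) (FormalTube U) :=
  wirtD (sg σ) (fibreVec k)

/-- The linear functions `ζ_k` (`true`) and `ζ̄_k` (`false`). -/
def fibL (σ : Bool) (k : Fin n) : Cn n →L[ℝ] ℂ :=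
  cond σ ((ContinuousLinearMap.proj k : Cn n →L[ℂ] ℂ).restrictScalars ℝ)
    (Complex.conjCLE.toContinuousLinearMap.comp
      ((ContinuousLinearMap.proj k : Cn n →L[ℂ] ℂ).restrictScalars ℝ))

theorem fibL_true (k : Fin n) (ζ : Cn n) : fibL true k ζ = ζ k := rfl

theorem fibL_false (k : Fin n) (ζ : Cn n) : fibL false k ζ = (starRingEnd ℂ) (ζ k) := rfl

/-- The fibre coordinates `ζ_k` (`true`) and `ζ̄_k` (`false`) as formal functions. -/
def fib (σ : Bool) (k : Fin n) : FormalTube U := fibreFun (fibL σ k)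

theorem dF_fib (σ : Bool) (k j : Fin n) : dF σ k (fib σ j : FormalTube U) = 0 := by
  cases σ
  · exact dZeta_zetabar k j
  · exact dZetabar_zeta k j

theorem dF_not_fib (σ : Bool) (k j : Fin n) :
    dF (!σ) k (fib σ j : FormalTube U) = if j = k then 1 else 0 := by
  cases σ
  · exact dZetabar_zetabar k j
  · exact dZeta_zeta k j

theorem dB_fib (τ σ : Bool) (k j : Fin n) : dB τ k (fib σ j : FormalTube U) = 0 := by
  cases σ
  · exact wirtD_baseVec_zetabar _ k j
  · exact wirtD_baseVec_zeta _ k j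

theorem coef_succ_fib (σ : Bool) (r : ℕ) (w : U) (ζ : Cn n) (q : FormalTube U) :
    coef (r + 1) w ζ q = ∑ k, (fibL σ k ζ * coef r w ζ (dF (!σ) k q) +
      fibL (!σ) k ζ * coef r w ζ (dF σ k q)) := by
  rw [coef_succ]
  refine Finset.sum_congr rfl fun k _ => ?_
  cases σ
  · exact add_comm _ _
  · rfl

theorem coef_dB (σ : Bool) (r : ℕ) (w : U) (ζ : Cn n) (k : Fin n) (q : FormalTube U) :
    coef r w ζ (dB σ k q) = dw σ k (coefFun r q ζ) w := coef_wirt_base _ r w ζ k q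

theorem coef_dB_eq_zero {σ : Bool} {r : ℕ} {ζ : Cn n} {q : FormalTube U}
    (h : ∀ w : U, coef r w ζ q = 0) (k : Fin n) (w : U) : coef r w ζ (dB σ k q) = 0 := by
  have h1 : coefFun r q ζ = fun _ => 0 := by
    funext w'
    by_cases hw : w' ∈ U
    · exact (coefFun_of_mem r q ζ ⟨w', hw⟩).trans (h _)
    · simp [coefFun, hw]
  rw [coef_dB, h1]
  simp [dw]

theorem contDiffOn_dw {u : Cn n → ℂ} (hu : ContDiffOn ℝ ∞ u U) (σ : Bool) (l : Fin n) :
    ContDiffOn ℝ ∞ (dw σ l u) U := by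
  have h := hu.fderiv_of_isOpen U.isOpen (m := ∞) (by simp)
  exact ((h.clm_apply contDiffOn_const).add
    (contDiffOn_const.mul (h.clm_apply contDiffOn_const))).div_const 2

theorem dB_baseFun (σ : Bool) (l : Fin n) (u : Cn n → ℂ) (hu : ContDiffOn ℝ ∞ u U) :
    dB σ l (baseFun u hu) = baseFun (dw σ l u) (contDiffOn_dw hu σ l) := by
  rw [baseFun, wirtD_tubeMk]
  refine tubeMk_eq_of_eqOn fun p hp => ?_
  have hd : HasFDerivAt (fun p : Cn n × Cn n => u p.1)
      ((fderiv ℝ u p.1).comp (ContinuousLinearMap.fst ℝ _ _)) p :=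
    ((hu.contDiffAt (U.isOpen.mem_nhds (mem_tube.1 hp))).differentiableAt
      (by simp)).hasFDerivAt.comp p hasFDerivAt_fst
  simp [wirtSmooth, wirt, hd.fderiv, baseVec, dw, ← Pi.single_smul]

theorem coef_baseFun (r : ℕ) (w : U) (ζ : Cn n) {u : Cn n → ℂ} (hu : ContDiffOn ℝ ∞ u U) :
    coef r w ζ (baseFun u hu) = if r = 0 then u w else 0 := by
  rw [baseFun, coef_tubeMk]
  simp [fibreTaylor, iteratedDeriv_const]

variable (U) in
/-- The components over `U` of a tensor `γ + ε η`. -/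
structure LocalTensor where
  g : Fin n → Fin n → Cn n → ℂ
  h : Fin n → Fin n → Cn n → ℂ
  smooth_g : ∀ l k, ContDiffOn ℝ ∞ (g l k) U
  smooth_h : ∀ l k, ContDiffOn ℝ ∞ (h l k) U

/-- The components of a tensor as formal functions. -/
def LocalTensor.coeff (c : LocalTensor U) (l k : Fin n) : (FormalTube U)[ε] :=
  epsMk (baseFun (c.g l k) (c.smooth_g l k)) (baseFun (c.h l k) (c.smooth_h l k))

/-- The Jacobi identities for `γ + ε η`. -/
structure LocalTensor.Jacobi (c : LocalTensor U) (σ : Bool) : Prop where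
  left₀ : ∀ w ∈ U, ∀ l q p, ∑ k, c.g l k w * dw (!σ) k (c.g q p) w =
    ∑ k, c.g q k w * dw (!σ) k (c.g l p) w
  left₁ : ∀ w ∈ U, ∀ l q p, ∑ k, (c.g l k w * dw (!σ) k (c.h q p) w +
      c.h l k w * dw (!σ) k (c.g q p) w) =
    ∑ k, (c.g q k w * dw (!σ) k (c.h l p) w + c.h q k w * dw (!σ) k (c.g l p) w)
  right₀ : ∀ w ∈ U, ∀ k q p, ∑ l, c.g l k w * dw σ l (c.g q p) w =
    ∑ l, c.g l p w * dw σ l (c.g q k) w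
  right₁ : ∀ w ∈ U, ∀ k q p, ∑ l, (c.g l k w * dw σ l (c.h q p) w +
      c.h l k w * dw σ l (c.g q p) w) =
    ∑ l, (c.g l p w * dw σ l (c.h q k) w + c.h l p w * dw σ l (c.g q k) w)

theorem epsD_dB_coeff (c : LocalTensor U) (σ : Bool) (j l k : Fin n) :
    epsD (dB σ j) (c.coeff l k) =
      epsMk (baseFun (dw σ j (c.g l k)) (contDiffOn_dw (c.smooth_g l k) σ j))
        (baseFun (dw σ j (c.h l k)) (contDiffOn_dw (c.smooth_h l k) σ j)) :=
  TrivSqZeroExt.ext (dB_baseFun _ _ _ (c.smooth_g l k)) (dB_baseFun _ _ _ (c.smooth_h l k))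

theorem epsD_dF_coeff (c : LocalTensor U) (σ : Bool) (j l k : Fin n) :
    epsD (dF σ j) (c.coeff l k) = 0 :=
  TrivSqZeroExt.ext (wirtD_fibreVec_baseFun _ _ _ (c.smooth_g l k))
    (wirtD_fibreVec_baseFun _ _ _ (c.smooth_h l k))

/-- Over the dual numbers one identity for `g + εh` contains both the Jacobi identity, as its
constant part, and the deformation condition, as its `ε`-part. Every later argument can then be
algebra over `R[ε]` with no separate treatment of `h`. -/
theorem LocalTensor.Jacobi.left {c : LocalTensor U} {σ : Bool} (hc : c.Jacobi σ) (l q p : Fin n) :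
    ∑ k, c.coeff l k * epsD (dB (!σ) k) (c.coeff q p) =
      ∑ k, c.coeff q k * epsD (dB (!σ) k) (c.coeff l p) := by
  simp only [epsD_dB_coeff]
  refine TrivSqZeroExt.ext ?_ ?_ <;> refine formalTube_ext fun r w ζ => ?_
  · simp only [fst_dual_sum, fst_dual_mul, fst_epsMk, LocalTensor.coeff, map_sum, coef_baseFun_mul,
      coef_baseFun]
    by_cases hr : r = 0 <;> simp [hr, hc.left₀ w w.2 l q p]
  · simp only [snd_dual_sum, snd_dual_mul, snd_epsMk, fst_epsMk, LocalTensor.coeff, map_sum,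
      map_add, coef_baseFun_mul, coef_baseFun]
    by_cases hr : r = 0 <;> simp [hr, hc.left₁ w w.2 l q p]

theorem LocalTensor.Jacobi.right {c : LocalTensor U} {σ : Bool} (hc : c.Jacobi σ) (k q p : Fin n) :
    ∑ l, c.coeff l k * epsD (dB σ l) (c.coeff q p) =
      ∑ l, c.coeff l p * epsD (dB σ l) (c.coeff q k) := by
  simp only [epsD_dB_coeff]
  refine TrivSqZeroExt.ext ?_ ?_ <;> refine formalTube_ext fun r w ζ => ?_
  · simp only [fst_dual_sum, fst_dual_mul, fst_epsMk, LocalTensor.coeff, map_sum, coef_baseFun_mul,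
      coef_baseFun]
    by_cases hr : r = 0 <;> simp [hr, hc.right₀ w w.2 k q p]
  · simp only [snd_dual_sum, snd_dual_mul, snd_epsMk, fst_epsMk, LocalTensor.coeff, map_sum,
      map_add, coef_baseFun_mul, coef_baseFun]
    by_cases hr : r = 0 <;> simp [hr, hc.right₁ w w.2 k q p]

/-- The equations for the source map (`true`) and for the target map (`false`) over `U`. -/
def LocalTensor.Source (c : LocalTensor U) (σ : Bool) (a : (FormalTube U)[ε]) : Prop :=
  IsSource (fun l => epsD (dB σ l)) (fun k => epsD (dF (!σ) k)) (fun l => epsD (dF σ l)) c.coeff a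

/-- The operator `ζ_k γ^{lk} ∂/∂z̄^l` and its conjugate. -/
def opF (σ : Bool) (γ : Fin n → Fin n → Cn n → ℂ) (u : Cn n → Cn n → ℂ) (w ζ : Cn n) : ℂ :=
  ∑ k, ∑ l, fibL σ k ζ * γ l k w * dw σ l (fun v => u v ζ) w

/-- In Euler's formula the `ζ̄` terms (for `σ = true`) drop out and the `ζ` derivatives are replaced
through the source equations. -/
theorem LocalTensor.Source.coef_succ {c : LocalTensor U} {σ : Bool} {a : (FormalTube U)[ε]}
    (ha : c.Source σ a) (r : ℕ) (w : U) (ζ : Cn n) :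
    coef (r + 1) w ζ a.fst = opF σ c.g (fun v ζ => coefFun r a.fst ζ v) w ζ ∧
    coef (r + 1) w ζ a.snd = opF σ c.g (fun v ζ => coefFun r a.snd ζ v) w ζ +
      opF σ c.h (fun v ζ => coefFun r a.fst ζ v) w ζ := by
  have h1 : ∀ l, dF σ l a.fst = 0 ∧ dF σ l a.snd = 0 := fun l =>
    ⟨congrArg TrivSqZeroExt.fst (ha.1 l), congrArg TrivSqZeroExt.snd (ha.1 l)⟩
  have h2 := fun k => congrArg TrivSqZeroExt.fst (ha.2 k)
  have h3 := fun k => congrArg TrivSqZeroExt.snd (ha.2 k)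
  simp only [fst_dual_sum, fst_dual_mul, fst_epsMk, snd_epsMk, LocalTensor.coeff, fst_epsD,
    snd_dual_sum, snd_dual_mul, snd_epsD] at h2 h3
  constructor
  · rw [coef_succ_fib σ, opF]
    refine Finset.sum_congr rfl fun k _ => ?_
    rw [(h1 k).1, h2, map_zero, mul_zero, add_zero, map_sum, Finset.mul_sum]
    refine Finset.sum_congr rfl fun l _ => ?_
    rw [coef_baseFun_mul, coef_dB, mul_assoc]
  · rw [coef_succ_fib σ, opF, opF, ← Finset.sum_add_distrib]
    refine Finset.sum_congr rfl fun k _ => ?_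
    rw [(h1 k).2, h3, map_zero, mul_zero, add_zero, map_sum, Finset.mul_sum,
      ← Finset.sum_add_distrib]
    refine Finset.sum_congr rfl fun l _ => ?_
    rw [map_add, coef_baseFun_mul, coef_baseFun_mul, coef_dB, coef_dB]
    ring

theorem opF_congr {σ : Bool} {γ : Fin n → Fin n → Cn n → ℂ} {u v : Cn n → Cn n → ℂ}
    (h : ∀ w ∈ U, ∀ ζ, u w ζ = v w ζ) {w : Cn n} (hw : w ∈ U) (ζ : Cn n) :
    opF σ γ u w ζ = opF σ γ v w ζ := by
  refine Finset.sum_congr rfl fun k _ => Finset.sum_congr rfl fun l _ => ?_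
  rw [dw_congr]
  filter_upwards [U.isOpen.mem_nhds hw] with w' hw'
  exact h w' hw' ζ

/-- The Taylor coefficients of a solution of the source equations are given by the iterates of the
operator `ζ_k (γ + ε η)^{lk} ∂/∂z̄^l`. -/
theorem LocalTensor.Source.coef_eq {c : LocalTensor U} {σ : Bool} {a : (FormalTube U)[ε]}
    (ha : c.Source σ a) {u : (Cn n → Cn n → ℂ) × (Cn n → Cn n → ℂ)}
    (h0 : ∀ (w : U) ζ, coef 0 w ζ a.fst = u.1 w ζ ∧ coef 0 w ζ a.snd = u.2 w ζ) (r : ℕ) (w : U)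
    (ζ : Cn n) :
    coef r w ζ a.fst = ((addEps (opF σ c.g) (opF σ c.h))^[r] u).1 w ζ ∧
      coef r w ζ a.snd = ((addEps (opF σ c.g) (opF σ c.h))^[r] u).2 w ζ := by
  induction r generalizing w ζ with
  | zero => exact h0 w ζ
  | succ r ih =>
    rw [Function.iterate_succ_apply']
    obtain ⟨h1, h2⟩ := ha.coef_succ r w ζ
    have e1 : ∀ w ∈ U, ∀ ζ, coefFun r a.fst ζ w =
        ((addEps (opF σ c.g) (opF σ c.h))^[r] u).1 w ζ := fun w hw ζ =>
      (coefFun_of_mem r _ ζ ⟨w, hw⟩).trans (ih _ _).1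
    have e2 : ∀ w ∈ U, ∀ ζ, coefFun r a.snd ζ w =
        ((addEps (opF σ c.g) (opF σ c.h))^[r] u).2 w ζ := fun w hw ζ =>
      (coefFun_of_mem r _ ζ ⟨w, hw⟩).trans (ih _ _).2
    rw [h1, h2, opF_congr e1 w.2, opF_congr e1 w.2, opF_congr e2 w.2]
    exact ⟨rfl, rfl⟩

theorem LocalTensor.Source.eq {c : LocalTensor U} {σ : Bool} {a b : (FormalTube U)[ε]}
    (ha : c.Source σ a) (hb : c.Source σ b)
    (h : ∀ (w : U), coef 0 w 0 a.fst = coef 0 w 0 b.fst ∧ coef 0 w 0 a.snd = coef 0 w 0 b.snd) :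
    a = b := by
  -- The coefficient of degree zero does not depend on the direction, so comparing at `ζ = 0` is
  -- enough.
  have hz : ∀ (w : U) ζ (q : FormalTube U), coef 0 w ζ q = coef 0 w 0 q := fun w ζ q => by
    obtain ⟨F, rfl⟩ := tubeMk_surjective q
    rw [coef_zero, coef_zero]
  have h1 := ha.coef_eq (u := (fun w ζ => coefFun 0 a.fst ζ w, fun w ζ => coefFun 0 a.snd ζ w))
    fun w ζ => ⟨(coefFun_of_mem _ _ _ _).symm, (coefFun_of_mem _ _ _ _).symm⟩
  have h2 := hb.coef_eq (u := (fun w ζ => coefFun 0 a.fst ζ w, fun w ζ => coefFun 0 a.snd ζ w))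
    fun w ζ => ⟨by rw [hz, ← (h w).1, ← hz w ζ]; exact (coefFun_of_mem _ _ _ _).symm,
      by rw [hz, ← (h w).2, ← hz w ζ]; exact (coefFun_of_mem _ _ _ _).symm⟩
  exact TrivSqZeroExt.ext (formalTube_ext fun r w ζ => by rw [(h1 r w ζ).1, (h2 r w ζ).1])
    (formalTube_ext fun r w ζ => by rw [(h1 r w ζ).2, (h2 r w ζ).2])

/-! #### Solutions from Taylor coefficients -/

/-- The Euler operator on formal functions. -/
def eulerF (σ : Bool) (a : (FormalTube U)[ε]) : (FormalTube U)[ε] :=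
  euler (fun k => epsD (dF (!σ) k)) (fun l => epsD (dF σ l)) (fun k => epsMk (fib σ k) 0)
    (fun k => epsMk (fib (!σ) k) 0) a

/-- The operator `ζ_k γ^{lk} ∂/∂z̄^l` on formal functions. -/
def LocalTensor.op (c : LocalTensor U) (σ : Bool) (a : (FormalTube U)[ε]) : (FormalTube U)[ε] :=
  fibreOp (fun l => epsD (dB σ l)) c.coeff (fun k => epsMk (fib σ k) 0) a

theorem fst_eulerF (σ : Bool) (a : (FormalTube U)[ε]) : (eulerF σ a).fst =
    ∑ k, (fib σ k * dF (!σ) k a.fst + fib (!σ) k * dF σ k a.fst) := by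
  simp [eulerF, euler, fst_dual_sum]

theorem snd_eulerF (σ : Bool) (a : (FormalTube U)[ε]) : (eulerF σ a).snd =
    ∑ k, (fib σ k * dF (!σ) k a.snd + fib (!σ) k * dF σ k a.snd) := by
  simp [eulerF, euler, snd_dual_sum]

theorem coef_zero_euler (σ : Bool) (w : U) (ζ : Cn n) (q : FormalTube U) :
    coef 0 w ζ (∑ k, (fib σ k * dF (!σ) k q + fib (!σ) k * dF σ k q)) = 0 := by
  simp only [map_sum, map_add, fib, coef_zero_fibreFun_mul, add_zero, Finset.sum_const_zero]

/-- The Euler field acts on the homogeneous part of degree `r + 1` as multiplication by `r + 1`. -/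
theorem coef_succ_euler (σ : Bool) (r : ℕ) (w : U) (ζ : Cn n) (q : FormalTube U) :
    coef (r + 1) w ζ (∑ k, (fib σ k * dF (!σ) k q + fib (!σ) k * dF σ k q)) =
      (r + 1) * coef (r + 1) w ζ q := by
  simp only [map_sum, map_add, fib, coef_fibreFun_mul]
  rw [coef_succ_fib σ r w ζ q, Finset.mul_sum]
  exact Finset.sum_congr rfl fun k _ => by ring

theorem coef_zero_op (c : LocalTensor U) (σ : Bool) (w : U) (ζ : Cn n) (a : (FormalTube U)[ε]) :
    coef 0 w ζ (c.op σ a).fst = 0 ∧ coef 0 w ζ (c.op σ a).snd = 0 := by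
  simp [LocalTensor.op, fibreOp, fst_dual_sum, snd_dual_sum, fib, coef_zero_fibreFun_mul]

/-- The factor `r + 1` comes from the normalization of `coef`, in which `r!` has not been divided
out. It matches the eigenvalue of the Euler field. -/
theorem coef_succ_op (c : LocalTensor U) (σ : Bool) (r : ℕ) (w : U) (ζ : Cn n)
    (a : (FormalTube U)[ε]) :
    coef (r + 1) w ζ (c.op σ a).fst =
      (r + 1) * ∑ k, ∑ l, fibL σ k ζ * c.g l k w * coef r w ζ (dB σ l a.fst) ∧
    coef (r + 1) w ζ (c.op σ a).snd =
      (r + 1) * (∑ k, ∑ l, fibL σ k ζ * c.g l k w * coef r w ζ (dB σ l a.snd) +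
        ∑ k, ∑ l, fibL σ k ζ * c.h l k w * coef r w ζ (dB σ l a.fst)) := by
  simp only [LocalTensor.op, fibreOp, fst_dual_sum, snd_dual_sum, fib, snd_dual_mul, fst_dual_mul,
    map_sum, coef_fibreFun_mul, fst_epsMk, snd_epsMk, zero_mul, add_zero, map_add,
    LocalTensor.coeff, coef_baseFun_mul, fst_epsD, snd_epsD]
  constructor
  · rw [Finset.mul_sum]
    refine Finset.sum_congr rfl fun k _ => ?_
    rw [Finset.mul_sum]
    exact congrArg _ (Finset.sum_congr rfl fun l _ => by ring)
  · rw [← Finset.sum_add_distrib, Finset.mul_sum]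
    refine Finset.sum_congr rfl fun k _ => ?_
    rw [Finset.mul_sum, ← Finset.sum_add_distrib]
    exact congrArg _ (Finset.sum_congr rfl fun l _ => by ring)

/-- Induction on the degree: the left side multiplies the coefficient of degree `r` by `r + 1`,
never zero, while the right side in degree `r` depends only on degree `r - 1` and has no part of
degree zero. -/
theorem eq_zero_of_euler_add {c : LocalTensor U} {σ : Bool} {a : (FormalTube U)[ε]}
    (h : eulerF σ a + a = c.op σ a) : a = 0 := by
  have h1 := fun r (w : U) ζ => congrArg (coef r w ζ) (congrArg TrivSqZeroExt.fst h)
  have h2 := fun r (w : U) ζ => congrArg (coef r w ζ) (congrArg TrivSqZeroExt.snd h)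
  simp only [TrivSqZeroExt.fst_add, TrivSqZeroExt.snd_add, map_add, fst_eulerF, snd_eulerF]
    at h1 h2
  have key : ∀ r (w : U) ζ, coef r w ζ a.fst = 0 ∧ coef r w ζ a.snd = 0 := by
    intro r
    induction r with
    | zero =>
      intro w ζ
      have h1 := h1 0 w ζ
      have h2 := h2 0 w ζ
      rw [coef_zero_euler, zero_add, (coef_zero_op c σ w ζ a).1] at h1
      rw [coef_zero_euler, zero_add, (coef_zero_op c σ w ζ a).2] at h2
      exact ⟨h1, h2⟩
    | succ r ih =>
      intro w ζ
      have h1 := h1 (r + 1) w ζ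
      have h2 := h2 (r + 1) w ζ
      have z1 := fun l => coef_dB_eq_zero (σ := σ) (fun w => (ih w ζ).1) l w
      have z2 := fun l => coef_dB_eq_zero (σ := σ) (fun w => (ih w ζ).2) l w
      rw [coef_succ_euler, (coef_succ_op c σ r w ζ a).1] at h1
      rw [coef_succ_euler, (coef_succ_op c σ r w ζ a).2] at h2
      simp only [z1, z2, mul_zero, Finset.sum_const_zero, add_zero] at h1 h2
      have hr : ((r : ℂ) + 1 + 1) ≠ 0 := by exact_mod_cast (Nat.succ_ne_zero (r + 1))
      exact ⟨(mul_eq_zero.1 ((by linear_combination h1 :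
          ((r : ℂ) + 1 + 1) * coef (r + 1) w ζ a.fst = 0))).resolve_left hr,
        (mul_eq_zero.1 ((by linear_combination h2 :
          ((r : ℂ) + 1 + 1) * coef (r + 1) w ζ a.snd = 0))).resolve_left hr⟩
  exact TrivSqZeroExt.ext (formalTube_ext fun r w ζ => by simp [(key r w ζ).1])
    (formalTube_ext fun r w ζ => by simp [(key r w ζ).2])

/-- The single contracted equation implies the whole overdetermined system: each defect solves the
homogeneous equation of `eq_zero_of_euler_add`. -/
theorem LocalTensor.Jacobi.source_of_euler {c : LocalTensor U} {σ : Bool} (hc : c.Jacobi σ)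
    {a : (FormalTube U)[ε]} (h : eulerF σ a = c.op σ a) : c.Source σ a := by
  have cm : ∀ s t u v, ∀ x : (FormalTube U)[ε], epsD (wirtD s u) (epsD (wirtD t v) x) =
      epsD (wirtD t v) (epsD (wirtD s u) x) := fun s t u v => epsD_comm (wirtD_comm s t u v)
  have d1 : ∀ (σ : Bool) (k j : Fin n), epsD (dF σ k) (epsMk (fib σ j) 0 : (FormalTube U)[ε]) = 0 :=
    fun σ k j => TrivSqZeroExt.ext (dF_fib σ k j) (map_zero _)
  have d2 : ∀ (σ : Bool) (k j : Fin n), epsD (dF (!σ) k) (epsMk (fib σ j) 0 : (FormalTube U)[ε]) =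
      if j = k then 1 else 0 := fun σ k j => by
    refine TrivSqZeroExt.ext ((dF_not_fib σ k j).trans ?_) ((map_zero _).trans ?_) <;>
      split_ifs <;> simp
  have d3 : ∀ (τ σ : Bool) (k j : Fin n),
      epsD (dB τ k) (epsMk (fib σ j) 0 : (FormalTube U)[ε]) = 0 :=
    fun τ σ k j => TrivSqZeroExt.ext (dB_fib τ σ k j) (map_zero _)
  refine ⟨fun l => ?_, fun k => sub_eq_zero.1 ?_⟩
  · refine eq_zero_of_euler_add (c := c) (σ := σ) ?_
    exact euler_dtb h l (fun _ _ => cm _ _ _ _) (fun _ _ => cm _ _ _ _) (fun _ _ => cm _ _ _ _)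
      (fun k i j => epsD_dF_coeff c _ k i j) (d1 σ)
      (fun k j => by simpa using d2 (!σ) k j)
  · refine eq_zero_of_euler_add (c := c) (σ := σ) ?_
    exact euler_defect h k (fun _ _ => cm _ _ _ _) (fun _ _ => cm _ _ _ _) (fun _ _ => cm _ _ _ _)
      (fun _ _ => cm _ _ _ _) (fun _ _ => cm _ _ _ _)
      (fun k i j => epsD_dF_coeff c _ k i j) (fun k i j => epsD_dF_coeff c _ k i j)
      (d2 σ) (d1 (!σ)) (d3 σ σ) (d3 σ (!σ)) hc.right

/-- A formal function whose Taylor coefficients are the iterates of the operator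
`ζ_k (γ + ε η)^{lk} ∂/∂z̄^l` solves the source equations. -/
theorem LocalTensor.Jacobi.source_of_coef {c : LocalTensor U} {σ : Bool} (hc : c.Jacobi σ)
    {a : (FormalTube U)[ε]} {u : (Cn n → Cn n → ℂ) × (Cn n → Cn n → ℂ)}
    (h : ∀ r (w : U) ζ, coef r w ζ a.fst = ((addEps (opF σ c.g) (opF σ c.h))^[r] u).1 w ζ ∧
      coef r w ζ a.snd = ((addEps (opF σ c.g) (opF σ c.h))^[r] u).2 w ζ) : c.Source σ a := by
  refine hc.source_of_euler (TrivSqZeroExt.ext ?_ ?_) <;> refine formalTube_ext fun r w ζ => ?_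
  all_goals
    have e1 : ∀ r, ∀ w ∈ U, ∀ ζ, ((addEps (opF σ c.g) (opF σ c.h))^[r] u).1 w ζ =
        coefFun r a.fst ζ w := fun r w hw ζ =>
      ((coefFun_of_mem r _ ζ ⟨w, hw⟩).trans (h r _ _).1).symm
    have e2 : ∀ r, ∀ w ∈ U, ∀ ζ, ((addEps (opF σ c.g) (opF σ c.h))^[r] u).2 w ζ =
        coefFun r a.snd ζ w := fun r w hw ζ =>
      ((coefFun_of_mem r _ ζ ⟨w, hw⟩).trans (h r _ _).2).symm
  · rw [fst_eulerF]
    cases r with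
    | zero => rw [coef_zero_euler, (coef_zero_op c σ w ζ a).1]
    | succ r =>
      rw [coef_succ_euler, (coef_succ_op c σ r w ζ a).1, (h _ w ζ).1, Function.iterate_succ_apply']
      -- Both sides carry the same factor `r + 1`, which leaves the recursion defining the iterates.
      refine congrArg _ ((opF_congr (e1 r) w.2 ζ).trans ?_)
      simp only [coef_dB]
      rfl
  · rw [snd_eulerF]
    cases r with
    | zero => rw [coef_zero_euler, (coef_zero_op c σ w ζ a).2]
    | succ r =>
      rw [coef_succ_euler, (coef_succ_op c σ r w ζ a).2, (h _ w ζ).2, Function.iterate_succ_apply']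
      refine congrArg _ ((congrArg₂ (· + ·) (opF_congr (e2 r) w.2 ζ)
        (opF_congr (e1 r) w.2 ζ)).trans ?_)
      simp only [coef_dB]
      rfl

end LocalSource

/-! ### Borel's lemma -/

section Borel

open Set Filter TopologicalSpace

variable {n : ℕ} {U : Opens (Cn n)}

/-- The dilation `(w, ζ) ↦ (w, s ζ)`. -/
def dilation (s : ℝ) : (Cn n × Cn n) →L[ℝ] (Cn n × Cn n) :=
  (ContinuousLinearMap.fst ℝ (Cn n) (Cn n)).prod (s • ContinuousLinearMap.snd ℝ (Cn n) (Cn n))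

theorem dilation_apply (s : ℝ) (p : Cn n × Cn n) : dilation s p = (p.1, s • p.2) := rfl

theorem norm_dilation_le {s : ℝ} (hs : 1 ≤ s) : ‖(dilation s : (Cn n × Cn n) →L[ℝ] _)‖ ≤ s := by
  refine ContinuousLinearMap.opNorm_le_bound _ (by linarith) fun p => ?_
  rw [dilation_apply, Prod.norm_def, max_le_iff]
  constructor
  · exact (norm_fst_le p).trans (le_mul_of_one_le_left (norm_nonneg _) hs)
  · rw [norm_smul, Real.norm_of_nonneg (by linarith)]
    exact mul_le_mul_of_nonneg_left (norm_snd_le p) (by linarith)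

/-- By dilation in the fibres the derivatives of order less than `r` of `s⁻ʳ q(w, s ζ)` become
small. -/
theorem exists_dilation {q : Cn n × Cn n → ℂ} (hq : ContDiff ℝ ∞ q) (hc : HasCompactSupport q)
    (r : ℕ) : ∃ s : ℝ, 1 ≤ s ∧ ∃ B : ℕ → ℝ, (∀ k < r, B k ≤ (1 / 2) ^ r) ∧
      ∀ k x, ‖iteratedFDeriv ℝ k (fun p => (s ^ r)⁻¹ • q (dilation s p)) x‖ ≤ B k := by
  have hb : ∀ k : ℕ, ∃ C, ∀ x, ‖iteratedFDeriv ℝ k q x‖ ≤ C := fun k =>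
    (hc.iteratedFDeriv k).exists_bound_of_continuous
      (hq.continuous_iteratedFDeriv (by exact_mod_cast le_top))
  choose C hC using hb
  have hC0 : ∀ k, 0 ≤ C k := fun k => (norm_nonneg _).trans (hC k 0)
  -- The dilation multiplies the bound of order `k` by `s^k`, so after division by `s^r` an order `k
  -- < r` keeps at most `C k / s ≤ 2^{-r}`.
  set s : ℝ := 1 + 2 ^ r * ∑ k ∈ Finset.range r, C k with hs
  have hsum : 0 ≤ ∑ k ∈ Finset.range r, C k := Finset.sum_nonneg fun k _ => hC0 k
  have hs1 : 1 ≤ s := by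
    rw [hs]
    have : 0 ≤ (2 : ℝ) ^ r * ∑ k ∈ Finset.range r, C k := by positivity
    linarith
  have hs0 : 0 < s := by linarith
  refine ⟨s, hs1, fun k => (s ^ r)⁻¹ * (C k * s ^ k), fun k hk => ?_, fun k x => ?_⟩
  · have h1 : C k ≤ ∑ k ∈ Finset.range r, C k :=
      Finset.single_le_sum (fun i _ => hC0 i) (Finset.mem_range.2 hk)
    have h2 : C k * 2 ^ r ≤ s := by
      rw [hs]
      nlinarith [pow_pos (two_pos (α := ℝ)) r]
    have h3 : s ^ (k + 1) ≤ s ^ r := pow_le_pow_right₀ hs1 hk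
    rw [inv_mul_le_iff₀ (by positivity), div_pow, one_pow, mul_one_div, le_div_iff₀ (by positivity)]
    calc C k * s ^ k * 2 ^ r = (C k * 2 ^ r) * s ^ k := by ring
      _ ≤ s * s ^ k := mul_le_mul_of_nonneg_right h2 (by positivity)
      _ = s ^ (k + 1) := by ring
      _ ≤ s ^ r := h3
  · have hcd : ContDiff ℝ ∞ (q ∘ dilation s) := hq.comp (dilation s).contDiff
    have hk : (k : WithTop ℕ∞) ≤ ∞ := by exact_mod_cast le_top
    have e1 : iteratedFDeriv ℝ k (fun p => (s ^ r)⁻¹ • q (dilation s p)) x =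
        (s ^ r)⁻¹ • iteratedFDeriv ℝ k (q ∘ dilation s) x :=
      iteratedFDeriv_const_smul_apply (a := (s ^ r)⁻¹) (x := x) ((hcd.of_le hk).contDiffAt)
    rw [e1, norm_smul, Real.norm_of_nonneg (by positivity),
      (dilation s).iteratedFDeriv_comp_right hq x hk]
    refine mul_le_mul_of_nonneg_left ?_ (by positivity)
    refine (ContinuousMultilinearMap.norm_compContinuousLinearMap_le _ _).trans ?_
    rw [Finset.prod_const, Finset.card_univ, Fintype.card_fin]
    exact mul_le_mul (hC k _) (pow_le_pow_left₀ (norm_nonneg _) (norm_dilation_le hs1) k)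
      (by positivity) (hC0 k)

theorem iteratedDeriv_pow_smul_zero (r i : ℕ) (c : ℂ) :
    iteratedDeriv r (fun t : ℝ => t ^ i • c) 0 = if i = r then (r.factorial : ℂ) * c else 0 := by
  rw [iteratedDeriv_smul_const (f := fun t : ℝ => t ^ i) (by fun_prop) c,
    iteratedDeriv_fun_pow_zero]
  split_ifs with h1 h2 h2
  · subst h1; simp
  · exact absurd h1.symm h2
  · exact absurd h2.symm h1
  · simp

/-- Borel's lemma: a sequence of homogeneous functions of the fibre variables is locally over the
base the sequence of Taylor coefficients of a smooth function. -/
theorem exists_contDiff_fibreTaylor_eq {p : ℕ → Cn n × Cn n → ℂ}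
    (hp : ∀ r, ContDiffOn ℝ ∞ (p r) (tube U))
    (hom : ∀ r, ∀ w ∈ U, ∀ (ζ : Cn n) (s : ℝ), p r (w, s • ζ) = s ^ r • p r (w, ζ))
    {w₀ : Cn n} (hw₀ : w₀ ∈ U) :
    ∃ F : Cn n × Cn n → ℂ, ContDiff ℝ ∞ F ∧ ∃ U' : Opens (Cn n), w₀ ∈ U' ∧ U' ≤ U ∧
      ∀ r, ∀ w ∈ U', ∀ ζ, fibreTaylor r F w ζ = p r (w, ζ) := by
  obtain ⟨χ, hχ, hχc, hχU, hχ1⟩ := exists_cutoff U hw₀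
  obtain ⟨θ, hθ, hθc, -, hθ1⟩ := exists_cutoff (⊤ : Opens (Cn n)) (w := 0) trivial
  -- Cutoffs in the base and in the fibre give compact support; `1 / r!` compensates the factorial
  -- produced by `fibreTaylor r`.
  set q : ℕ → Cn n × Cn n → ℂ := fun r x =>
    (χ x.1 : ℂ) * ((θ x.2 : ℂ) * ((r.factorial : ℂ)⁻¹ * p r x)) with hqdef
  have hθ' : ContDiff ℝ ∞ (fun x : Cn n × Cn n => (θ x.2 : ℂ)) :=
    Complex.ofRealCLM.contDiff.comp (hθ.comp contDiff_snd)
  have hq : ∀ r, ContDiff ℝ ∞ (q r) := fun r => contDiff_cutoff_mul hχ hχU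
    (hθ'.contDiffOn.mul (contDiffOn_const.mul (hp r)))
  have hqc : ∀ r, HasCompactSupport (q r) := fun r => by
    refine HasCompactSupport.intro (hχc.isCompact.prod hθc.isCompact) fun x hx => ?_
    simp only [hqdef]
    by_cases h1 : x.1 ∈ tsupport χ
    · have h2 : x.2 ∉ tsupport θ := fun h => hx ⟨h1, h⟩
      simp [image_eq_zero_of_notMem_tsupport h2]
    · simp [image_eq_zero_of_notMem_tsupport h1]
  choose s hs1 B hBr hB using fun r => exists_dilation (hq r) (hqc r) r
  set f : ℕ → Cn n × Cn n → ℂ := fun r x => ((s r) ^ r)⁻¹ • q r (dilation (s r) x) with hfdef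
  have hf : ∀ r, ContDiff ℝ ∞ (f r) := fun r =>
    ((hq r).comp (dilation (s r)).contDiff).const_smul (((s r) ^ r)⁻¹)
  have hB0 : ∀ r k, 0 ≤ B r k := fun r k => (norm_nonneg _).trans (hB r k 0)
  -- For a fixed order `k` the geometric bound holds only for the terms with index above `k`; the
  -- finitely many earlier ones do not affect summability.
  have hv : ∀ k : ℕ, (k : ℕ∞) ≤ ⊤ → Summable (fun i => B i k) := fun k _ => by
    refine (summable_nat_add_iff (k + 1)).1 ?_
    refine Summable.of_nonneg_of_le (fun i => hB0 _ _) (fun i => hBr (i + (k + 1)) k (by omega)) ?_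
    exact (summable_nat_add_iff (k + 1)).2 summable_geometric_two
  have hb : ∀ (k i : ℕ) (x : Cn n × Cn n), (k : ℕ∞) ≤ ⊤ → ‖iteratedFDeriv ℝ k (f i) x‖ ≤ B i k :=
    fun k i x _ => hB i k x
  have hF : ContDiff ℝ ∞ (fun x => ∑' i, f i x) := contDiff_tsum (N := ⊤) hf hv hb
  obtain ⟨V, hV1, hVo, hVw⟩ := eventually_nhds_iff.1 hχ1
  refine ⟨_, hF, ⟨V, hVo⟩ ⊓ U, ⟨hVw, hw₀⟩, inf_le_right, fun r w hw ζ => ?_⟩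
  rw [fibreTaylor_eq_iteratedFDeriv hF, iteratedFDeriv_tsum_apply (N := ⊤) hf hv hb le_top]
  have hsum : Summable fun i => iteratedFDeriv ℝ r (f i) ((w, 0) : Cn n × Cn n) :=
    Summable.of_norm_bounded (hv r le_top) fun i => hB i r _
  have happ := (ContinuousMultilinearMap.apply ℝ (fun _ : Fin r => Cn n × Cn n) ℂ
    (fun _ => (0, ζ))).map_tsum hsum
  rw [ContinuousMultilinearMap.apply_apply] at happ
  rw [happ]
  have hterm : ∀ i, (ContinuousMultilinearMap.apply ℝ (fun _ : Fin r => Cn n × Cn n) ℂ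
      (fun _ => (0, ζ))) (iteratedFDeriv ℝ r (f i) ((w, 0) : Cn n × Cn n)) =
      if i = r then p r (w, ζ) else 0 := fun i => by
    rw [ContinuousMultilinearMap.apply_apply, ← fibreTaylor_eq_iteratedFDeriv (hf i), fibreTaylor]
    -- Near `t = 0` both cutoffs equal one, and homogeneity of degree `i` cancels the dilation
    -- against the prefactor, so each term contributes to exactly one Taylor coefficient.
    have hev : (fun t : ℝ => f i (w, t • ζ)) =ᶠ[𝓝 0]
        fun t : ℝ => t ^ i • ((i.factorial : ℂ)⁻¹ * p i (w, ζ)) := by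
      have hθt : ∀ᶠ t : ℝ in 𝓝 0, θ (s i • t • ζ) = 1 := by
        have hcont : Tendsto (fun t : ℝ => s i • t • ζ) (𝓝 0) (𝓝 0) := by
          have : Continuous fun t : ℝ => s i • t • ζ := by fun_prop
          simpa using this.tendsto 0
        exact hcont.eventually hθ1
      filter_upwards [hθt] with t ht
      have hsi : (s i) ^ i ≠ 0 := pow_ne_zero _ (by linarith [hs1 i])
      simp only [hfdef, hqdef, dilation_apply]
      rw [hV1 w hw.1, ht, smul_smul (s i) t ζ, hom i w hw.2 ζ, mul_pow, mul_smul]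
      simp only [Complex.real_smul, Complex.ofReal_one, one_mul, Complex.ofReal_inv]
      have hsc : (((s i) ^ i : ℝ) : ℂ) ≠ 0 := by exact_mod_cast hsi
      field_simp
    rw [hev.iteratedDeriv_eq, iteratedDeriv_pow_smul_zero]
    split_ifs with h
    · subst h
      rw [mul_inv_cancel_left₀ (by exact_mod_cast Nat.factorial_ne_zero i)]
    · rfl
  simp only [hterm, tsum_ite_eq]

end Borel

/-! ### Local realization of the exponential series by smooth functions. -/

section LocalExistence

open Set Filter TopologicalSpace

variable {n : ℕ} {U : Opens (Cn n)}

/-- Joint smoothness in `(z, ζ)`, as Borel's lemma requires: the derivative with `ζ` frozen is a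
partial derivative of the joint function. -/
theorem contDiffOn_opF {σ : Bool} {γ : Fin n → Fin n → Cn n → ℂ}
    (hγ : ∀ l k, ContDiffOn ℝ ∞ (γ l k) U) {u : Cn n → Cn n → ℂ}
    (hu : ContDiffOn ℝ ∞ (fun p : Cn n × Cn n => u p.1 p.2) (tube U)) :
    ContDiffOn ℝ ∞ (fun p : Cn n × Cn n => opF σ γ u p.1 p.2) (tube U) := by
  have hd : ∀ (v : Cn n), ContDiffOn ℝ ∞
      (fun p : Cn n × Cn n => fderiv ℝ (fun w => u w p.2) p.1 v) (tube U) := fun v => by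
    refine (contDiffOn_fderiv_apply hu (v, 0)).congr fun p hp => ?_
    have h1 : HasFDerivAt (fun p : Cn n × Cn n => u p.1 p.2)
        (fderiv ℝ (fun p : Cn n × Cn n => u p.1 p.2) p) (p.1, p.2) :=
      (differentiableAt_of_tube hu (mem_tube.1 hp) p.2).hasFDerivAt
    have h2 : HasFDerivAt (fun w => u w p.2) ((fderiv ℝ (fun p : Cn n × Cn n => u p.1 p.2) p).comp
        (ContinuousLinearMap.inl ℝ (Cn n) (Cn n))) p.1 :=
      HasFDerivAt.comp (g := fun p : Cn n × Cn n => u p.1 p.2) (f := fun w => (w, p.2)) p.1 h1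
        (hasFDerivAt_prodMk_left p.1 p.2)
    rw [h2.fderiv]
    simp
  refine ContDiffOn.sum fun k _ => ContDiffOn.sum fun l _ => ?_
  refine ContDiffOn.mul (ContDiffOn.mul ?_ ?_) ?_
  · exact ((fibL σ k).contDiff.comp contDiff_snd).contDiffOn
  · exact (hγ l k).comp contDiffOn_fst fun p hp => mem_tube.1 hp
  · exact ((hd _).add (contDiffOn_const.mul (hd _))).div_const 2

theorem fderiv_const_smul_real {u : Cn n → ℂ} {w v : Cn n} (c : ℝ) :
    fderiv ℝ (fun w => c • u w) w v = c • fderiv ℝ u w v := by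
  have : fderiv ℝ (fun w => c • u w) w = c • fderiv ℝ u w := congrFun (fderiv_const_smul_field c) w
  rw [this]
  rfl

/-- The operator raises the fibre degree by one, so its `r`-th iterate on a function of the base is
homogeneous of degree `r`, the other hypothesis of Borel's lemma. -/
theorem opF_homogeneous {σ : Bool} {γ : Fin n → Fin n → Cn n → ℂ} {u : Cn n → Cn n → ℂ} {r : ℕ}
    (hu : ∀ w ∈ U, ∀ (ζ : Cn n) (s : ℝ), u w (s • ζ) = s ^ r • u w ζ) {w : Cn n} (hw : w ∈ U)
    (ζ : Cn n) (s : ℝ) : opF σ γ u w (s • ζ) = s ^ (r + 1) • opF σ γ u w ζ := by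
  rw [opF, opF, Finset.smul_sum]
  refine Finset.sum_congr rfl fun k _ => ?_
  rw [Finset.smul_sum]
  refine Finset.sum_congr rfl fun l _ => ?_
  have h1 : dw σ l (fun v => u v (s • ζ)) w = s ^ r • dw σ l (fun v => u v ζ) w := by
    rw [dw_congr (v := fun v => s ^ r • u v ζ)]
    · simp only [dw, fderiv_const_smul_real]
      simp only [Complex.real_smul]
      ring
    · filter_upwards [U.isOpen.mem_nhds hw] with w' hw'
      exact hu w' hw' ζ s
  rw [h1, map_smul]
  simp only [Complex.real_smul]
  push_cast
  ring

/-- Local existence of solutions of the source equations with a given restriction to the zero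
section. -/
theorem LocalTensor.exists_source {c : LocalTensor U} {σ : Bool} {f₀ f₁ : Cn n → ℂ}
    (hf₀ : ContDiffOn ℝ ∞ f₀ U) (hf₁ : ContDiffOn ℝ ∞ f₁ U) {w₀ : Cn n} (hw₀ : w₀ ∈ U) :
    ∃ F₀ F₁ : Cn n × Cn n → ℂ, ContDiff ℝ ∞ F₀ ∧ ContDiff ℝ ∞ F₁ ∧
      ∃ U' : Opens (Cn n), w₀ ∈ U' ∧ U' ≤ U ∧ ∀ r, ∀ w ∈ U', ∀ ζ,
        fibreTaylor r F₀ w ζ =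
          ((addEps (opF σ c.g) (opF σ c.h))^[r] (fun w _ => f₀ w, fun w _ => f₁ w)).1 w ζ ∧
        fibreTaylor r F₁ w ζ =
          ((addEps (opF σ c.g) (opF σ c.h))^[r] (fun w _ => f₀ w, fun w _ => f₁ w)).2 w ζ := by
  set u := fun r : ℕ =>
    (addEps (opF σ c.g) (opF σ c.h))^[r] (fun w _ => f₀ w, fun w _ => f₁ w) with hu
  have husucc : ∀ r, u (r + 1) = (opF σ c.g (u r).1, opF σ c.g (u r).2 + opF σ c.h (u r).1) :=
    fun r => Function.iterate_succ_apply' _ _ _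
  have hsm : ∀ r, ContDiffOn ℝ ∞ (fun p : Cn n × Cn n => (u r).1 p.1 p.2) (tube U) ∧
      ContDiffOn ℝ ∞ (fun p : Cn n × Cn n => (u r).2 p.1 p.2) (tube U) := by
    intro r
    induction r with
    | zero =>
      exact ⟨hf₀.comp contDiffOn_fst fun p hp => mem_tube.1 hp,
        hf₁.comp contDiffOn_fst fun p hp => mem_tube.1 hp⟩
    | succ r ih =>
      rw [husucc]
      exact ⟨contDiffOn_opF c.smooth_g ih.1,
        (contDiffOn_opF c.smooth_g ih.2).add (contDiffOn_opF c.smooth_h ih.1)⟩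
  have hhom : ∀ r, ∀ w ∈ U, ∀ (ζ : Cn n) (s : ℝ), (u r).1 w (s • ζ) = s ^ r • (u r).1 w ζ ∧
      (u r).2 w (s • ζ) = s ^ r • (u r).2 w ζ := by
    intro r
    induction r with
    | zero => intro w _ ζ s; simp [hu]
    | succ r ih =>
      intro w hw ζ s
      rw [husucc]
      have h1 := fun w hw ζ s => (ih w hw ζ s).1
      have h2 := fun w hw ζ s => (ih w hw ζ s).2
      refine ⟨opF_homogeneous h1 hw ζ s, ?_⟩
      simp only [Pi.add_apply]
      rw [opF_homogeneous h1 hw ζ s, opF_homogeneous h2 hw ζ s, smul_add]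
  obtain ⟨F₀, hF₀, U₀, h0, h0U, hT₀⟩ := exists_contDiff_fibreTaylor_eq (fun r => (hsm r).1)
    (fun r w hw ζ s => (hhom r w hw ζ s).1) hw₀
  obtain ⟨F₁, hF₁, U₁, h1, h1U, hT₁⟩ := exists_contDiff_fibreTaylor_eq (fun r => (hsm r).2)
    (fun r w hw ζ s => (hhom r w hw ζ s).2) hw₀
  exact ⟨F₀, F₁, hF₀, hF₁, U₀ ⊓ U₁, ⟨h0, h1⟩, inf_le_left.trans h0U, fun r w hw ζ =>
    ⟨hT₀ r w hw.1 ζ, hT₁ r w hw.2 ζ⟩⟩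

end LocalExistence

/-! ### Chart independence of flatness and of the source equations -/

section SourceAt

open Set Filter TopologicalSpace

variable {n : ℕ}

/-- The function `ηˡᵏ ∂F/∂z̄^l` (`true`) or its conjugate (`false`). -/
def contr (σ : Bool) (η : Fin n → Fin n → Cn n → ℂ) (k : Fin n) (F : Cn n × Cn n → ℂ)
    (p : Cn n × Cn n) : ℂ :=
  ∑ l, η l k p.1 * wirt (sg σ) (baseVec l) F p

/-- The source equations (`true`) or target equations (`false`) for `F₀ + ε F₁` hold up to functions
that are flat at the point `(w, 0)` of the zero section. -/
structure SourceAt (σ : Bool) (γ η : Fin n → Fin n → Cn n → ℂ) (F₀ F₁ : Cn n × Cn n → ℂ)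
    (w : Cn n) : Prop where
  anti₀ : ∀ l, FlatAt (wirt (sg σ) (fibreVec l) F₀) w
  anti₁ : ∀ l, FlatAt (wirt (sg σ) (fibreVec l) F₁) w
  eq₀ : ∀ k, FlatAt (fun p => wirt (sg (!σ)) (fibreVec k) F₀ p - contr σ γ k F₀ p) w
  eq₁ : ∀ k, FlatAt (fun p => wirt (sg (!σ)) (fibreVec k) F₁ p -
    (contr σ γ k F₁ p + contr σ η k F₀ p)) w

theorem tubeMk_sum_baseFun_mul {U : Opens (Cn n)} (η : Fin n → Cn n → ℂ)
    (hη : ∀ l, ContDiffOn ℝ ∞ (η l) U) (s : ℂ) (F : SmoothTube U) :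
    ∃ h, ∑ l, baseFun (η l) (hη l) * wirtD s (baseVec l) (tubeMk U F) =
      tubeMk U ⟨fun p => ∑ l, η l p.1 * wirt s (baseVec l) F.1 p, h⟩ := by
  set H : Fin n → SmoothTube U := fun l =>
    ⟨fun p => η l p.1, (hη l).comp contDiffOn_fst fun _ hp => mem_tube.1 hp⟩ *
      wirtSmooth s (baseVec l) F with hH
  have e : (∑ l, H l).1 = fun p => ∑ l, η l p.1 * wirt s (baseVec l) F.1 p := by
    funext p
    rw [AddSubmonoidClass.coe_finsetSum, Finset.sum_apply]
    rfl
  have hs : (∑ l, H l).1 ∈ SmoothTube U := (∑ l, H l).2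
  rw [e] at hs
  refine ⟨hs, ?_⟩
  simp only [wirtD_tubeMk]
  calc _ = ∑ l, tubeMk U (H l) := Finset.sum_congr rfl fun l _ => rfl
    _ = tubeMk U (∑ l, H l) := (map_sum _ _ _).symm
    _ = _ := congrArg _ (Subtype.ext e)

/-- Translates equations in the quotient algebra into flatness at each point of the zero section, a
form that can be transported to another chart. -/
theorem LocalTensor.source_iff {U : Opens (Cn n)} (c : LocalTensor U) (σ : Bool)
    (F₀ F₁ : SmoothTube U) : c.Source σ (epsMk (tubeMk U F₀) (tubeMk U F₁)) ↔
      ∀ w ∈ U, SourceAt σ c.g c.h F₀.1 F₁.1 w := by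
  have hanti : ∀ (F : SmoothTube U) l, dF σ l (tubeMk U F) = 0 ↔
      ∀ w ∈ U, FlatAt (wirt (sg σ) (fibreVec l) F.1) w := fun F l => by
    rw [wirtD_tubeMk, tubeMk_eq_zero]
    rfl
  have h0 : ∀ k, dF (!σ) k (tubeMk U F₀) =
      ∑ l, baseFun (c.g l k) (c.smooth_g l k) * dB σ l (tubeMk U F₀) ↔ ∀ w ∈ U,
        FlatAt (fun p => wirt (sg (!σ)) (fibreVec k) F₀.1 p - contr σ c.g k F₀.1 p) w := fun k => by
    obtain ⟨h, e⟩ := tubeMk_sum_baseFun_mul (fun l => c.g l k) (fun l => c.smooth_g l k) (sg σ) F₀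
    rw [e, wirtD_tubeMk, tubeMk_eq]
    rfl
  have h1 : ∀ k, dF (!σ) k (tubeMk U F₁) =
      ∑ l, baseFun (c.g l k) (c.smooth_g l k) * dB σ l (tubeMk U F₁) +
        ∑ l, baseFun (c.h l k) (c.smooth_h l k) * dB σ l (tubeMk U F₀) ↔ ∀ w ∈ U,
        FlatAt (fun p => wirt (sg (!σ)) (fibreVec k) F₁.1 p -
          (contr σ c.g k F₁.1 p + contr σ c.h k F₀.1 p)) w := fun k => by
    obtain ⟨h, e⟩ := tubeMk_sum_baseFun_mul (fun l => c.g l k) (fun l => c.smooth_g l k) (sg σ) F₁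
    obtain ⟨h', e'⟩ := tubeMk_sum_baseFun_mul (fun l => c.h l k) (fun l => c.smooth_h l k) (sg σ) F₀
    rw [e, e', wirtD_tubeMk, ← map_add, tubeMk_eq]
    rfl
  have hS : c.Source σ (epsMk (tubeMk U F₀) (tubeMk U F₁)) ↔
      (∀ l, dF σ l (tubeMk U F₀) = 0 ∧ dF σ l (tubeMk U F₁) = 0) ∧
      ∀ k, dF (!σ) k (tubeMk U F₀) =
        ∑ l, baseFun (c.g l k) (c.smooth_g l k) * dB σ l (tubeMk U F₀) ∧
        dF (!σ) k (tubeMk U F₁) =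
        ∑ l, baseFun (c.g l k) (c.smooth_g l k) * dB σ l (tubeMk U F₁) +
        ∑ l, baseFun (c.h l k) (c.smooth_h l k) * dB σ l (tubeMk U F₀) := by
    refine and_congr (forall_congr' fun l => ?_) (forall_congr' fun k => ?_)
    · rw [TrivSqZeroExt.ext_iff]
      rfl
    · rw [TrivSqZeroExt.ext_iff, fst_dual_sum, snd_dual_sum, ← Finset.sum_add_distrib]
      simp only [fst_dual_mul, snd_dual_mul]
      rfl
  rw [hS]
  simp only [hanti, h0, h1]
  constructor
  · intro h w hw
    exact ⟨fun l => (h.1 l).1 w hw, fun l => (h.1 l).2 w hw, fun k => (h.2 k).1 w hw,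
      fun k => (h.2 k).2 w hw⟩
  · intro h
    exact ⟨fun l => ⟨fun w hw => (h w hw).anti₀ l, fun w hw => (h w hw).anti₁ l⟩,
      fun k => ⟨fun w hw => (h w hw).eq₀ k, fun w hw => (h w hw).eq₁ k⟩⟩

/-- Complex conjugation (`true`) or the identity (`false`). -/
def cj (σ : Bool) : ℂ →+* ℂ := cond σ (starRingEnd ℂ) (RingHom.id ℂ)

theorem continuous_cj (σ : Bool) : Continuous (cj σ) := by
  cases σ
  · exact continuous_id
  · exact Complex.continuous_conj

theorem wirt_sg (σ : Bool) (u : Cn n × Cn n) (F : Cn n × Cn n → ℂ) (p : Cn n × Cn n) :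
    wirt (sg σ) u F p = ∑ k, (cj σ (u.1 k) * wirt (sg σ) (baseVec k) F p +
      cj σ (u.2 k) * wirt (sg σ) (fibreVec k) F p) := by
  cases σ
  · exact wirt_neg_I u F p
  · exact wirt_I u F p

variable {M : Type*} [TopologicalSpace M] [ChartedSpace (Cn n) M] [IsManifold 𝓘(ℂ, Cn n) ω M]
  {φ ψ : OpenPartialHomeomorph M (Cn n)}

/-- The components of the tensor `g` (`true`) or its transpose (`false`) in the chart `φ`. -/
def Tensor11.comp (g : Tensor11 n M) (σ : Bool) (φ : OpenPartialHomeomorph M (Cn n))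
    (l k : Fin n) : Cn n → ℂ :=
  cond σ (g.coeff φ l k) (g.coeff φ k l)

theorem Tensor11.comp_transform (g : Tensor11 n M) (σ : Bool) (hφ : φ ∈ holCharts n M)
    (hψ : ψ ∈ holCharts n M) {w : Cn n} (hw : w ∈ (φ.symm ≫ₕ ψ).source) (l k : Fin n) :
    g.comp σ ψ l k (ψ (φ.symm w)) = ∑ q, ∑ p,
      cj σ (fderiv ℂ (ψ ∘ φ.symm) w (Pi.single q 1) l) *
        cj (!σ) (fderiv ℂ (ψ ∘ φ.symm) w (Pi.single p 1) k) * g.comp σ φ q p w := by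
  cases σ
  · refine (g.transform φ hφ ψ hψ w hw k l).trans ?_
    rw [Finset.sum_comm]
    exact Finset.sum_congr rfl fun q _ => Finset.sum_congr rfl fun p _ =>
      congrArg (· * _) (mul_comm _ _)
  · exact g.transform φ hφ ψ hψ w hw l k

theorem coordChange_zero (w : Cn n) : coordChange φ ψ (w, 0) = (ψ (φ.symm w), 0) := by
  ext
  · rfl
  · simp [coordChange]

/-- A smooth function is locally Lipschitz; compare its value at `(w', ζ)` with the zero value at
`(w', 0)`. -/
theorem isBigO_snd_of_contDiffAt {Y : Type*} [NormedAddCommGroup Y] [NormedSpace ℝ Y]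
    {f : Cn n × Cn n → Y} {w : Cn n} (hf : ContDiffAt ℝ ∞ f (w, 0))
    (h0 : ∀ᶠ w' in 𝓝 w, f (w', 0) = 0) :
    f =O[𝓝 ((w, 0) : Cn n × Cn n)] fun p => p.2 := by
  obtain ⟨K, t, ht, hK⟩ := (hf.of_le (by simp : (1 : WithTop ℕ∞) ≤ ∞)).exists_lipschitzOnWith
  have hc : Tendsto (fun p : Cn n × Cn n => ((p.1, 0) : Cn n × Cn n)) (𝓝 (w, 0)) (𝓝 (w, 0)) :=
    Continuous.tendsto (by fun_prop) _
  have hc1 : Tendsto (fun p : Cn n × Cn n => p.1) (𝓝 (w, 0)) (𝓝 w) := continuous_fst.tendsto _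
  refine Asymptotics.IsBigO.of_bound K ?_
  filter_upwards [ht, hc ht, hc1.eventually h0] with p hp hp0 hp1
  have h := hK.dist_le_mul p hp (p.1, 0) hp0
  rw [dist_eq_norm, dist_eq_norm, hp1, sub_zero] at h
  have h1 : p - (p.1, 0) = (0, p.2) := by ext <;> simp
  rw [h1] at h
  exact h.trans (by simp)

theorem coordChange_snd_isBigO (hφ : φ ∈ holCharts n M) (hψ : ψ ∈ holCharts n M) {w : Cn n}
    (hw : w ∈ (φ.symm ≫ₕ ψ).source) :
    (fun p => (coordChange φ ψ p).2) =O[𝓝 ((w, 0) : Cn n × Cn n)] fun p => p.2 :=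
  isBigO_snd_of_contDiffAt (contDiff_snd.contDiffAt.comp _
    (contDiffAt_coordChange hφ hψ (p := (w, 0)) hw))
    (Eventually.of_forall fun w' => by rw [coordChange_zero])

theorem FlatAt.comp_coordChange (hφ : φ ∈ holCharts n M) (hψ : ψ ∈ holCharts n M) {w : Cn n}
    (hw : w ∈ (φ.symm ≫ₕ ψ).source) {F : Cn n × Cn n → ℂ} (hF : FlatAt F (ψ (φ.symm w))) :
    FlatAt (fun p => F (coordChange φ ψ p)) w :=
  hF.comp (contDiffAt_coordChange hφ hψ (p := (w, 0)) hw).continuousAt (coordChange_zero w)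
    (coordChange_snd_isBigO hφ hψ hw)

theorem continuousAt_coordChangeDeriv (hφ : φ ∈ holCharts n M) (hψ : ψ ∈ holCharts n M) {w : Cn n}
    (hw : w ∈ (φ.symm ≫ₕ ψ).source) (v : Cn n × Cn n) :
    ContinuousAt (fun p => coordChangeDeriv φ ψ p v) (w, 0) := by
  have h1 : ContinuousAt (fun p => fderiv ℝ (coordChange φ ψ) p v) (w, 0) :=
    (((contDiffAt_coordChange hφ hψ (p := (w, 0)) hw).fderiv_right (m := 0)
      (by simp)).continuousAt).clm_apply continuousAt_const
  refine h1.congr ?_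
  have ho : IsOpen (Prod.fst ⁻¹' (φ.symm ≫ₕ ψ).source : Set (Cn n × Cn n)) :=
    (φ.symm ≫ₕ ψ).open_source.preimage continuous_fst
  filter_upwards [ho.mem_nhds (show ((w, 0) : Cn n × Cn n) ∈ _ from hw)] with p hp
  rw [((hasFDerivAt_coordChange hφ hψ hp).restrictScalars ℝ).fderiv]
  rfl

/-- The tensor law absorbs the Jacobian of the base change. What remains comes from the dependence
of the fibre coordinates on the base point, and involves only those fibre derivatives that the
source equations require to be flat. -/
theorem contr_coordChange (σ : Bool) (η : Tensor11 n M) (hφ : φ ∈ holCharts n M)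
    (hψ : ψ ∈ holCharts n M) {p : Cn n × Cn n} (hp : p.1 ∈ (φ.symm ≫ₕ ψ).source)
    {F : Cn n × Cn n → ℂ} (hF : DifferentiableAt ℝ F (coordChange φ ψ p)) (k : Fin n) :
    contr σ (η.comp σ φ) k (fun q => F (coordChange φ ψ q)) p =
      ∑ j, cj (!σ) ((coordChangeDeriv φ ψ p (fibreVec k)).2 j) *
        contr σ (η.comp σ ψ) j F (coordChange φ ψ p) +
      ∑ l, ∑ m, η.comp σ φ l k p.1 * cj σ ((coordChangeDeriv φ ψ p (baseVec l)).2 m) *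
        wirt (sg σ) (fibreVec m) F (coordChange φ ψ p) := by
  have e1 : contr σ (η.comp σ φ) k (fun q => F (coordChange φ ψ q)) p =
      ∑ l, ∑ m, η.comp σ φ l k p.1 * cj σ (fderiv ℂ (ψ ∘ φ.symm) p.1 (Pi.single l 1) m) *
        wirt (sg σ) (baseVec m) F (coordChange φ ψ p) +
      ∑ l, ∑ m, η.comp σ φ l k p.1 * cj σ ((coordChangeDeriv φ ψ p (baseVec l)).2 m) *
        wirt (sg σ) (fibreVec m) F (coordChange φ ψ p) := by
    rw [contr, ← Finset.sum_add_distrib]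
    refine Finset.sum_congr rfl fun l _ => ?_
    rw [wirt_comp (hasFDerivAt_coordChange hφ hψ hp) hF, wirt_sg, Finset.mul_sum,
      ← Finset.sum_add_distrib]
    refine Finset.sum_congr rfl fun m _ => ?_
    rw [mul_add, ← mul_assoc, ← mul_assoc]
    rfl
  rw [e1]
  congr 1
  -- The fibre coordinates transform by the inverse Jacobian.
  have hinv : ∀ q : Fin n, ∑ j, cj (!σ) ((coordChangeDeriv φ ψ p (fibreVec k)).2 j) *
      cj (!σ) (fderiv ℂ (ψ ∘ φ.symm) p.1 (Pi.single q 1) j) = if q = k then 1 else 0 := fun q => by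
    obtain ⟨h1, h2, h3⟩ := mem_symm_trans_source hp
    have h4 := fderiv_chart_comp_symm_apply hψ hφ h3 (Pi.single q 1)
    rw [ψ.left_inv h2, φ.right_inv h1] at h4
    rw [eq_sum_smul_single (fderiv ℂ (ψ ∘ φ.symm) p.1 (Pi.single q 1)), map_sum] at h4
    have h5 := congrFun h4 k
    rw [Finset.sum_apply] at h5
    simp only [coordChangeDeriv_fibreVec, ← map_mul, ← map_sum]
    have h6 : ∑ j, fderiv ℂ (φ ∘ ψ.symm) (ψ (φ.symm p.1)) (Pi.single j 1) k *
        fderiv ℂ (ψ ∘ φ.symm) p.1 (Pi.single q 1) j = if q = k then 1 else 0 := by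
      rw [show (if q = k then (1 : ℂ) else 0) = (Pi.single q 1 : Cn n) k by
        simp [Pi.single_apply, eq_comm], ← h5]
      refine Finset.sum_congr rfl fun j _ => ?_
      rw [map_smul, Pi.smul_apply, smul_eq_mul, mul_comm]
    rw [h6]
    split_ifs <;> simp
  -- One of the two Jacobian factors in the tensor law is cancelled by `hinv`; the other stays.
  have e2 : ∀ m, ∑ j, cj (!σ) ((coordChangeDeriv φ ψ p (fibreVec k)).2 j) *
      η.comp σ ψ m j (ψ (φ.symm p.1)) =
      ∑ l, η.comp σ φ l k p.1 * cj σ (fderiv ℂ (ψ ∘ φ.symm) p.1 (Pi.single l 1) m) := fun m => by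
    calc _ = ∑ l, ∑ q, (∑ j, cj (!σ) ((coordChangeDeriv φ ψ p (fibreVec k)).2 j) *
          cj (!σ) (fderiv ℂ (ψ ∘ φ.symm) p.1 (Pi.single q 1) j)) *
          (η.comp σ φ l q p.1 * cj σ (fderiv ℂ (ψ ∘ φ.symm) p.1 (Pi.single l 1) m)) := by
          simp only [η.comp_transform σ hφ hψ hp, Finset.mul_sum, Finset.sum_mul]
          rw [Finset.sum_comm]
          refine Finset.sum_congr rfl fun l _ => ?_
          rw [Finset.sum_comm]
          exact Finset.sum_congr rfl fun q _ => Finset.sum_congr rfl fun j _ => by ring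
      _ = _ := by
          refine Finset.sum_congr rfl fun l _ => ?_
          simp only [hinv, ite_mul, one_mul, zero_mul, Finset.sum_ite_eq', Finset.mem_univ, if_true]
  simp only [contr, Finset.mul_sum]
  rw [Finset.sum_comm]
  conv_rhs => rw [Finset.sum_comm]
  refine Finset.sum_congr rfl fun m _ => ?_
  rw [← Finset.sum_mul, ← e2 m, Finset.sum_mul]
  refine Finset.sum_congr rfl fun j _ => ?_
  rw [mul_assoc]
  rfl

theorem wirt_fibreVec_coordChange (σ : Bool) (hφ : φ ∈ holCharts n M)
    (hψ : ψ ∈ holCharts n M) {p : Cn n × Cn n} (hp : p.1 ∈ (φ.symm ≫ₕ ψ).source)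
    {F : Cn n × Cn n → ℂ} (hF : DifferentiableAt ℝ F (coordChange φ ψ p)) (k : Fin n) :
    wirt (sg σ) (fibreVec k) (fun q => F (coordChange φ ψ q)) p =
      ∑ j, cj σ ((coordChangeDeriv φ ψ p (fibreVec k)).2 j) *
        wirt (sg σ) (fibreVec j) F (coordChange φ ψ p) := by
  rw [wirt_comp (hasFDerivAt_coordChange hφ hψ hp) hF, wirt_sg]
  refine Finset.sum_congr rfl fun j _ => ?_
  have h : (coordChangeDeriv φ ψ p (fibreVec k)).1 j = 0 := by rw [coordChangeDeriv_fibreVec]; rfl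
  rw [h, map_zero, zero_mul, zero_add]

theorem eventually_mem_source {w : Cn n} (hw : w ∈ (φ.symm ≫ₕ ψ).source) :
    ∀ᶠ p : Cn n × Cn n in 𝓝 (w, 0), p.1 ∈ (φ.symm ≫ₕ ψ).source :=
  continuous_fst.continuousAt.eventually_mem ((φ.symm ≫ₕ ψ).open_source.mem_nhds hw)

/-- The source equations do not depend on the chart. -/
theorem SourceAt.comp_coordChange {σ : Bool} {g h : Tensor11 n M} (hφ : φ ∈ holCharts n M)
    (hψ : ψ ∈ holCharts n M) {w : Cn n} (hw : w ∈ (φ.symm ≫ₕ ψ).source)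
    {F₀ F₁ : Cn n × Cn n → ℂ} (hF₀ : ContDiffAt ℝ ∞ F₀ (ψ (φ.symm w), 0))
    (hF₁ : ContDiffAt ℝ ∞ F₁ (ψ (φ.symm w), 0))
    (hS : SourceAt σ (g.comp σ ψ) (h.comp σ ψ) F₀ F₁ (ψ (φ.symm w))) :
    SourceAt σ (g.comp σ φ) (h.comp σ φ) (fun p => F₀ (coordChange φ ψ p))
      (fun p => F₁ (coordChange φ ψ p)) w := by
  have hΦ : ContinuousAt (coordChange φ ψ) (w, 0) :=
    (contDiffAt_coordChange hφ hψ (p := (w, 0)) hw).continuousAt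
  have hdiff : ∀ {F : Cn n × Cn n → ℂ}, ContDiffAt ℝ ∞ F (ψ (φ.symm w), 0) →
      ∀ᶠ p in 𝓝 (w, 0), DifferentiableAt ℝ F (coordChange φ ψ p) := fun {F} hF => by
    have h1 := (hF.of_le (by simp : (1 : WithTop ℕ∞) ≤ ∞)).eventually (by simp)
    rw [← coordChange_zero w] at h1
    exact (hΦ.eventually h1).mono fun p hp => hp.differentiableAt (by simp)
  have hcf : ∀ τ k j, ContinuousAt
      (fun p => cj τ ((coordChangeDeriv φ ψ p (fibreVec k)).2 j)) (w, 0) := fun τ k j =>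
    (continuous_cj τ).continuousAt.comp ((continuous_apply j).continuousAt.comp
      (continuous_snd.continuousAt.comp (continuousAt_coordChangeDeriv hφ hψ hw (fibreVec k))))
  have hcb : ∀ τ k j, ContinuousAt
      (fun p => cj τ ((coordChangeDeriv φ ψ p (baseVec k)).2 j)) (w, 0) := fun τ k j =>
    (continuous_cj τ).continuousAt.comp ((continuous_apply j).continuousAt.comp
      (continuous_snd.continuousAt.comp (continuousAt_coordChangeDeriv hφ hψ hw (baseVec k))))
  have hcg : ∀ (η : Tensor11 n M) l k, ContinuousAt
      (fun p : Cn n × Cn n => η.comp σ φ l k p.1) (w, 0) := fun η l k => by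
    have h1 : ContinuousAt (η.comp σ φ l k) w := by
      have hwt := φ.open_target.mem_nhds (mem_symm_trans_source hw).1
      cases σ
      · exact ((η.smooth φ hφ k l).contDiffAt hwt).continuousAt
      · exact ((η.smooth φ hφ l k).contDiffAt hwt).continuousAt
    exact ContinuousAt.comp (f := Prod.fst) (x := ((w, 0) : Cn n × Cn n)) h1 continuousAt_fst
  have hanti : ∀ {F : Cn n × Cn n → ℂ}, ContDiffAt ℝ ∞ F (ψ (φ.symm w), 0) →
      (∀ l, FlatAt (wirt (sg σ) (fibreVec l) F) (ψ (φ.symm w))) →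
      ∀ l, FlatAt (wirt (sg σ) (fibreVec l) fun p => F (coordChange φ ψ p)) w := by
    intro F hF hf l
    refine (FlatAt.sum (s := Finset.univ) fun j _ =>
      ((hf j).comp_coordChange hφ hψ hw).mul_left (hcf σ l j)).congr ?_
    filter_upwards [eventually_mem_source hw, hdiff hF] with p hp hd
    exact (wirt_fibreVec_coordChange σ hφ hψ hp hd l).symm
  -- The error term in `contr_coordChange` is flat by the first set of equations, so the second set
  -- is covariant modulo the first.
  have herr : ∀ {F : Cn n × Cn n → ℂ} (η : Tensor11 n M),
      (∀ l, FlatAt (wirt (sg σ) (fibreVec l) F) (ψ (φ.symm w))) → ∀ k,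
      FlatAt (fun p => ∑ l, ∑ m, η.comp σ φ l k p.1 *
        cj σ ((coordChangeDeriv φ ψ p (baseVec l)).2 m) *
        wirt (sg σ) (fibreVec m) F (coordChange φ ψ p)) w := fun η hf k =>
    FlatAt.sum fun l _ => FlatAt.sum fun m _ =>
      ((hf m).comp_coordChange hφ hψ hw).mul_left ((hcg η l k).mul (hcb σ l m))
  refine ⟨hanti hF₀ hS.anti₀, hanti hF₁ hS.anti₁, fun k => ?_, fun k => ?_⟩
  · refine ((FlatAt.sum (s := Finset.univ) fun j _ =>
      ((hS.eq₀ j).comp_coordChange hφ hψ hw).mul_left (hcf (!σ) k j)).sub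
      (herr g hS.anti₀ k)).congr ?_
    filter_upwards [eventually_mem_source hw, hdiff hF₀] with p hp hd
    rw [wirt_fibreVec_coordChange (!σ) hφ hψ hp hd, contr_coordChange σ g hφ hψ hp hd]
    simp only [mul_sub, Finset.sum_sub_distrib]
    ring
  · refine ((FlatAt.sum (s := Finset.univ) fun j _ =>
      ((hS.eq₁ j).comp_coordChange hφ hψ hw).mul_left (hcf (!σ) k j)).sub
      ((herr g hS.anti₁ k).add (herr h hS.anti₀ k))).congr ?_
    filter_upwards [eventually_mem_source hw, hdiff hF₀, hdiff hF₁] with p hp hd hd1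
    rw [wirt_fibreVec_coordChange (!σ) hφ hψ hp hd1, contr_coordChange σ g hφ hψ hp hd1,
      contr_coordChange σ h hφ hψ hp hd]
    simp only [mul_sub, mul_add, Finset.sum_sub_distrib, Finset.sum_add_distrib]
    ring

theorem SourceAt.congr {σ : Bool} {γ η : Fin n → Fin n → Cn n → ℂ} {F₀ F₁ G₀ G₁ : Cn n × Cn n → ℂ}
    {w : Cn n} (hS : SourceAt σ γ η F₀ F₁ w) (h₀ : F₀ =ᶠ[𝓝 (w, 0)] G₀)
    (h₁ : F₁ =ᶠ[𝓝 (w, 0)] G₁) : SourceAt σ γ η G₀ G₁ w := by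
  have e : ∀ {F G : Cn n × Cn n → ℂ}, F =ᶠ[𝓝 (w, 0)] G → ∀ᶠ p in 𝓝 ((w, 0) : Cn n × Cn n),
      (∀ s v, wirt s v F p = wirt s v G p) ∧ ∀ η k, contr σ η k F p = contr σ η k G p := by
    intro F G h
    filter_upwards [h.eventuallyEq_nhds] with p hp
    have h1 : ∀ s v, wirt s v F p = wirt s v G p := fun s v => by
      simp only [wirt, hp.fderiv_eq]
    exact ⟨h1, fun η k => by simp only [contr, h1]⟩
  refine ⟨fun l => (hS.anti₀ l).congr ((e h₀).mono fun p hp => hp.1 _ _),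
    fun l => (hS.anti₁ l).congr ((e h₁).mono fun p hp => hp.1 _ _),
    fun k => (hS.eq₀ k).congr ((e h₀).mono fun p hp => ?_), fun k => (hS.eq₁ k).congr ?_⟩
  · simp only [hp.1, hp.2]
  · filter_upwards [e h₀, e h₁] with p hp hp1
    simp only [hp.2, hp1.1, hp1.2]

end SourceAt

/-! ### Formal functions along the zero section -/

section Global

open Set Filter TopologicalSpace Asymptotics

variable {n : ℕ} {M : Type*} [TopologicalSpace M] [ChartedSpace (Cn n) M]
  [IsManifold 𝓘(ℂ, Cn n) ω M] {φ ψ : OpenPartialHomeomorph M (Cn n)}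

/-- The target of a chart as an open set. -/
def tgt (φ : OpenPartialHomeomorph M (Cn n)) : Opens (Cn n) := ⟨φ.target, φ.open_target⟩

/-- A function on `T*M` as a function of the coordinates `(z, ζ)`. -/
def chartFun {Y : Type*} (φ : OpenPartialHomeomorph M (Cn n)) (F : Cotangent n M → Y)
    (p : Cn n × Cn n) : Y := F (cotangentPoint φ p.1 p.2)

theorem contDiffAt_chartFun {Y : Type*} [NormedAddCommGroup Y] [NormedSpace ℝ Y]
    (hφ : φ ∈ holCharts n M) {F : Cotangent n M → Y} {p : Cn n × Cn n} (hp : p.1 ∈ φ.target)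
    (hF : ContMDiffAt (cotangentModel n) 𝓘(ℝ, Y) ∞ F (cotangentPoint φ p.1 p.2)) :
    ContDiffAt ℝ ∞ (chartFun φ F) p :=
  contMDiffAt_iff_contDiffAt.1 (ContMDiffAt.comp p hF (contMDiffAt_cotangentPoint hφ hp))

theorem eventually_mem_chart_source {p : Cotangent n M} (hp : p.1 ∈ φ.source) :
    ∀ᶠ q : Cotangent n M in 𝓝 p, q.1 ∈ φ.source :=
  (FiberBundle.continuous_proj (Cn n →L[ℝ] ℝ)
    (fun x : M => TangentSpace 𝓘(ℝ, Cn n) x →L[ℝ] Trivial M ℝ x)).continuousAt.eventually_mem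
    (φ.open_source.mem_nhds hp)

theorem contMDiffAt_of_chartFun {Y : Type*} [NormedAddCommGroup Y] [NormedSpace ℝ Y]
    (hφ : φ ∈ holCharts n M) {F : Cotangent n M → Y} {p : Cotangent n M} (hp : p.1 ∈ φ.source)
    (hF : ContDiffAt ℝ ∞ (chartFun φ F) (cotangentCoord φ p)) :
    ContMDiffAt (cotangentModel n) 𝓘(ℝ, Y) ∞ F p := by
  refine (ContMDiffAt.comp p hF.contMDiffAt
    (contMDiffAt_cotangentCoord hφ hp)).congr_of_eventuallyEq ?_
  filter_upwards [eventually_mem_chart_source hp] with q hq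
  exact congrArg F (cotangentPoint_cotangentCoord hφ hq).symm

theorem chartFun_coordChange {Y : Type*} (hφ : φ ∈ holCharts n M) (hψ : ψ ∈ holCharts n M)
    (F : Cotangent n M → Y) {p : Cn n × Cn n} (hp : p.1 ∈ (φ.symm ≫ₕ ψ).source) :
    chartFun ψ F (coordChange φ ψ p) = chartFun φ F p :=
  congrArg F (cotangentPoint_coordChange hφ hψ hp p.2)

theorem mem_trans_source {x : M} (hx : x ∈ φ.source) (hx' : x ∈ ψ.source) :
    φ x ∈ (φ.symm ≫ₕ ψ).source := by
  simp [hx, hx']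

/-- The function `F` is flat at the point of the zero section over `x`. -/
def FlatOver (F : Cotangent n M → ℂ) (x : M) : Prop :=
  ∀ φ ∈ holCharts n M, x ∈ φ.source → FlatAt (chartFun φ F) (φ x)

/-- The fibre coordinates change linearly over each base point, so the order of decay does not
depend on the chart. -/
theorem FlatOver.of_chart {F : Cotangent n M → ℂ} {x : M} (hψ : ψ ∈ holCharts n M)
    (hx : x ∈ ψ.source) (hF : FlatAt (chartFun ψ F) (ψ x)) : FlatOver F x := by
  intro φ hφ hxφ
  have hw := mem_trans_source hxφ hx
  rw [← φ.left_inv hxφ] at hF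
  refine (hF.comp_coordChange hφ hψ hw).congr ?_
  filter_upwards [eventually_mem_source hw] with p hp
  exact chartFun_coordChange hφ hψ F hp

theorem cotangentPoint_zero (φ : OpenPartialHomeomorph M (Cn n)) (w : Cn n) :
    cotangentPoint φ w 0 = zeroSection (Cn n →L[ℝ] ℝ) _ (φ.symm w) := by
  have h : covector (0 : Cn n) = 0 := by
    ext v
    simp [covector_apply]
  rw [cotangentPoint, h]
  exact congrArg (TotalSpace.mk (φ.symm w)) (ContinuousLinearMap.zero_comp _)

theorem mem_zeroSec_of_fibreCoord (hφ : φ ∈ holCharts n M) {p : Cotangent n M}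
    (hp : p.1 ∈ φ.source) (h : fibreCoord φ p = 0) : p ∈ zeroSec n M := by
  rw [← cotangentPoint_cotangentCoord hφ hp, h, cotangentPoint_zero]
  rfl

theorem cotangentPoint_mem_zeroSec (hφ : φ ∈ holCharts n M) {p : Cn n × Cn n} (hp : p.1 ∈ φ.target)
    (h : cotangentPoint φ p.1 p.2 ∈ zeroSec n M) : p.2 = 0 := by
  have h1 : cotangentPoint φ p.1 p.2 = cotangentPoint φ p.1 0 := by
    rw [cotangentPoint_zero]
    exact congrArg (TotalSpace.mk (φ.symm p.1)) h
  have h2 := congrArg (cotangentCoord φ) h1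
  rw [cotangentCoord_cotangentPoint hφ hp, cotangentCoord_cotangentPoint hφ hp] at h2
  exact congrArg Prod.snd h2

theorem chartFun_isBigO_of_mem_vanishingIdeal {F : CT n M}
    (hF : F ∈ vanishingIdeal (cotangentModel n) (zeroSec n M)) (hφ : φ ∈ holCharts n M) {x : M}
    (hx : x ∈ φ.source) : chartFun φ F.1 =O[𝓝 (φ x, 0)] fun p => ‖p.2‖ :=
  (isBigO_snd_of_contDiffAt (contDiffAt_chartFun hφ (φ.map_source hx) F.2.contMDiffAt)
    (Eventually.of_forall fun w => by
      rw [chartFun, cotangentPoint_zero]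
      exact hF _ rfl)).norm_right

/-- The functions that are `O(‖ζ‖^N)` at a given point form an ideal. For `N = 1` it contains the
vanishing ideal, and the orders add under products, so it contains the `N`-th power. -/
theorem flatOver_of_mem_flatIdeal {F : CT n M}
    (hF : F ∈ flatIdeal (cotangentModel n) (zeroSec n M)) (x : M) : FlatOver F.1 x := by
  intro φ hφ hx N
  let I : ℕ → Ideal (CT n M) := fun N =>
    { carrier := {F | chartFun φ F.1 =O[𝓝 (φ x, 0)] fun p => ‖p.2‖ ^ N}
      add_mem' := fun {a b} ha hb => IsBigO.add ha hb
      zero_mem' := isBigO_zero _ _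
      smul_mem' := fun c F hF => by
        have h := ((contDiffAt_chartFun hφ (p := (φ x, 0)) (φ.map_source hx)
          (F := c.1) c.2.contMDiffAt).continuousAt.isBigO_one ℝ).mul hF
        exact h.congr_right fun p => one_mul _ }
  have hI : ∀ N, vanishingIdeal (cotangentModel n) (zeroSec n M) ^ N ≤ I N := by
    intro N
    induction N with
    | zero =>
      intro F _
      have h := (contDiffAt_chartFun hφ (p := (φ x, 0)) (φ.map_source hx)
          (F := F.1) F.2.contMDiffAt).continuousAt.isBigO_one ℝ
      exact (show chartFun φ F.1 =O[𝓝 (φ x, 0)] fun p => ‖p.2‖ ^ 0 by simpa using h)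
    | succ N ih =>
      rw [pow_succ]
      refine Ideal.mul_le.2 fun a ha b hb => ?_
      have h := IsBigO.mul (show chartFun φ a.1 =O[𝓝 (φ x, 0)] fun p => ‖p.2‖ ^ N from ih ha)
        (chartFun_isBigO_of_mem_vanishingIdeal hb hφ hx)
      exact h.congr_right fun p => (pow_succ _ _).symm
  exact hI N (Ideal.mem_iInf.1 hF N)

/-! #### Partitions of unity -/

theorem continuous_cotangent_proj : Continuous (TotalSpace.proj : Cotangent n M → M) :=
  FiberBundle.continuous_proj (Cn n →L[ℝ] ℝ)
    (fun x : M => TangentSpace 𝓘(ℝ, Cn n) x →L[ℝ] Trivial M ℝ x)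

theorem contMDiff_pullback_real {f : M → ℝ} (hf : ContMDiff 𝓘(ℝ, Cn n) 𝓘(ℝ) ∞ f) :
    ContMDiff (cotangentModel n) 𝓘(ℝ) ∞ (fun p : Cotangent n M => f p.1) :=
  ContMDiff.comp (I' := 𝓘(ℝ, Cn n)) hf
    (contMDiff_proj (fun x : M => TangentSpace 𝓘(ℝ, Cn n) x →L[ℝ] Trivial M ℝ x))

theorem contMDiff_cutoff_smul {Y : Type*} [NormedAddCommGroup Y] [NormedSpace ℝ Y] {f : M → ℝ}
    (hf : ContMDiff 𝓘(ℝ, Cn n) 𝓘(ℝ) ∞ f) {G : Cotangent n M → Y}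
    (hG : ∀ p, p.1 ∈ tsupport f → ContMDiffAt (cotangentModel n) 𝓘(ℝ, Y) ∞ G p) :
    ContMDiff (cotangentModel n) 𝓘(ℝ, Y) ∞ (fun p : Cotangent n M => f p.1 • G p) := by
  refine contMDiff_of_tsupport fun p hp => ?_
  have h1 : p.1 ∈ tsupport f := by
    refine closure_minimal (t := TotalSpace.proj ⁻¹' tsupport f) (fun q hq => ?_)
      ((isClosed_tsupport f).preimage continuous_cotangent_proj) hp
    refine subset_closure fun h0 => hq ?_
    change f q.1 • G q = 0
    rw [show f q.1 = 0 from h0, zero_smul]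
  exact (contMDiff_pullback_real hf).contMDiffAt.smul (hG p h1)

theorem locallyFinite_pullback {ι : Type*} {f : ι → M → ℝ}
    (hf : LocallyFinite fun i => Function.support (f i)) :
    LocallyFinite fun i => (TotalSpace.proj ⁻¹' Function.support (f i) : Set (Cotangent n M)) :=
  hf.preimage_continuous continuous_cotangent_proj

theorem contMDiff_patch {ι Y : Type*} [NormedAddCommGroup Y] [NormedSpace ℝ Y]
    (f : SmoothPartitionOfUnity ι 𝓘(ℝ, Cn n) M univ) {G : ι → Cotangent n M → Y}
    (hG : ∀ i p, p.1 ∈ tsupport (f i) → ContMDiffAt (cotangentModel n) 𝓘(ℝ, Y) ∞ (G i) p) :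
    ContMDiff (cotangentModel n) 𝓘(ℝ, Y) ∞ (fun p : Cotangent n M => ∑ᶠ i, f i p.1 • G i p) := by
  refine contMDiff_finsum (fun i => contMDiff_cutoff_smul (f i).contMDiff (hG i)) ?_
  refine (locallyFinite_pullback f.locallyFinite).subset fun i p hp h0 => hp ?_
  change f i p.1 • G i p = 0
  rw [show f i p.1 = 0 from h0, zero_smul]

variable [T2Space M] [SecondCountableTopology M]

theorem sigmaCompactSpace_of_charted (n : ℕ) (M : Type*) [TopologicalSpace M]
    [ChartedSpace (Cn n) M] [SecondCountableTopology M] : SigmaCompactSpace M := by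
  have : LocallyCompactSpace M := ChartedSpace.locallyCompactSpace (Cn n) M
  infer_instance

theorem coordChange_coordChange (hφ : φ ∈ holCharts n M) (hψ : ψ ∈ holCharts n M) {p : Cn n × Cn n}
    (hp : p.1 ∈ (φ.symm ≫ₕ ψ).source) : coordChange ψ φ (coordChange φ ψ p) = p := by
  obtain ⟨h1, h2, h3⟩ := mem_symm_trans_source hp
  have h4 := fibreCoord_cotangentPoint hψ hφ h3 (coordChange φ ψ p).2
  have h5 := cotangentPoint_coordChange hφ hψ hp p.2
  have h6 : cotangentPoint ψ (ψ (φ.symm p.1)) (coordChange φ ψ p).2 = cotangentPoint φ p.1 p.2 := h5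
  rw [h6, cotangentCoord_cotangentPoint hφ h1] at h4
  exact h4.symm

/-- The upper bound for the inverse coordinate change, read as a lower bound for the change itself.
-/
theorem snd_isBigO_coordChange (hφ : φ ∈ holCharts n M) (hψ : ψ ∈ holCharts n M) {w : Cn n}
    (hw : w ∈ (φ.symm ≫ₕ ψ).source) :
    (fun p => p.2) =O[𝓝 ((w, 0) : Cn n × Cn n)] fun p => (coordChange φ ψ p).2 := by
  obtain ⟨h1, h2, h3⟩ := mem_symm_trans_source hw
  have hc : Tendsto (coordChange φ ψ) (𝓝 (w, 0)) (𝓝 (ψ (φ.symm w), 0)) := by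
    rw [← coordChange_zero w]
    exact (contDiffAt_coordChange hφ hψ (p := (w, 0)) hw).continuousAt
  refine ((coordChange_snd_isBigO hψ hφ h3).comp_tendsto hc).congr' ?_ EventuallyEq.rfl
  filter_upwards [eventually_mem_source hw] with p hp
  exact congrArg Prod.snd (coordChange_coordChange hφ hψ hp)

variable (n M) in
/-- There is a smooth function on `T*M` that is locally comparable to the square of the norm in the
fibres. -/
theorem exists_fibre_norm : ∃ ρ : Cotangent n M → ℝ,
    ContMDiff (cotangentModel n) 𝓘(ℝ) ∞ ρ ∧ (∀ p ∈ zeroSec n M, ρ p = 0) ∧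
    (∀ p ∉ zeroSec n M, ρ p ≠ 0) ∧ ∀ φ ∈ holCharts n M, ∀ x ∈ φ.source,
      (fun p : Cn n × Cn n => ‖p.2‖ ^ 2) =O[𝓝 (φ x, 0)] chartFun φ ρ := by
  have := sigmaCompactSpace_of_charted n M
  obtain ⟨f, hf⟩ := SmoothPartitionOfUnity.exists_isSubordinate_chartAt_source 𝓘(ℝ, Cn n) M
  -- The squared Euclidean norm of the fibre coordinates in each preferred chart, to be averaged
  -- with a partition of unity.
  set G : M → Cotangent n M → ℝ := fun i p =>
    ∑ k, Complex.normSq ((cotangentCoord (chartAt (Cn n) i) p).2 k) with hG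
  have hnsq : ContDiff ℝ ∞ (fun q : Cn n × Cn n => ∑ k, Complex.normSq (q.2 k)) := by
    refine ContDiff.sum fun k _ => ?_
    have h1 : ContDiff ℝ ∞ (fun z : ℂ => Complex.normSq z) := by
      have : (fun z : ℂ => Complex.normSq z) = fun z => Complex.reCLM z * Complex.reCLM z +
          Complex.imCLM z * Complex.imCLM z := by
        funext z
        simp [Complex.normSq_apply]
      rw [this]
      exact (Complex.reCLM.contDiff.mul Complex.reCLM.contDiff).add
        (Complex.imCLM.contDiff.mul Complex.imCLM.contDiff)
    exact h1.comp ((ContinuousLinearMap.proj k : Cn n →L[ℝ] ℂ).contDiff.comp contDiff_snd)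
  have hGs : ∀ i p, p.1 ∈ tsupport (f i) → ContMDiffAt (cotangentModel n) 𝓘(ℝ) ∞ (G i) p :=
    fun i p hp => ContMDiffAt.comp (g := fun q : Cn n × Cn n => ∑ k, Complex.normSq (q.2 k)) p
      hnsq.contDiffAt.contMDiffAt
      (contMDiffAt_cotangentCoord (chartAt_mem_holCharts i) (hf i hp))
  have hG0 : ∀ i p, 0 ≤ G i p := fun i p => Finset.sum_nonneg fun k _ => Complex.normSq_nonneg _
  set ρ : Cotangent n M → ℝ := fun p => ∑ᶠ i, f i p.1 • G i p with hρ
  -- All terms are nonnegative, so a single one with positive weight already bounds `ρ` from below.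
  have hle : ∀ i p, f i p.1 * G i p ≤ ρ p := fun i p => by
    refine single_le_finsum (f := fun i => f i p.1 • G i p) i ?_ fun j =>
      mul_nonneg (f.nonneg j _) (hG0 j p)
    refine (f.locallyFinite.point_finite p.1).subset fun j hj h0 => hj ?_
    change f j p.1 • G j p = 0
    rw [show f j p.1 = 0 from h0, zero_smul]
  have hpos : ∀ x : M, ∃ i, 0 < f i x := fun x => by
    by_contra! h
    have h1 := f.sum_eq_one (mem_univ x)
    rw [finsum_congr (fun i => le_antisymm (h i) (f.nonneg i x)), finsum_zero] at h1
    exact zero_ne_one h1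
  have hsrc : ∀ i x, 0 < f i x → x ∈ (chartAt (Cn n) i).source := fun i x h =>
    hf i (subset_closure h.ne')
  refine ⟨ρ, contMDiff_patch f hGs, fun p hp => ?_, fun p hp => ?_, fun φ hφ x hx => ?_⟩
  · refine finsum_eq_zero_of_forall_eq_zero fun i => ?_
    by_cases h : f i p.1 = 0
    · rw [h, zero_smul]
    · have hs := hsrc i p.1 (lt_of_le_of_ne (f.nonneg i _) (Ne.symm h))
      have h1 : p = cotangentPoint (chartAt (Cn n) i) (chartAt (Cn n) i p.1) 0 := by
        rw [cotangentPoint_zero, (chartAt (Cn n) i).left_inv hs]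
        exact congrArg (TotalSpace.mk p.1) hp
      have h2 : (cotangentCoord (chartAt (Cn n) i) p).2 = 0 := by
        conv_lhs => rw [h1]
        rw [cotangentCoord_cotangentPoint (chartAt_mem_holCharts i)
          ((chartAt (Cn n) i).map_source hs)]
      simp [hG, h2]
  · obtain ⟨i, hi⟩ := hpos p.1
    refine (lt_of_lt_of_le (mul_pos hi ?_) (hle i p)).ne'
    have h1 : (cotangentCoord (chartAt (Cn n) i) p).2 ≠ 0 := fun h =>
      hp (mem_zeroSec_of_fibreCoord (chartAt_mem_holCharts i) (hsrc i _ hi) h)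
    obtain ⟨k, hk⟩ := Function.ne_iff.1 h1
    exact lt_of_lt_of_le (Complex.normSq_pos.2 hk)
      (Finset.single_le_sum (f := fun k => Complex.normSq ((cotangentCoord (chartAt (Cn n) i) p).2 k))
        (fun j _ => Complex.normSq_nonneg _) (Finset.mem_univ k))
  · obtain ⟨i, hi⟩ := hpos x
    set χ := chartAt (Cn n) i with hχ
    have hχh : χ ∈ holCharts n M := chartAt_mem_holCharts i
    have hw := mem_trans_source hx (hsrc i x hi)
    have h1 := (snd_isBigO_coordChange hφ hχh hw).norm_norm.pow 2
    -- The weight `f i` stays above half its value at `x` in a neighbourhood of `x`.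
    refine h1.trans (IsBigO.of_bound (2 / f i x) ?_)
    have hcont : ContinuousAt (fun p : Cn n × Cn n => f i (φ.symm p.1)) (φ x, 0) := by
      have hc1 : ContinuousAt (fun p : Cn n × Cn n => φ.symm p.1) (φ x, 0) :=
        ContinuousAt.comp (f := Prod.fst) (x := ((φ x, 0) : Cn n × Cn n))
          (φ.continuousAt_symm (φ.map_source hx)) continuousAt_fst
      exact (f i).contMDiff.continuous.continuousAt.comp hc1
    have hev : ∀ᶠ p : Cn n × Cn n in 𝓝 (φ x, 0), f i x / 2 < f i (φ.symm p.1) := by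
      refine hcont.eventually (lt_mem_nhds ?_)
      change f i x / 2 < f i (φ.symm (φ x))
      rw [φ.left_inv hx]
      linarith
    filter_upwards [hev, eventually_mem_source hw] with p hp hps
    have h2 := hle i (cotangentPoint φ p.1 p.2)
    have h3 : G i (cotangentPoint φ p.1 p.2) = ∑ k, Complex.normSq ((coordChange φ χ p).2 k) := by
      simp only [hG]
      rw [fibreCoord_cotangentPoint hφ hχh hps p.2]
    have h4 : ‖(coordChange φ χ p).2‖ ^ 2 ≤ G i (cotangentPoint φ p.1 p.2) := by
      rw [h3]
      have hs0 : 0 ≤ ∑ k, Complex.normSq ((coordChange φ χ p).2 k) :=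
        Finset.sum_nonneg fun k _ => Complex.normSq_nonneg _
      rw [← Real.sq_sqrt hs0]
      refine pow_le_pow_left₀ (norm_nonneg _) ?_ 2
      refine (pi_norm_le_iff_of_nonneg (Real.sqrt_nonneg _)).2 fun k => ?_
      rw [Complex.norm_def]
      exact Real.sqrt_le_sqrt (Finset.single_le_sum
        (f := fun k => Complex.normSq ((coordChange φ χ p).2 k))
        (fun j _ => Complex.normSq_nonneg _) (Finset.mem_univ k))
    have h5 : ‖(coordChange φ χ p).2‖ ^ 2 * (f i x / 2) ≤ ρ (cotangentPoint φ p.1 p.2) := by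
      refine le_trans ?_ h2
      rw [mul_comm]
      exact mul_le_mul hp.le h4 (by positivity) (f.nonneg i _)
    rw [Real.norm_of_nonneg (by positivity), Real.norm_eq_abs]
    refine le_trans ?_ (mul_le_mul_of_nonneg_left (le_abs_self _) (by positivity))
    rw [chartFun, div_mul_eq_mul_div, le_div_iff₀ hi]
    linarith

/-- Write `F = ρ^l (F / ρ^l)` with `ρ` comparable to the squared fibre norm. Division of a flat
function by a power of `ρ` leaves a smooth function, and `ρ` vanishes on the zero section, so `F`
lies in every power of the ideal; a single global factorization serves for each `l`. -/
theorem mem_flatIdeal_of_flatOver {F : CT n M} (hF : ∀ x, FlatOver F.1 x) :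
    F ∈ flatIdeal (cotangentModel n) (zeroSec n M) := by
  obtain ⟨ρ, hρ, hρ0, hρ1, hρ2⟩ := exists_fibre_norm n M
  refine Ideal.mem_iInf.2 fun l => ?_
  have hq : ContMDiff (cotangentModel n) 𝓘(ℝ, ℂ) ∞ (fun p => (ρ p ^ l)⁻¹ • F.1 p) := fun p => by
    have hφ := chartAt_mem_holCharts (n := n) p.1
    have hp := mem_chart_source (Cn n) p.1
    refine contMDiffAt_of_chartFun hφ hp ?_
    have h1 := contDiffOn_inv_pow_smul (E := Cn n) (V := Cn n) (Y := ℂ)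
      (W := tube (tgt (chartAt (Cn n) p.1))) (ρ := chartFun (chartAt (Cn n) p.1) ρ)
      (F := chartFun (chartAt (Cn n) p.1) F.1) (isOpen_tube _)
      (fun q hq => (contDiffAt_chartFun hφ (mem_tube.1 hq) hρ.contMDiffAt).contDiffWithinAt)
      (fun q hq h0 => hρ1 _ fun h => h0 (cotangentPoint_mem_zeroSec hφ (mem_tube.1 hq) h))
      (fun w hw => by
        have hw' : w ∈ (chartAt (Cn n) p.1).target := mem_tube.1 hw
        have h2 := hρ2 _ hφ _ ((chartAt (Cn n) p.1).map_target hw')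
        rwa [(chartAt (Cn n) p.1).right_inv hw'] at h2)
      (fun q hq => (contDiffAt_chartFun hφ (mem_tube.1 hq) F.2.contMDiffAt).contDiffWithinAt)
      (fun w hw => by
        have hw' : w ∈ (chartAt (Cn n) p.1).target := mem_tube.1 hw
        have h2 := hF _ _ hφ ((chartAt (Cn n) p.1).map_target hw')
        rwa [(chartAt (Cn n) p.1).right_inv hw'] at h2) l
    exact h1.contDiffAt ((isOpen_tube _).mem_nhds (mem_tube.2 ((chartAt (Cn n) p.1).map_source hp)))
  have hρc : ContMDiff (cotangentModel n) 𝓘(ℝ, ℂ) ∞ (fun p => (ρ p : ℂ)) :=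
    ContMDiff.comp (I' := 𝓘(ℝ)) Complex.ofRealCLM.contDiff.contMDiff hρ
  let P : CT n M := ⟨_, hρc⟩
  let Q : CT n M := ⟨_, hq⟩
  have hF' : F = P ^ l * Q := by
    refine Subtype.ext (funext fun p => ?_)
    change F.1 p = (ρ p : ℂ) ^ l * ((ρ p ^ l)⁻¹ • F.1 p)
    by_cases hp : p ∈ zeroSec n M
    · have h0 : F.1 p = 0 := by
        have h1 := (hF p.1 _ (chartAt_mem_holCharts p.1) (mem_chart_source (Cn n) p.1)).eq_zero
        rw [chartFun, cotangentPoint_zero, (chartAt (Cn n) p.1).left_inv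
          (mem_chart_source (Cn n) p.1)] at h1
        rw [← h1]
        exact congrArg F.1 (congrArg (TotalSpace.mk p.1) hp)
      rw [h0, smul_zero, mul_zero]
    · have h1 : (ρ p : ℂ) ^ l ≠ 0 := pow_ne_zero _ (by exact_mod_cast hρ1 p hp)
      rw [Complex.real_smul]
      push_cast
      rw [mul_inv_cancel_left₀ h1]
  rw [hF']
  refine Ideal.mul_mem_right _ _ (Ideal.pow_mem_pow ?_ l)
  intro p hp
  change ((ρ p : ℝ) : ℂ) = 0
  rw [hρ0 p hp, Complex.ofReal_zero]

end Global

/-! ### Localization of formal functions in charts -/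

section Localization

open Set Filter TopologicalSpace

variable {n : ℕ} {M : Type*} [TopologicalSpace M] [ChartedSpace (Cn n) M]
  [IsManifold 𝓘(ℂ, Cn n) ω M] {φ ψ : OpenPartialHomeomorph M (Cn n)}

/-- A smooth function on `T*M` in the coordinates of a chart. -/
def chartSmooth (hφ : φ ∈ holCharts n M) : CT n M →ₐ[ℂ] SmoothTube (tgt φ) where
  toFun F := ⟨chartFun φ F.1, fun _ hp =>
    (contDiffAt_chartFun hφ (mem_tube.1 hp) F.2.contMDiffAt).contDiffWithinAt⟩
  map_one' := rfl
  map_mul' _ _ := rfl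
  map_zero' := rfl
  map_add' _ _ := rfl
  commutes' _ := rfl

theorem flatAt_chartFun {F : Cotangent n M → ℂ} (hF : ∀ x, FlatOver F x) (hφ : φ ∈ holCharts n M)
    {w : Cn n} (hw : w ∈ tgt φ) : FlatAt (chartFun φ F) w := by
  have h := hF _ φ hφ (φ.map_target hw)
  rwa [φ.right_inv hw] at h

/-- A formal function along the zero section in the coordinates of a chart. -/
def loc (hφ : φ ∈ holCharts n M) : CTZ n M →ₐ[ℂ] FormalTube (tgt φ) :=
  Ideal.Quotient.liftₐ (flatIdeal (cotangentModel n) (zeroSec n M))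
    ((tubeMk (tgt φ)).comp (chartSmooth hφ)) fun _ hF =>
      tubeMk_eq_zero.2 fun _ hw => flatAt_chartFun (flatOver_of_mem_flatIdeal hF) hφ hw

theorem loc_toFormal (hφ : φ ∈ holCharts n M) (F : CT n M) :
    loc hφ (toFormal n M F) = tubeMk (tgt φ) (chartSmooth hφ F) := rfl

theorem toFormal_surjective : Function.Surjective (toFormal n M) := Ideal.Quotient.mk_surjective

theorem coef_zero_loc (hφ : φ ∈ holCharts n M) (P : CTZ n M) (w : tgt φ) (ζ : Cn n) :
    coef 0 w ζ (loc hφ P) = (unitMap n M P).1 (φ.symm w) := by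
  obtain ⟨F, rfl⟩ := toFormal_surjective P
  rw [loc_toFormal, coef_zero]
  change F.1 (cotangentPoint φ w 0) = _
  rw [cotangentPoint_zero]
  rfl

theorem poisson_mem {U : Opens (Cn n)} (F G : SmoothTube U) :
    poisson F.1 G.1 ∈ SmoothTube U := by
  have hF := fun s v => contDiffOn_wirt F.2 s v
  have hG := fun s v => contDiffOn_wirt G.2 s v
  refine ContDiffOn.sum fun k _ => ?_
  exact ((((hF _ _).mul (hG _ _)).sub ((hF _ _).mul (hG _ _))).add ((hF _ _).mul (hG _ _))).sub
    ((hF _ _).mul (hG _ _))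

/-- The canonical bracket of formal functions. -/
abbrev tubeBracket {U : Opens (Cn n)} (a b : FormalTube U) : FormalTube U :=
  algBracket dZ dZbar dZeta dZetabar a b

theorem tubeBracket_tubeMk {U : Opens (Cn n)} (F G : SmoothTube U) :
    tubeBracket (tubeMk U F) (tubeMk U G) = tubeMk U ⟨poisson F.1 G.1, poisson_mem F G⟩ := by
  set H : Fin n → SmoothTube U := fun k =>
    wirtSmooth (-Complex.I) (fibreVec k) F * wirtSmooth (-Complex.I) (baseVec k) G -
      wirtSmooth (-Complex.I) (baseVec k) F * wirtSmooth (-Complex.I) (fibreVec k) G +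
      wirtSmooth Complex.I (fibreVec k) F * wirtSmooth Complex.I (baseVec k) G -
      wirtSmooth Complex.I (baseVec k) F * wirtSmooth Complex.I (fibreVec k) G with hH
  have e : (∑ k, H k).1 = poisson F.1 G.1 := by
    funext p
    rw [AddSubmonoidClass.coe_finsetSum, Finset.sum_apply]
    rfl
  rw [tubeBracket, algBracket]
  simp only [wirtD_tubeMk]
  calc _ = ∑ k, tubeMk U (H k) := Finset.sum_congr rfl fun l _ => rfl
    _ = tubeMk U (∑ k, H k) := (map_sum _ _ _).symm
    _ = _ := congrArg _ (Subtype.ext e)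

theorem differentiableAt_chartFun (hφ : φ ∈ holCharts n M) (F : CT n M) {p : Cn n × Cn n}
    (hp : p.1 ∈ φ.target) : DifferentiableAt ℝ (chartFun φ F.1) p :=
  (contDiffAt_chartFun hφ hp F.2.contMDiffAt).differentiableAt (by simp)

theorem canonicalBracket_inChart (hφ : φ ∈ holCharts n M) (F G : CT n M) {w : Cn n}
    (hw : w ∈ φ.target) (ζ : Cn n) :
    canonicalBracket (inChart φ F.1) (inChart φ G.1) w ζ =
      poisson (chartFun φ F.1) (chartFun φ G.1) (w, ζ) :=
  canonicalBracket_eq_poisson (differentiableAt_chartFun hφ F (p := (w, ζ)) hw)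
    (differentiableAt_chartFun hφ G (p := (w, ζ)) hw)

theorem poisson_chartFun_coordChange (hφ : φ ∈ holCharts n M) (hψ : ψ ∈ holCharts n M)
    (F G : CT n M) {p : Cn n × Cn n} (hp : p.1 ∈ (φ.symm ≫ₕ ψ).source) :
    poisson (chartFun ψ F.1) (chartFun ψ G.1) (coordChange φ ψ p) =
      poisson (chartFun φ F.1) (chartFun φ G.1) p := by
  have ht : (coordChange φ ψ p).1 ∈ ψ.target := ψ.map_source (mem_symm_trans_source hp).2.1
  rw [← poisson_coordChange hφ hψ hp (differentiableAt_chartFun hψ F ht)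
    (differentiableAt_chartFun hψ G ht)]
  have e : ∀ F : CT n M, (fun q => chartFun ψ F.1 (coordChange φ ψ q)) =ᶠ[𝓝 p]
      chartFun φ F.1 := fun F => by
    filter_upwards [((φ.symm ≫ₕ ψ).open_source.preimage continuous_fst).mem_nhds hp] with q hq
    exact chartFun_coordChange hφ hψ F.1 hq
  simp only [poisson, wirt, (e F).fderiv_eq, (e G).fderiv_eq]

/-- The Poisson bracket of two smooth functions on `T*M`. -/
theorem exists_poisson (F G : CT n M) : ∃ H : CT n M, ∀ φ ∈ holCharts n M, ∀ p : Cn n × Cn n,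
    p.1 ∈ φ.target → chartFun φ H.1 p = poisson (chartFun φ F.1) (chartFun φ G.1) p := by
  -- At each point the bracket is computed in the preferred chart of its base point; by invariance
  -- any other chart gives the same value, hence smoothness.
  set H : Cotangent n M → ℂ := fun q => poisson (chartFun (chartAt (Cn n) q.1) F.1)
    (chartFun (chartAt (Cn n) q.1) G.1) (cotangentCoord (chartAt (Cn n) q.1) q) with hH
  have key : ∀ φ ∈ holCharts n M, ∀ p : Cn n × Cn n,
      p.1 ∈ φ.target → chartFun φ H p = poisson (chartFun φ F.1) (chartFun φ G.1) p := by
    intro φ hφ p hp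
    have hps : p.1 ∈ (φ.symm ≫ₕ chartAt (Cn n) (φ.symm p.1)).source := by
      simp [hp]
    rw [← poisson_chartFun_coordChange hφ (chartAt_mem_holCharts (φ.symm p.1)) F G hps,
      ← fibreCoord_cotangentPoint hφ (chartAt_mem_holCharts (φ.symm p.1)) hps]
    rfl
  have hs : ContMDiff (cotangentModel n) 𝓘(ℝ, ℂ) ∞ H := fun q => by
    have hφ := chartAt_mem_holCharts (n := n) q.1
    have hq := mem_chart_source (Cn n) q.1
    refine contMDiffAt_of_chartFun hφ hq ?_
    have hU : tube (tgt (chartAt (Cn n) q.1)) ∈ 𝓝 (cotangentCoord (chartAt (Cn n) q.1) q) :=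
      (isOpen_tube _).mem_nhds (mem_tube.2 ((chartAt (Cn n) q.1).map_source hq))
    refine (ContDiffOn.contDiffAt (poisson_mem (chartSmooth hφ F) (chartSmooth hφ G))
      hU).congr_of_eventuallyEq ?_
    filter_upwards [hU] with p hp
    exact key _ hφ p (mem_tube.1 hp)
  exact ⟨⟨H, hs⟩, key⟩

variable [T2Space M] [SecondCountableTopology M]

theorem toFormal_eq_iff {F G : CT n M} :
    toFormal n M F = toFormal n M G ↔ ∀ x, FlatOver (F - G).1 x :=
  (Ideal.Quotient.mk_eq_mk_iff_sub_mem F G).trans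
    ⟨fun h x => flatOver_of_mem_flatIdeal h x, mem_flatIdeal_of_flatOver⟩

/-- A global formal function is determined by its localizations. This is where the description of `⋂
I_Z^l` by flatness is used. -/
theorem CTZ_ext {P Q : CTZ n M} (h : ∀ (φ : OpenPartialHomeomorph M (Cn n))
    (hφ : φ ∈ holCharts n M), loc hφ P = loc hφ Q) : P = Q := by
  obtain ⟨F, rfl⟩ := toFormal_surjective P
  obtain ⟨G, rfl⟩ := toFormal_surjective Q
  refine toFormal_eq_iff.2 fun x φ hφ hx => ?_
  have h1 := h φ hφ
  rw [loc_toFormal, loc_toFormal, tubeMk_eq] at h1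
  exact h1 (φ x) (φ.map_source hx)

/-- Removes the choice of representatives: the bracket relation becomes an algebraic identity in
each chart. In the converse direction the global Poisson bracket of any representatives serves as
the witness. -/
theorem isCotangentBracket_iff {P Q R : CTZ n M} : IsCotangentBracket P Q R ↔
    ∀ (φ : OpenPartialHomeomorph M (Cn n)) (hφ : φ ∈ holCharts n M),
      tubeBracket (loc hφ P) (loc hφ Q) = loc hφ R := by
  constructor
  · rintro ⟨F, G, H, rfl, rfl, rfl, h⟩ φ hφ
    rw [loc_toFormal, loc_toFormal, loc_toFormal, tubeBracket_tubeMk]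
    refine tubeMk_eq_of_eqOn fun p hp => ?_
    exact ((h φ hφ p.1 (mem_tube.1 hp) p.2).trans
      (canonicalBracket_inChart hφ F G (mem_tube.1 hp) p.2)).symm
  · intro h
    obtain ⟨F, rfl⟩ := toFormal_surjective P
    obtain ⟨G, rfl⟩ := toFormal_surjective Q
    obtain ⟨H, hH⟩ := exists_poisson F G
    refine ⟨F, G, H, rfl, rfl, CTZ_ext fun φ hφ => ?_, fun φ hφ w hw ζ => ?_⟩
    · rw [← h φ hφ, loc_toFormal, loc_toFormal, loc_toFormal, tubeBracket_tubeMk]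
      exact tubeMk_eq_of_eqOn fun p hp => hH φ hφ p (mem_tube.1 hp)
    · exact (hH φ hφ (w, ζ) hw).trans (canonicalBracket_inChart hφ F G hw ζ).symm

theorem exists_isCotangentBracket (P Q : CTZ n M) : ∃ R, IsCotangentBracket P Q R := by
  obtain ⟨F, rfl⟩ := toFormal_surjective P
  obtain ⟨G, rfl⟩ := toFormal_surjective Q
  obtain ⟨H, hH⟩ := exists_poisson F G
  exact ⟨_, F, G, H, rfl, rfl, rfl, fun φ hφ w hw ζ => (hH φ hφ (w, ζ) hw).trans
    (canonicalBracket_inChart hφ F G hw ζ).symm⟩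

/-- Localization over the dual numbers. -/
def locE (hφ : φ ∈ holCharts n M) (P : (CTZ n M)[ε]) : (FormalTube (tgt φ))[ε] :=
  epsMk (loc hφ P.fst) (loc hφ P.snd)

theorem locE_mul (hφ : φ ∈ holCharts n M) (P Q : (CTZ n M)[ε]) :
    locE hφ (P * Q) = locE hφ P * locE hφ Q := by
  refine TrivSqZeroExt.ext ?_ ?_
  · rw [fst_dual_mul]
    exact map_mul _ _ _
  · rw [snd_dual_mul]
    change loc hφ (P * Q).snd = _
    rw [snd_dual_mul, map_add, map_mul, map_mul]
    rfl

theorem locE_add (hφ : φ ∈ holCharts n M) (P Q : (CTZ n M)[ε]) :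
    locE hφ (P + Q) = locE hφ P + locE hφ Q :=
  TrivSqZeroExt.ext (map_add (loc hφ) _ _) (map_add (loc hφ) _ _)

theorem locE_smul (hφ : φ ∈ holCharts n M) (c : ℂ) (P : (CTZ n M)[ε]) :
    locE hφ (c • P) = c • locE hφ P :=
  TrivSqZeroExt.ext (map_smul (loc hφ) _ _) (map_smul (loc hφ) _ _)

theorem locE_ext {P Q : (CTZ n M)[ε]} (h : ∀ (φ : OpenPartialHomeomorph M (Cn n))
    (hφ : φ ∈ holCharts n M), locE hφ P = locE hφ Q) : P = Q :=
  TrivSqZeroExt.ext (CTZ_ext fun φ hφ => congrArg TrivSqZeroExt.fst (h φ hφ))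
    (CTZ_ext fun φ hφ => congrArg TrivSqZeroExt.snd (h φ hφ))

/-- The canonical bracket over the dual numbers. -/
abbrev tubeBracketE {U : Opens (Cn n)} (a b : (FormalTube U)[ε]) : (FormalTube U)[ε] :=
  algBracket (fun k => epsD (dZ k)) (fun k => epsD (dZbar k)) (fun k => epsD (dZeta k))
    (fun k => epsD (dZetabar k)) a b

theorem fst_tubeBracketE {U : Opens (Cn n)} (a b : (FormalTube U)[ε]) :
    (tubeBracketE a b).fst = tubeBracket a.fst b.fst := by
  rw [tubeBracketE, algBracket, fst_dual_sum]
  rfl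

theorem snd_tubeBracketE {U : Opens (Cn n)} (a b : (FormalTube U)[ε]) :
    (tubeBracketE a b).snd = tubeBracket a.fst b.snd + tubeBracket a.snd b.fst := by
  rw [tubeBracketE, algBracket, snd_dual_sum, tubeBracket, tubeBracket, algBracket, algBracket,
    ← Finset.sum_add_distrib]
  refine Finset.sum_congr rfl fun k _ => ?_
  simp only [TrivSqZeroExt.snd_add, TrivSqZeroExt.snd_sub, snd_dual_mul, fst_epsD, snd_epsD]
  ring

theorem isCotangentBracketEps_iff {P Q R : (CTZ n M)[ε]} : IsCotangentBracketEps P Q R ↔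
    ∀ (φ : OpenPartialHomeomorph M (Cn n)) (hφ : φ ∈ holCharts n M),
      tubeBracketE (locE hφ P) (locE hφ Q) = locE hφ R := by
  constructor
  · rintro ⟨h0, A, B, hA, hB, hAB⟩ φ hφ
    rw [isCotangentBracket_iff] at h0 hA hB
    refine TrivSqZeroExt.ext ?_ ?_
    · rw [fst_tubeBracketE]
      exact h0 φ hφ
    · rw [snd_tubeBracketE]
      change tubeBracket (loc hφ P.fst) (loc hφ Q.snd) +
        tubeBracket (loc hφ P.snd) (loc hφ Q.fst) = loc hφ R.snd
      rw [hA φ hφ, hB φ hφ, hAB, map_add]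
  · intro h
    obtain ⟨A, hA⟩ := exists_isCotangentBracket P.fst Q.snd
    obtain ⟨B, hB⟩ := exists_isCotangentBracket P.snd Q.fst
    refine ⟨isCotangentBracket_iff.2 fun φ hφ => ?_, A, B, hA, hB, CTZ_ext fun φ hφ => ?_⟩
    · have h1 := congrArg TrivSqZeroExt.fst (h φ hφ)
      rwa [fst_tubeBracketE] at h1
    · have h1 := congrArg TrivSqZeroExt.snd (h φ hφ)
      rw [snd_tubeBracketE] at h1
      rw [map_add, ← isCotangentBracket_iff.1 hA φ hφ, ← isCotangentBracket_iff.1 hB φ hφ]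
      exact h1.symm

theorem exists_isCotangentBracketEps (P Q : (CTZ n M)[ε]) :
    ∃ R, IsCotangentBracketEps P Q R := by
  obtain ⟨R, hR⟩ := exists_isCotangentBracket P.fst Q.fst
  obtain ⟨A, hA⟩ := exists_isCotangentBracket P.fst Q.snd
  obtain ⟨B, hB⟩ := exists_isCotangentBracket P.snd Q.fst
  exact ⟨epsMk R (A + B), hR, A, B, hA, hB, rfl⟩

end Localization

/-! ### Existence and uniqueness of solutions of the source equations -/

section GlobalSource

open Set Filter TopologicalSpace

variable {n : ℕ} {M : Type*} [TopologicalSpace M] [ChartedSpace (Cn n) M]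
  [IsManifold 𝓘(ℂ, Cn n) ω M] {φ ψ : OpenPartialHomeomorph M (Cn n)} {g h : Tensor11 n M}
  {σ : Bool}

theorem Tensor11.comp_smooth (g : Tensor11 n M) (σ : Bool) (hφ : φ ∈ holCharts n M)
    (l k : Fin n) : ContDiffOn ℝ ∞ (g.comp σ φ l k) φ.target := by
  cases σ
  · exact g.smooth φ hφ k l
  · exact g.smooth φ hφ l k

/-- The components of `g + ε h` over an open subset of the target of a chart. -/
def tensorOn (g h : Tensor11 n M) (σ : Bool) (hφ : φ ∈ holCharts n M) {U : Opens (Cn n)}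
    (hU : U ≤ tgt φ) : LocalTensor U where
  g := g.comp σ φ
  h := h.comp σ φ
  smooth_g l k := (g.comp_smooth σ hφ l k).mono hU
  smooth_h l k := (h.comp_smooth σ hφ l k).mono hU

/-- For `σ = false` the transposition of the tensor together with the exchange of `z` and `z̄`
interchanges the two Jacobi identities. -/
theorem tensorOn_jacobi (hg : IsKahlerPoisson g) (hh : IsInfinitesimalDeformation g h) (σ : Bool)
    (hφ : φ ∈ holCharts n M) {U : Opens (Cn n)} (hU : U ≤ tgt φ) :
    (tensorOn g h σ hφ hU).Jacobi σ := by
  have e1 := fun w (hw : w ∈ U) => hg φ hφ w (hU hw)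
  have e2 := fun w (hw : w ∈ U) => hh φ hφ w (hU hw)
  cases σ
  · refine ⟨fun w hw l q p => ?_, fun w hw l q p => ?_, fun w hw k q p => ?_, fun w hw k q p => ?_⟩
    · exact (e1 w hw).2 l p q
    · exact (e2 w hw).2 l p q
    · simp only [dw_false]
      exact (e1 w hw).1 k p q
    · simp only [dw_false]
      exact (e2 w hw).1 k p q
  · refine ⟨fun w hw l q p => ?_, fun w hw l q p => ?_, fun w hw k q p => ?_, fun w hw k q p => ?_⟩
    · simp only [Bool.not_true, dw_false]
      exact (e1 w hw).1 l q p
    · simp only [Bool.not_true, dw_false]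
      exact (e2 w hw).1 l q p
    · exact (e1 w hw).2 k q p
    · exact (e2 w hw).2 k q p

/-- The source (`true`) or target (`false`) equations for an element of `C^∞(T*M, Z)[ε]`. -/
def IsSrc (g h : Tensor11 n M) (σ : Bool) (P : (CTZ n M)[ε]) : Prop :=
  ∀ (φ : OpenPartialHomeomorph M (Cn n)) (hφ : φ ∈ holCharts n M),
    (tensorOn g h σ hφ le_rfl).Source σ (locE hφ P)

/-- The source equations for `F₀ + ε F₁` at the point of the zero section over `x`. -/
def SrcOver (g h : Tensor11 n M) (σ : Bool) (F₀ F₁ : CT n M) (x : M) : Prop :=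
  ∀ φ ∈ holCharts n M, x ∈ φ.source →
    SourceAt σ (g.comp σ φ) (h.comp σ φ) (chartFun φ F₀.1) (chartFun φ F₁.1) (φ x)

theorem SrcOver.of_chart {F₀ F₁ : CT n M} {x : M} (hψ : ψ ∈ holCharts n M) (hx : x ∈ ψ.source)
    (hS : SourceAt σ (g.comp σ ψ) (h.comp σ ψ) (chartFun ψ F₀.1) (chartFun ψ F₁.1) (ψ x)) :
    SrcOver g h σ F₀ F₁ x := by
  intro φ hφ hxφ
  have hw := mem_trans_source hxφ hx
  have hs : ∀ F : CT n M, ContDiffAt ℝ ∞ (chartFun ψ F.1) (ψ (φ.symm (φ x)), 0) := fun F => by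
    rw [φ.left_inv hxφ]
    exact contDiffAt_chartFun hψ (ψ.map_source hx) F.2.contMDiffAt
  rw [← φ.left_inv hxφ] at hS
  refine (hS.comp_coordChange hφ hψ hw (hs F₀) (hs F₁)).congr ?_ ?_ <;>
  · filter_upwards [eventually_mem_source hw] with p hp
    exact chartFun_coordChange hφ hψ _ hp

/-- The part of the target of a chart that lies over an open subset of `M`. -/
def tgtOn (φ : OpenPartialHomeomorph M (Cn n)) (O : Opens M) : Opens (Cn n) :=
  ⟨φ.target ∩ φ.symm ⁻¹' O, φ.isOpen_inter_preimage_symm O.isOpen⟩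

theorem tgtOn_le (φ : OpenPartialHomeomorph M (Cn n)) (O : Opens M) : tgtOn φ O ≤ tgt φ :=
  fun _ hw => hw.1

/-- A smooth function on `T*M` in the coordinates of a chart, over an open subset. -/
def chartSmoothOn (hφ : φ ∈ holCharts n M) {U : Opens (Cn n)} (hU : U ≤ tgt φ) (F : CT n M) :
    SmoothTube U :=
  ⟨chartFun φ F.1, (chartSmooth hφ F).2.mono fun _ hp => mem_tube.2 (hU (mem_tube.1 hp))⟩

theorem source_chartSmoothOn (hφ : φ ∈ holCharts n M) {O : Opens M} {F₀ F₁ : CT n M}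
    (hF : ∀ x ∈ O, SrcOver g h σ F₀ F₁ x) :
    (tensorOn g h σ hφ (tgtOn_le φ O)).Source σ (epsMk
      (tubeMk _ (chartSmoothOn hφ (tgtOn_le φ O) F₀))
      (tubeMk _ (chartSmoothOn hφ (tgtOn_le φ O) F₁))) := by
  refine (LocalTensor.source_iff _ σ _ _).2 fun w hw => ?_
  have h1 := hF _ hw.2 φ hφ (φ.map_target hw.1)
  rwa [φ.right_inv hw.1] at h1

theorem isSrc_iff {F₀ F₁ : CT n M} :
    IsSrc g h σ (epsMk (toFormal n M F₀) (toFormal n M F₁)) ↔ ∀ x, SrcOver g h σ F₀ F₁ x := by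
  constructor
  · intro H x
    have hφ := chartAt_mem_holCharts (n := n) x
    have h1 := (LocalTensor.source_iff _ σ (chartSmooth hφ F₀) (chartSmooth hφ F₁)).1 (H _ hφ)
    exact SrcOver.of_chart hφ (mem_chart_source (Cn n) x)
      (h1 _ ((chartAt (Cn n) x).map_source (mem_chart_source (Cn n) x)))
  · intro H φ hφ
    refine (LocalTensor.source_iff _ σ (chartSmooth hφ F₀) (chartSmooth hφ F₁)).2 fun w hw => ?_
    have h1 := H _ φ hφ (φ.map_target hw)
    rwa [φ.right_inv hw] at h1

theorem chartFun_zero (φ : OpenPartialHomeomorph M (Cn n)) (F : CT n M) (w : Cn n) :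
    chartFun φ F.1 (w, 0) = (restrictZero n M F).1 (φ.symm w) := by
  rw [chartFun, cotangentPoint_zero]
  rfl

/-- Local uniqueness. It is stated over an arbitrary open set of the base because both the gluing of
local solutions and separation of variables compare solutions only locally. -/
theorem SrcOver.flatOver_sub {O : Opens M} {F₀ F₁ G₀ G₁ : CT n M}
    (hF : ∀ x ∈ O, SrcOver g h σ F₀ F₁ x) (hG : ∀ x ∈ O, SrcOver g h σ G₀ G₁ x)
    (h₀ : ∀ x ∈ O, (restrictZero n M F₀).1 x = (restrictZero n M G₀).1 x)
    (h₁ : ∀ x ∈ O, (restrictZero n M F₁).1 x = (restrictZero n M G₁).1 x) :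
    ∀ x ∈ O, FlatOver (F₀ - G₀).1 x ∧ FlatOver (F₁ - G₁).1 x := by
  intro x hx
  have hφ := chartAt_mem_holCharts (n := n) x
  have hxs := mem_chart_source (Cn n) x
  set φ := chartAt (Cn n) x
  have hU := tgtOn_le φ O
  have h1 := (source_chartSmoothOn hφ hF).eq (source_chartSmoothOn hφ hG) fun w => by
    simp only [fst_epsMk, snd_epsMk, coef_zero]
    change chartFun φ F₀.1 (w, 0) = chartFun φ G₀.1 (w, 0) ∧
      chartFun φ F₁.1 (w, 0) = chartFun φ G₁.1 (w, 0)
    simp only [chartFun_zero]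
    exact ⟨h₀ _ w.2.2, h₁ _ w.2.2⟩
  have hw : φ x ∈ tgtOn φ O := ⟨φ.map_source hxs, by
    rw [mem_preimage, φ.left_inv hxs]
    exact hx⟩
  have e0 := tubeMk_eq.1 (congrArg TrivSqZeroExt.fst h1) _ hw
  have e1 := tubeMk_eq.1 (congrArg TrivSqZeroExt.snd h1) _ hw
  exact ⟨FlatOver.of_chart hφ hxs e0, FlatOver.of_chart hφ hxs e1⟩

/-- The equations see only the class modulo flat functions, so they pass to a glued function that
agrees with a local solution up to flatness. -/
theorem SrcOver.of_flatOver_sub {O : Opens M} {F₀ F₁ G₀ G₁ : CT n M}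
    (hG : ∀ x ∈ O, SrcOver g h σ G₀ G₁ x)
    (hFG : ∀ x ∈ O, FlatOver (F₀ - G₀).1 x ∧ FlatOver (F₁ - G₁).1 x) :
    ∀ x ∈ O, SrcOver g h σ F₀ F₁ x := by
  intro x hx
  have hφ := chartAt_mem_holCharts (n := n) x
  have hxs := mem_chart_source (Cn n) x
  set φ := chartAt (Cn n) x
  have h1 := source_chartSmoothOn hφ hG
  have hw : φ x ∈ tgtOn φ O := ⟨φ.map_source hxs, by
    rw [mem_preimage, φ.left_inv hxs]
    exact hx⟩
  have e0 : tubeMk _ (chartSmoothOn hφ (tgtOn_le φ O) F₀) =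
      tubeMk _ (chartSmoothOn hφ (tgtOn_le φ O) G₀) := tubeMk_eq.2 fun w hw => by
    have h2 := (hFG _ hw.2).1 φ hφ (φ.map_target hw.1)
    rwa [φ.right_inv hw.1] at h2
  have e1 : tubeMk _ (chartSmoothOn hφ (tgtOn_le φ O) F₁) =
      tubeMk _ (chartSmoothOn hφ (tgtOn_le φ O) G₁) := tubeMk_eq.2 fun w hw => by
    have h2 := (hFG _ hw.2).2 φ hφ (φ.map_target hw.1)
    rwa [φ.right_inv hw.1] at h2
  rw [← e0, ← e1] at h1
  exact SrcOver.of_chart hφ hxs ((LocalTensor.source_iff _ σ _ _).1 h1 _ hw)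

variable [T2Space M]

theorem exists_bump {x : M} {O : Set M} (hO : O ∈ 𝓝 x) : ∃ χ : M → ℝ,
    ContMDiff 𝓘(ℝ, Cn n) 𝓘(ℝ) ∞ χ ∧ tsupport χ ⊆ O ∧ ∀ᶠ y in 𝓝 x, χ y = 1 := by
  obtain ⟨f, -, hf⟩ := (SmoothBumpFunction.nhds_basis_tsupport (I := 𝓘(ℝ, Cn n)) x).mem_iff.1 hO
  exact ⟨f, f.contMDiff, hf, f.eventuallyEq_one⟩

theorem contDiffOn_comp_symm (hφ : φ ∈ holCharts n M) (f : CM n M) :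
    ContDiffOn ℝ ∞ (f.1 ∘ φ.symm) φ.target :=
  contMDiffOn_iff_contDiffOn.1 (f.2.comp_contMDiffOn (contMDiffOn_chart_symm hφ))

/-- The Borel function of a chart, multiplied by a cutoff lifted from the base, is defined on the
whole cotangent bundle and is unchanged near the fibre over `x`. -/
theorem exists_srcOver_near (hg : IsKahlerPoisson g) (hh : IsInfinitesimalDeformation g h)
    (σ : Bool) (f₀ f₁ : CM n M) (x : M) : ∃ (G₀ G₁ : CT n M) (O : Opens M), x ∈ O ∧ ∀ y ∈ O,
      SrcOver g h σ G₀ G₁ y ∧ (restrictZero n M G₀).1 y = f₀.1 y ∧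
        (restrictZero n M G₁).1 y = f₁.1 y := by
  have hφ := chartAt_mem_holCharts (n := n) x
  have hxs := mem_chart_source (Cn n) x
  set φ := chartAt (Cn n) x
  obtain ⟨F₀, F₁, hF₀, hF₁, U, hxU, hU, hT⟩ :=
    LocalTensor.exists_source (c := tensorOn g h σ hφ le_rfl) (σ := σ)
      (contDiffOn_comp_symm hφ f₀) (contDiffOn_comp_symm hφ f₁) (φ.map_source hxs)
  have hO : IsOpen (φ.source ∩ φ ⁻¹' U) := φ.isOpen_inter_preimage U.isOpen
  obtain ⟨χ, hχ, hχO, hχ1⟩ := exists_bump (n := n) (hO.mem_nhds ⟨hxs, hxU⟩)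
  obtain ⟨V, hV1, hVo, hVx⟩ := eventually_nhds_iff.1 hχ1
  have hs : ∀ {F : Cn n × Cn n → ℂ}, ContDiff ℝ ∞ F → ContMDiff (cotangentModel n) 𝓘(ℝ, ℂ) ∞
      (fun p : Cotangent n M => χ p.1 • F (cotangentCoord φ p)) := fun {F} hF =>
    contMDiff_cutoff_smul hχ fun p hp => ContMDiffAt.comp p hF.contMDiff.contMDiffAt
      (contMDiffAt_cotangentCoord hφ (hχO hp).1)
  let O : Opens M := ⟨V ∩ (φ.source ∩ φ ⁻¹' U), hVo.inter hO⟩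
  have heq : ∀ {F : Cn n × Cn n → ℂ} {p : Cn n × Cn n}, p.1 ∈ φ.target → φ.symm p.1 ∈ V →
      chartFun φ (fun p : Cotangent n M => χ p.1 • F (cotangentCoord φ p)) p = F p := by
    intro F p hp hpV
    change χ (φ.symm p.1) • F (cotangentCoord φ (cotangentPoint φ p.1 p.2)) = F p
    rw [hV1 _ hpV, one_smul, cotangentCoord_cotangentPoint hφ hp]
  have hev : ∀ {F : Cn n × Cn n → ℂ} {y : M}, y ∈ O → F =ᶠ[𝓝 (φ y, 0)]
      chartFun φ (fun p : Cotangent n M => χ p.1 • F (cotangentCoord φ p)) := by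
    intro F y hy
    have hm : φ y ∈ tgtOn φ ⟨V, hVo⟩ := ⟨φ.map_source hy.2.1, by
      rw [mem_preimage, φ.left_inv hy.2.1]
      exact hy.1⟩
    filter_upwards [(isOpen_tube _).mem_nhds ((mem_tube (p := (φ y, (0 : Cn n)))).2 hm)] with p hp
    exact (heq (mem_tube.1 hp).1 (mem_tube.1 hp).2).symm
  have hsrc : ∀ w ∈ U, SourceAt σ (g.comp σ φ) (h.comp σ φ) F₀ F₁ w := by
    refine (LocalTensor.source_iff (tensorOn g h σ hφ hU) σ ⟨F₀, hF₀.contDiffOn⟩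
      ⟨F₁, hF₁.contDiffOn⟩).1 ((tensorOn_jacobi hg hh σ hφ hU).source_of_coef
        (u := (fun w _ => (f₀.1 ∘ φ.symm) w, fun w _ => (f₁.1 ∘ φ.symm) w)) fun r w ζ => ?_)
    simp only [fst_epsMk, snd_epsMk, coef_tubeMk]
    exact hT r w w.2 ζ
  refine ⟨⟨_, hs hF₀⟩, ⟨_, hs hF₁⟩, O, ⟨hVx, hxs, hxU⟩, fun y hy => ⟨?_, ?_, ?_⟩⟩
  · exact SrcOver.of_chart hφ hy.2.1 ((hsrc _ hy.2.2).congr (hev hy) (hev hy))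
  all_goals
    have hyt := φ.map_source hy.2.1
    have hyV : φ.symm (φ y) ∈ V := by rw [φ.left_inv hy.2.1]; exact hy.1
  · have h1 := (hT 0 _ hy.2.2 0).1
    rw [fibreTaylor_zero] at h1
    have h2 := (chartFun_zero φ ⟨_, hs hF₀⟩ (φ y)).symm.trans ((heq (p := (φ y, 0)) hyt hyV).trans h1)
    rw [φ.left_inv hy.2.1] at h2
    rw [h2]
    exact congrArg f₀.1 (φ.left_inv hy.2.1)
  · have h1 := (hT 0 _ hy.2.2 0).2
    rw [fibreTaylor_zero] at h1
    have h2 := (chartFun_zero φ ⟨_, hs hF₁⟩ (φ y)).symm.trans ((heq (p := (φ y, 0)) hyt hyV).trans h1)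
    rw [φ.left_inv hy.2.1] at h2
    rw [h2]
    exact congrArg f₁.1 (φ.left_inv hy.2.1)

variable [SecondCountableTopology M]

/-- As the weights sum to one, `F - H` is the weighted sum of the flat differences `G i - H`, and
near `x` only finitely many indices occur. -/
theorem flatOver_patch_sub {ι : Type*} (f : SmoothPartitionOfUnity ι 𝓘(ℝ, Cn n) M univ)
    {G : ι → CT n M} {F H : CT n M} (hF : ∀ p, F.1 p = ∑ᶠ i, f i p.1 • (G i).1 p) {x : M}
    (hH : ∀ i, x ∈ tsupport (f i) → FlatOver (G i - H).1 x) : FlatOver (F - H).1 x := by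
  have hφ := chartAt_mem_holCharts (n := n) x
  have hxs := mem_chart_source (Cn n) x
  set φ := chartAt (Cn n) x
  refine FlatOver.of_chart hφ hxs ?_
  have hc1 : ContinuousAt (fun p : Cn n × Cn n => φ.symm p.1) (φ x, 0) :=
    ContinuousAt.comp (f := Prod.fst) (x := ((φ x, 0) : Cn n × Cn n))
      (φ.continuousAt_symm (φ.map_source hxs)) continuousAt_fst
  have hflat : FlatAt (fun p : Cn n × Cn n => ∑ i ∈ f.fintsupport x,
      f i (φ.symm p.1) • chartFun φ (G i - H).1 p) (φ x) := by
    refine FlatAt.sum fun i hi => ?_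
    have h1 := hH i ((f.mem_fintsupport_iff x i).1 hi) φ hφ hxs
    exact h1.smul ((f i).contMDiff.continuous.continuousAt.comp hc1)
  refine hflat.congr ?_
  have hev : ∀ᶠ y in 𝓝 x, f.finsupport y ⊆ f.fintsupport x := f.eventually_finsupport_subset x
  have hev' : Tendsto (fun p : Cn n × Cn n => φ.symm p.1) (𝓝 (φ x, 0)) (𝓝 x) := by
    have h2 : Tendsto _ _ _ := hc1
    simpa only [φ.left_inv hxs] using h2
  filter_upwards [hev'.eventually hev] with p hp
  have hsub : ∀ i, f i (φ.symm p.1) ≠ 0 → i ∈ f.fintsupport x := fun i hi =>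
    hp ((f.mem_finsupport _).2 hi)
  have h1 : ∑ i ∈ f.fintsupport x, f i (φ.symm p.1) = 1 := by
    rw [← f.sum_eq_one (mem_univ (φ.symm p.1))]
    exact (finsum_eq_sum_of_support_subset _ fun i hi => hsub i hi).symm
  have h2 : F.1 (cotangentPoint φ p.1 p.2) =
      ∑ i ∈ f.fintsupport x, f i (φ.symm p.1) • (G i).1 (cotangentPoint φ p.1 p.2) := by
    rw [hF]
    refine finsum_eq_sum_of_support_subset _ fun i hi => hsub i fun h0 => hi ?_
    change f i (φ.symm p.1) • _ = 0
    rw [h0, zero_smul]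
  change ∑ i ∈ f.fintsupport x, f i (φ.symm p.1) • ((G i).1 (cotangentPoint φ p.1 p.2) -
    H.1 (cotangentPoint φ p.1 p.2)) = F.1 (cotangentPoint φ p.1 p.2) -
    H.1 (cotangentPoint φ p.1 p.2)
  simp only [smul_sub, Finset.sum_sub_distrib]
  rw [← Finset.sum_smul, h1, one_smul, h2]

/-- Every element of `C^∞(M)[ε]` is the restriction to the zero section of a solution of the source
equations. -/
theorem exists_isSrc (hg : IsKahlerPoisson g) (hh : IsInfinitesimalDeformation g h) (σ : Bool)
    (f : (CM n M)[ε]) : ∃ P : (CTZ n M)[ε], IsSrc g h σ P ∧ unitMap n M P.fst = f.fst ∧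
      unitMap n M P.snd = f.snd := by
  have := sigmaCompactSpace_of_charted n M
  choose G₀ G₁ O hxO hO using exists_srcOver_near hg hh σ f.fst f.snd
  obtain ⟨ρ, hρ⟩ := SmoothPartitionOfUnity.exists_isSubordinate 𝓘(ℝ, Cn n) isClosed_univ
    (fun x => (O x : Set M)) (fun x => (O x).isOpen) fun x _ => mem_iUnion.2 ⟨x, hxO x⟩
  let F₀ : CT n M := ⟨_, contMDiff_patch ρ (G := fun i => (G₀ i).1) fun i p _ => (G₀ i).2.contMDiffAt⟩
  let F₁ : CT n M := ⟨_, contMDiff_patch ρ (G := fun i => (G₁ i).1) fun i p _ => (G₁ i).2.contMDiffAt⟩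
  -- On overlaps two local solutions with the same restriction differ by flat functions, so the
  -- patched pair agrees with each of them up to flatness.
  have hflat : ∀ j, ∀ x ∈ O j, FlatOver (F₀ - G₀ j).1 x ∧ FlatOver (F₁ - G₁ j).1 x := by
    intro j x hx
    have key : ∀ i, x ∈ tsupport (ρ i) →
        FlatOver (G₀ i - G₀ j).1 x ∧ FlatOver (G₁ i - G₁ j).1 x := fun i hi =>
      SrcOver.flatOver_sub (O := O i ⊓ O j) (fun y hy => (hO i y hy.1).1)
        (fun y hy => (hO j y hy.2).1)
        (fun y hy => (hO i y hy.1).2.1.trans (hO j y hy.2).2.1.symm)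
        (fun y hy => (hO i y hy.1).2.2.trans (hO j y hy.2).2.2.symm) x ⟨hρ i hi, hx⟩
    exact ⟨flatOver_patch_sub ρ (fun p => rfl) fun i hi => (key i hi).1,
      flatOver_patch_sub ρ (fun p => rfl) fun i hi => (key i hi).2⟩
  have hzero : ∀ {A B : CT n M} {x : M}, FlatOver (A - B).1 x →
      (restrictZero n M A).1 x = (restrictZero n M B).1 x := by
    intro A B x hAB
    have h1 := (hAB _ (chartAt_mem_holCharts x) (mem_chart_source (Cn n) x)).eq_zero
    rw [chartFun_zero, (chartAt (Cn n) x).left_inv (mem_chart_source (Cn n) x)] at h1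
    exact sub_eq_zero.1 h1
  refine ⟨epsMk (toFormal n M F₀) (toFormal n M F₁), isSrc_iff.2 fun x => ?_, ?_, ?_⟩
  · exact SrcOver.of_flatOver_sub (fun y hy => (hO x y hy).1) (hflat x) x (hxO x)
  · exact Subtype.ext (funext fun x =>
      (hzero (hflat x x (hxO x)).1).trans (hO x x (hxO x)).2.1)
  · exact Subtype.ext (funext fun x =>
      (hzero (hflat x x (hxO x)).2).trans (hO x x (hxO x)).2.2)

theorem IsSrc.eq {P Q : (CTZ n M)[ε]} (hP : IsSrc g h σ P) (hQ : IsSrc g h σ Q)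
    (h₀ : unitMap n M P.fst = unitMap n M Q.fst) (h₁ : unitMap n M P.snd = unitMap n M Q.snd) :
    P = Q :=
  locE_ext fun φ hφ => (hP φ hφ).eq (hQ φ hφ) fun w => by
    simp only [locE, fst_epsMk, snd_epsMk, coef_zero_loc, h₀, h₁, and_self]

theorem IsSrc.add {P Q : (CTZ n M)[ε]} (hP : IsSrc g h σ P) (hQ : IsSrc g h σ Q) :
    IsSrc g h σ (P + Q) := fun φ hφ => by
  rw [locE_add]
  exact IsSource.add (hP φ hφ) (hQ φ hφ)

theorem IsSrc.mul {P Q : (CTZ n M)[ε]} (hP : IsSrc g h σ P) (hQ : IsSrc g h σ Q) :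
    IsSrc g h σ (P * Q) := fun φ hφ => by
  rw [locE_mul]
  exact IsSource.mul (hP φ hφ) (hQ φ hφ)

theorem IsSrc.smul {P : (CTZ n M)[ε]} (c : ℂ) (hP : IsSrc g h σ P) : IsSrc g h σ (c • P) :=
  fun φ hφ => by
  rw [locE_smul]
  exact IsSource.smul c (hP φ hφ)

/-- Constants are annihilated by all the derivations. Together with multiplicativity this yields
`ε`-linearity. -/
theorem isSrc_eps : IsSrc g h σ (DualNumber.eps : (CTZ n M)[ε]) := fun φ hφ => by
  have h1 : ∀ d : Derivation ℂ (FormalTube (tgt φ)) (FormalTube (tgt φ)),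
      epsD d (locE hφ DualNumber.eps) = 0 := fun d => by
    refine TrivSqZeroExt.ext ?_ ?_
    · change d (loc hφ 0) = 0
      rw [map_zero, map_zero]
    · change d (loc hφ 1) = 0
      rw [map_one, Derivation.map_one_eq_zero]
  exact ⟨fun l => h1 _, fun k => by simp only [h1, mul_zero, Finset.sum_const_zero]⟩

end GlobalSource

/-! ### Brackets of solutions of the source equations -/

section SourceBracket

open Set Filter TopologicalSpace

theorem IsSource.bracket_eq {n : ℕ} {R : Type*} [CommRing R] [Algebra ℂ R]
    {dz dzb dt dtb : Fin n → Derivation ℂ R R} {γ : Fin n → Fin n → R} {a b : R}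
    (ha : IsSource dzb dt dtb γ a) (hb : IsSource dzb dt dtb γ b) :
    algBracket dz dzb dt dtb a b =
      ∑ l, ∑ k, γ l k * (dzb l a * dz k b - dzb l b * dz k a) := by
  rw [Finset.sum_comm]
  refine Finset.sum_congr rfl fun k _ => ?_
  rw [ha.1, hb.1, ha.2, hb.2, Finset.sum_mul, Finset.mul_sum, zero_mul, mul_zero, add_zero, sub_zero,
    ← Finset.sum_sub_distrib]
  exact Finset.sum_congr rfl fun l _ => by ring

variable {n : ℕ} {U : Opens (Cn n)}

theorem tubeBracketE_eq (σ : Bool) (a b : (FormalTube U)[ε]) :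
    tubeBracketE a b = algBracket (fun k => epsD (dB (!σ) k)) (fun k => epsD (dB σ k))
      (fun k => epsD (dF (!σ) k)) (fun k => epsD (dF σ k)) a b := by
  cases σ
  · exact algBracket_swap a b
  · rfl

theorem coef_zero_mul (w : U) (ζ : Cn n) (a b : FormalTube U) :
    coef 0 w ζ (a * b) = coef 0 w ζ a * coef 0 w ζ b := by
  obtain ⟨F, rfl⟩ := tubeMk_surjective a
  obtain ⟨G, rfl⟩ := tubeMk_surjective b
  rw [← map_mul, coef_zero, coef_zero, coef_zero]
  rfl

variable {M : Type*} [TopologicalSpace M] [ChartedSpace (Cn n) M]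
  [IsManifold 𝓘(ℂ, Cn n) ω M] {φ ψ : OpenPartialHomeomorph M (Cn n)} {g h : Tensor11 n M}
  {σ : Bool}

theorem coef_zero_dB_loc (hφ : φ ∈ holCharts n M) (P : CTZ n M) (σ : Bool) (l : Fin n)
    (w : tgt φ) (ζ : Cn n) :
    coef 0 w ζ (dB σ l (loc hφ P)) = dw σ l ((unitMap n M P).1 ∘ φ.symm) w := by
  rw [coef_dB]
  refine dw_congr ?_
  filter_upwards [(tgt φ).isOpen.mem_nhds w.2] with w' hw'
  exact (coefFun_of_mem 0 _ ζ ⟨w', hw'⟩).trans (coef_zero_loc hφ P ⟨w', hw'⟩ ζ)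

/-- The bracket of functions on `ℂⁿ` for a tensor of type `(1,1)`, up to a sign. -/
def baseBracket (σ : Bool) (γ : Fin n → Fin n → Cn n → ℂ) (u v : Cn n → ℂ) (w : Cn n) : ℂ :=
  ∑ l, ∑ k, γ l k w * (dw σ l u w * dw (!σ) k v w - dw σ l v w * dw (!σ) k u w)

/-- The sign `1` (`true`) or `-1` (`false`). -/
def sn (σ : Bool) : ℂ := cond σ 1 (-1)

theorem sn_mul_sn (σ : Bool) : sn σ * sn σ = 1 := by cases σ <;> simp [sn]

theorem sn_mul_baseBracket (g : Tensor11 n M) (σ : Bool) (φ : OpenPartialHomeomorph M (Cn n))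
    (u v : Cn n → ℂ) (w : Cn n) : sn σ * baseBracket σ (g.comp σ φ) u v w =
      ∑ l, ∑ k, g.coeff φ l k w * (dzbar l u w * dz k v w - dzbar l v w * dz k u w) := by
  cases σ
  · simp only [sn, cond_false, baseBracket, neg_one_mul, Bool.not_false, dw_true, dw_false]
    rw [Finset.sum_comm, ← Finset.sum_neg_distrib]
    refine Finset.sum_congr rfl fun l _ => ?_
    rw [← Finset.sum_neg_distrib]
    refine Finset.sum_congr rfl fun k _ => ?_
    change -(g.coeff φ l k w * _) = _
    ring
  · simp only [sn, cond_true, baseBracket, one_mul, Bool.not_true, dw_true, dw_false]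
    rfl

variable [T2Space M] [SecondCountableTopology M]

/-- After substitution of the source equations only derivatives along the base are left, so
restriction to the zero section yields the bracket of the restrictions for `g + εh`. For the target
this is the negative of the bracket, recorded by `sn`. -/
theorem IsSrc.unit_bracket {P Q R : (CTZ n M)[ε]} (hP : IsSrc g h σ P) (hQ : IsSrc g h σ Q)
    (hR : IsCotangentBracketEps P Q R) (hφ : φ ∈ holCharts n M) {w : Cn n} (hw : w ∈ φ.target) :
    (unitMap n M R.fst).1 (φ.symm w) = baseBracket σ (g.comp σ φ)
      ((unitMap n M P.fst).1 ∘ φ.symm) ((unitMap n M Q.fst).1 ∘ φ.symm) w ∧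
    (unitMap n M R.snd).1 (φ.symm w) = baseBracket σ (g.comp σ φ)
      ((unitMap n M P.fst).1 ∘ φ.symm) ((unitMap n M Q.snd).1 ∘ φ.symm) w +
      baseBracket σ (g.comp σ φ)
      ((unitMap n M P.snd).1 ∘ φ.symm) ((unitMap n M Q.fst).1 ∘ φ.symm) w +
      baseBracket σ (h.comp σ φ)
      ((unitMap n M P.fst).1 ∘ φ.symm) ((unitMap n M Q.fst).1 ∘ φ.symm) w := by
  have h1 := isCotangentBracketEps_iff.1 hR φ hφ
  rw [tubeBracketE_eq σ, IsSource.bracket_eq (hP φ hφ) (hQ φ hφ)] at h1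
  have e0 := congrArg (coef 0 (⟨w, hw⟩ : tgt φ) 0) (congrArg TrivSqZeroExt.fst h1)
  have e1 := congrArg (coef 0 (⟨w, hw⟩ : tgt φ) 0) (congrArg TrivSqZeroExt.snd h1)
  simp only [fst_dual_sum, snd_dual_sum, fst_dual_mul, snd_dual_mul, TrivSqZeroExt.fst_sub,
    TrivSqZeroExt.snd_sub, fst_epsD, snd_epsD, locE, fst_epsMk, snd_epsMk, LocalTensor.coeff,
    map_sum, map_add, map_sub, coef_baseFun_mul, coef_zero_mul, coef_zero_dB_loc,
    coef_zero_loc] at e0 e1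
  refine ⟨e0.symm, e1.symm.trans ?_⟩
  simp only [baseBracket, ← Finset.sum_add_distrib]
  refine Finset.sum_congr rfl fun l _ => Finset.sum_congr rfl fun k _ => ?_
  change g.comp σ φ l k w * _ + h.comp σ φ l k w * _ = _
  ring

theorem IsSrc.isBracket {P Q R : (CTZ n M)[ε]} (hP : IsSrc g h σ P) (hQ : IsSrc g h σ Q)
    (hR : IsCotangentBracketEps P Q R) :
    IsBracket g (unitMap n M P.fst) (unitMap n M Q.fst) (sn σ • unitMap n M R.fst) :=
  fun φ hφ w hw => by
  rw [← sn_mul_baseBracket g σ φ, ← (hP.unit_bracket hQ hR hφ hw).1]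
  rfl

theorem IsSrc.isBracketEps (hg : IsKahlerPoisson g) (hh : IsInfinitesimalDeformation g h)
    {P Q R : (CTZ n M)[ε]} (hP : IsSrc g h σ P) (hQ : IsSrc g h σ Q)
    (hR : IsCotangentBracketEps P Q R) :
    IsBracketEps g h (epsMk (unitMap n M P.fst) (unitMap n M P.snd))
      (epsMk (unitMap n M Q.fst) (unitMap n M Q.snd))
      (epsMk (sn σ • unitMap n M R.fst) (sn σ • unitMap n M R.snd)) := by
  -- That the bracket on the base exists as a global smooth function is obtained for free: it is the
  -- restriction of the canonical bracket of two solutions.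
  have hbr : ∀ u v : CM n M, ∃ b, IsBracket g u v b := fun u v => by
    obtain ⟨P, hP, hu, -⟩ := exists_isSrc hg hh true (epsMk u 0)
    obtain ⟨Q, hQ, hv, -⟩ := exists_isSrc hg hh true (epsMk v 0)
    obtain ⟨R, hR⟩ := exists_isCotangentBracketEps P Q
    have h1 := hP.isBracket hQ hR
    rw [hu, hv] at h1
    exact ⟨_, h1⟩
  obtain ⟨b₁, hb₁⟩ := hbr (unitMap n M P.fst) (unitMap n M Q.snd)
  obtain ⟨b₂, hb₂⟩ := hbr (unitMap n M P.snd) (unitMap n M Q.fst)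
  -- The bracket for `h` alone is taken as what remains of the `ε`-component.
  refine ⟨hP.isBracket hQ hR, b₁, b₂, sn σ • unitMap n M R.snd - b₁ - b₂, hb₁, hb₂,
    fun φ hφ w hw => ?_, ?_⟩
  · have h1 := (hP.unit_bracket hQ hR hφ hw).2
    have h2 := hb₁ φ hφ w hw
    have h3 := hb₂ φ hφ w hw
    rw [← sn_mul_baseBracket _ σ φ] at h2 h3
    simp only [fst_epsMk]
    rw [← sn_mul_baseBracket _ σ φ]
    change sn σ * (unitMap n M R.snd).1 (φ.symm w) - b₁.1 (φ.symm w) - b₂.1 (φ.symm w) = _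
    rw [h1, h2, h3]
    ring
  · change sn σ • unitMap n M R.snd = _
    abel

/-- Closure under the canonical bracket identifies the bracket of two solutions with the solution
extending its own restriction, which is why the source and target maps respect brackets. -/
theorem IsSrc.bracket (hg : IsKahlerPoisson g) (hh : IsInfinitesimalDeformation g h)
    {P Q R : (CTZ n M)[ε]} (hP : IsSrc g h σ P) (hQ : IsSrc g h σ Q)
    (hR : IsCotangentBracketEps P Q R) : IsSrc g h σ R := fun φ hφ => by
  have cm : ∀ s t u v, ∀ x : (FormalTube (tgt φ))[ε], epsD (wirtD s u) (epsD (wirtD t v) x) =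
      epsD (wirtD t v) (epsD (wirtD s u) x) := fun s t u v => epsD_comm (wirtD_comm s t u v)
  rw [← isCotangentBracketEps_iff.1 hR φ hφ, tubeBracketE_eq σ]
  exact IsSource.bracket (hP φ hφ) (hQ φ hφ) (fun _ _ => cm _ _ _ _) (fun _ _ => cm _ _ _ _)
    (fun _ _ => cm _ _ _ _) (fun _ _ => cm _ _ _ _) (fun _ _ => cm _ _ _ _)
    (fun _ _ => cm _ _ _ _) (fun k i j => epsD_dF_coeff _ _ k i j)
    (tensorOn_jacobi hg hh σ hφ le_rfl).left

theorem IsSrc.bracket_target {P Q : (CTZ n M)[ε]} (hP : IsSrc g h true P)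
    (hQ : IsSrc g h false Q) : IsCotangentBracketEps P Q 0 :=
  isCotangentBracketEps_iff.2 fun φ hφ =>
    (algBracket_source_target (hP φ hφ) (hQ φ hφ)).trans
      (TrivSqZeroExt.ext (map_zero (loc hφ)).symm (map_zero (loc hφ)).symm)

/-! ### The groupoid -/

/-- The solution of the source equations with a given restriction to the zero section. -/
def sol (hg : IsKahlerPoisson g) (hh : IsInfinitesimalDeformation g h) (σ : Bool)
    (f : (CM n M)[ε]) : (CTZ n M)[ε] := (exists_isSrc hg hh σ f).choose

theorem sol_spec (hg : IsKahlerPoisson g) (hh : IsInfinitesimalDeformation g h) (σ : Bool)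
    (f : (CM n M)[ε]) : IsSrc g h σ (sol hg hh σ f) ∧ unitMap n M (sol hg hh σ f).fst = f.fst ∧
      unitMap n M (sol hg hh σ f).snd = f.snd := (exists_isSrc hg hh σ f).choose_spec

theorem sol_eq (hg : IsKahlerPoisson g) (hh : IsInfinitesimalDeformation g h) {f : (CM n M)[ε]}
    {P : (CTZ n M)[ε]} (hP : IsSrc g h σ P) (h₀ : unitMap n M P.fst = f.fst)
    (h₁ : unitMap n M P.snd = f.snd) : sol hg hh σ f = P := by
  obtain ⟨h1, h2, h3⟩ := sol_spec hg hh σ f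
  exact h1.eq hP (h2.trans h₀.symm) (h3.trans h₁.symm)

/-- The product of two solutions is a solution with the right restriction, and solutions are unique.
-/
theorem sol_mul (hg : IsKahlerPoisson g) (hh : IsInfinitesimalDeformation g h) (σ : Bool)
    (f₁ f₂ : (CM n M)[ε]) : sol hg hh σ (f₁ * f₂) = sol hg hh σ f₁ * sol hg hh σ f₂ := by
  obtain ⟨h1, h2, h3⟩ := sol_spec hg hh σ f₁
  obtain ⟨k1, k2, k3⟩ := sol_spec hg hh σ f₂
  refine sol_eq hg hh (h1.mul k1) ?_ ?_
  · rw [fst_dual_mul, fst_dual_mul, map_mul, h2, k2]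
  · rw [snd_dual_mul, snd_dual_mul, map_add, map_mul, map_mul, h2, h3, k2, k3]

theorem sol_eps (hg : IsKahlerPoisson g) (hh : IsInfinitesimalDeformation g h) (σ : Bool) :
    sol hg hh σ (DualNumber.eps : (CM n M)[ε]) = DualNumber.eps :=
  sol_eq hg hh isSrc_eps (map_zero (unitMap n M)) (map_one (unitMap n M))

/-- The map `sol` as a linear map. -/
def solL (hg : IsKahlerPoisson g) (hh : IsInfinitesimalDeformation g h) (σ : Bool) :
    (CM n M)[ε] →ₗ[ℂ] (CTZ n M)[ε] where
  toFun := sol hg hh σ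
  map_add' f₁ f₂ := by
    obtain ⟨h1, h2, h3⟩ := sol_spec hg hh σ f₁
    obtain ⟨k1, k2, k3⟩ := sol_spec hg hh σ f₂
    exact sol_eq hg hh (h1.add k1) ((map_add (unitMap n M) _ _).trans (congrArg₂ (· + ·) h2 k2))
      ((map_add (unitMap n M) _ _).trans (congrArg₂ (· + ·) h3 k3))
  map_smul' c f := by
    obtain ⟨h1, h2, h3⟩ := sol_spec hg hh σ f
    exact sol_eq hg hh (h1.smul c) ((map_smul (unitMap n M) _ _).trans (congrArg (c • ·) h2))
      ((map_smul (unitMap n M) _ _).trans (congrArg (c • ·) h3))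

/-- The sign is `1` for the source map and `-1` for the target map, so it equals its own inverse and
can be moved to the other side. -/
theorem exists_bracket_sol (hg : IsKahlerPoisson g) (hh : IsInfinitesimalDeformation g h)
    (σ : Bool) (f₁ f₂ : (CM n M)[ε]) : ∃ b, IsBracketEps g h f₁ f₂ b ∧
      IsCotangentBracketEps (solL hg hh σ f₁) (solL hg hh σ f₂) (sn σ • solL hg hh σ b) := by
  obtain ⟨h1, h2, h3⟩ := sol_spec hg hh σ f₁
  obtain ⟨k1, k2, k3⟩ := sol_spec hg hh σ f₂
  obtain ⟨R, hR⟩ := exists_isCotangentBracketEps (sol hg hh σ f₁) (sol hg hh σ f₂)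
  have hb := h1.isBracketEps hg hh k1 hR
  rw [h2, h3, k2, k3] at hb
  have hs := h1.bracket hg hh k1 hR
  refine ⟨_, hb, ?_⟩
  have e : solL hg hh σ (epsMk (sn σ • unitMap n M R.fst) (sn σ • unitMap n M R.snd)) =
      sn σ • R := sol_eq hg hh (hs.smul (sn σ)) (map_smul (unitMap n M) _ _)
        (map_smul (unitMap n M) _ _)
  rw [e, smul_smul, sn_mul_sn, one_smul]
  exact hR

theorem neg_one_smul_algebra {A : Type*} [CommRing A] [Algebra ℂ A] (x : A) : (-1 : ℂ) • x = -x :=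
  neg_one_smul ℂ x

/-- The deformation formal symplectic groupoid with separation of variables. -/
def groupoid (hg : IsKahlerPoisson g) (hh : IsInfinitesimalDeformation g h) :
    DeformationGroupoid g h where
  S := solL hg hh true
  T := solL hg hh false
  S_eps f := (sol_mul hg hh true _ f).trans (by rw [sol_eps]; rfl)
  T_eps f := (sol_mul hg hh false _ f).trans (by rw [sol_eps]; rfl)
  unit_S f := (sol_spec hg hh true f).2
  unit_T f := (sol_spec hg hh false f).2
  S_mul := sol_mul hg hh true
  T_mul := sol_mul hg hh false
  S_bracket f₁ f₂ := by
    obtain ⟨b, hb, hb'⟩ := exists_bracket_sol hg hh true f₁ f₂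
    exact ⟨b, hb, by simpa [sn] using hb'⟩
  T_bracket f₁ f₂ := by
    obtain ⟨b, hb, hb'⟩ := exists_bracket_sol hg hh false f₁ f₂
    refine ⟨b, hb, ?_⟩
    have e : sn false • solL hg hh false b = -solL hg hh false b :=
      TrivSqZeroExt.ext (neg_one_smul_algebra (A := CTZ n M) _)
        (neg_one_smul_algebra (A := CTZ n M) _)
    rwa [e] at hb'
  S_T_bracket f₁ f₂ := (sol_spec hg hh true f₁).1.bracket_target (sol_spec hg hh false f₂).1

end SourceBracket

/-! ### The exponential formulas -/

section Separation

open Set Filter TopologicalSpace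

variable {n : ℕ} {M : Type*} [TopologicalSpace M] [ChartedSpace (Cn n) M]
  [IsManifold 𝓘(ℂ, Cn n) ω M] {φ ψ : OpenPartialHomeomorph M (Cn n)} {g h : Tensor11 n M}
  {σ τ : Bool}

theorem opF_comp_false (g : Tensor11 n M) (φ : OpenPartialHomeomorph M (Cn n)) :
    opF false (g.comp false φ) = opDbar g φ := by
  funext u w ζ
  simp only [opF, opDbar, dw_false]
  rfl

/-- Supplies the factor `1 / r!` that turns the derivatives recorded by `coef` into the terms of the
exponential series. -/
theorem hasFibreExpansion_of_coef (hφ : φ ∈ holCharts n M) {P : CTZ n M}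
    {p : ℕ → Cn n → Cn n → ℂ} (hp : ∀ r (w : tgt φ) ζ, coef r w ζ (loc hφ P) = p r w ζ) :
    HasFibreExpansion φ P (fun r => ((r.factorial : ℂ)⁻¹) • p r) := by
  rintro F rfl w hw ζ r
  have h1 := hp r ⟨w, hw⟩ ζ
  rw [loc_toFormal, coef_tubeMk] at h1
  change _ = (r.factorial : ℂ)⁻¹ * p r w ζ
  rw [← h1, div_eq_inv_mul]
  rfl

variable [T2Space M] [SecondCountableTopology M]

theorem isExpSeries_sol (hg : IsKahlerPoisson g) (hh : IsInfinitesimalDeformation g h) (σ : Bool)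
    (hφ : φ ∈ holCharts n M) (f : (CM n M)[ε]) :
    IsExpSeries φ (opF σ (g.comp σ φ)) (opF σ (h.comp σ φ)) f (sol hg hh σ f) := by
  obtain ⟨h1, h2, h3⟩ := sol_spec hg hh σ f
  have h4 := (h1 φ hφ).coef_eq (u := baseInChart φ f) fun w ζ =>
    ⟨(coef_zero_loc hφ _ w ζ).trans (by rw [h2]; rfl),
      (coef_zero_loc hφ _ w ζ).trans (by rw [h3]; rfl)⟩
  exact ⟨hasFibreExpansion_of_coef hφ fun r w ζ => (h4 r w ζ).1,
    hasFibreExpansion_of_coef hφ fun r w ζ => (h4 r w ζ).2⟩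

/-! ### Separation of variables -/

/-- Agreement near `x` asks for representatives that are equal there, not merely up to flat
functions. Subtracting `χ (F - G)`, with a cutoff `χ` equal to one near `x`, replaces `F` by such a
representative; the correction is flat everywhere, so the class does not change. -/
theorem agreeNear_of_flatOver {F G : CT n M} {O : Opens M} {x : M} (hx : x ∈ O)
    (hFG : ∀ y ∈ O, FlatOver (F - G).1 y) : AgreeNear x (toFormal n M F) (toFormal n M G) := by
  obtain ⟨χ, hχ, hχO, hχ1⟩ := exists_bump (n := n) (O.isOpen.mem_nhds hx)
  let D : CT n M := ⟨fun p => χ p.1 • (F - G).1 p,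
    contMDiff_cutoff_smul hχ fun p _ => (F - G).2.contMDiffAt⟩
  refine ⟨F - D, G, (toFormal_eq_iff.2 fun y => ?_).symm, rfl, ?_⟩
  · rw [sub_sub_cancel]
    have hφ := chartAt_mem_holCharts (n := n) y
    have hys := mem_chart_source (Cn n) y
    set φ := chartAt (Cn n) y
    have hc : ContinuousAt (fun p : Cn n × Cn n => φ.symm p.1) (φ y, 0) :=
      ContinuousAt.comp (f := Prod.fst) (x := ((φ y, 0) : Cn n × Cn n))
        (φ.continuousAt_symm (φ.map_source hys)) continuousAt_fst
    refine FlatOver.of_chart hφ hys ?_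
    by_cases hy : y ∈ O
    · exact (hFG y hy φ hφ hys).smul (hχ.continuous.continuousAt.comp hc)
    · have hy' : ∀ᶠ z in 𝓝 y, χ z = 0 :=
        notMem_tsupport_iff_eventuallyEq.1 fun h => hy (hχO h)
      have ht : Tendsto (fun p : Cn n × Cn n => φ.symm p.1) (𝓝 (φ y, 0)) (𝓝 y) := by
        have h2 : Tendsto _ _ _ := hc
        simpa only [φ.left_inv hys] using h2
      refine flatAt_zero.congr ?_
      filter_upwards [ht.eventually hy'] with p hp
      change 0 = χ (φ.symm p.1) • _
      rw [hp, zero_smul]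
  · filter_upwards [hχ1] with y hy p hp
    change F.1 p - χ p.1 • (F.1 p - G.1 p) = G.1 p
    rw [hp, hy, one_smul, sub_sub_cancel]

theorem wirt_comp_fst {u : Cn n → ℂ} {p : Cn n × Cn n} (hu : DifferentiableAt ℝ u p.1) (s : ℂ)
    (v : Cn n × Cn n) : wirt s v (fun p => u p.1) p =
      (fderiv ℝ u p.1 v.1 + s * fderiv ℝ u p.1 (Complex.I • v.1)) / 2 := by
  have h1 : ∀ v, fderiv ℝ (fun p : Cn n × Cn n => u p.1) p v = fderiv ℝ u p.1 v.1 := fun v =>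
    congrArg (fun T => T v) (hu.hasFDerivAt.comp p hasFDerivAt_fst).fderiv
  rw [wirt, h1, h1]
  rfl

theorem wirt_fibreVec_comp_fst {u : Cn n → ℂ} {p : Cn n × Cn n} (hu : DifferentiableAt ℝ u p.1)
    (s : ℂ) (k : Fin n) : wirt s (fibreVec k) (fun p => u p.1) p = 0 := by
  rw [wirt_comp_fst hu]
  simp [fibreVec]

theorem wirt_baseVec_comp_fst {u : Cn n → ℂ} {p : Cn n × Cn n} (hu : DifferentiableAt ℝ u p.1)
    (σ : Bool) (k : Fin n) : wirt (sg σ) (baseVec k) (fun p => u p.1) p = dw σ k u p.1 := by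
  rw [wirt_comp_fst hu, dw]
  simp [baseVec, ← Pi.single_smul]

/-- For a function lifted from the base all fibre derivatives vanish, and so does the right side of
the equations when the base derivatives of type `σ` vanish. -/
theorem sourceAt_base {γ η : Fin n → Fin n → Cn n → ℂ} {u : Cn n → ℂ} {w : Cn n}
    (hu : ∀ᶠ v in 𝓝 w, DifferentiableAt ℝ u v ∧ ∀ l, dw σ l u v = 0) :
    SourceAt σ γ η (fun p => u p.1) (fun _ => 0) w := by
  have hev : ∀ᶠ p : Cn n × Cn n in 𝓝 (w, 0), DifferentiableAt ℝ u p.1 ∧ ∀ l, dw σ l u p.1 = 0 :=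
    (continuous_fst.tendsto ((w, 0) : Cn n × Cn n)).eventually hu
  have h0 : ∀ s v, wirt s v (fun _ : Cn n × Cn n => (0 : ℂ)) = fun _ => 0 := fun s v => by
    funext p
    simp [wirt]
  refine ⟨fun l => flatAt_zero.congr ?_, fun l => by rw [h0]; exact flatAt_zero,
    fun k => flatAt_zero.congr ?_, fun k => flatAt_zero.congr ?_⟩
  all_goals
    filter_upwards [hev] with p hp
    simp [contr, h0, wirt_fibreVec_comp_fst hp.1, wirt_baseVec_comp_fst hp.1, hp.2]

theorem cj_cj (σ : Bool) (z : ℂ) : cj σ (cj σ z) = z := by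
  cases σ
  · rfl
  · exact Complex.conj_conj z

/-- The Cauchy–Riemann equations, applied to `u` itself for `σ = true` and to its conjugate for `σ =
false`. -/
theorem dw_eq_zero_of_differentiableAt {u : Cn n → ℂ} {w : Cn n}
    (hu : DifferentiableAt ℂ (fun v => cj (!σ) (u v)) w) (l : Fin n) : dw σ l u w = 0 := by
  have hI : (Pi.single l Complex.I : Cn n) = Complex.I • Pi.single l 1 := by
    simp [← Pi.single_smul]
  have h1 := hu.hasFDerivAt.restrictScalars ℝ
  cases σ
  · have h2 : HasFDerivAt u (Complex.conjCLE.toContinuousLinearMap.comp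
        ((fderiv ℂ (fun v => cj true (u v)) w).restrictScalars ℝ)) w := by
      have h3 := Complex.conjCLE.toContinuousLinearMap.hasFDerivAt.comp w h1
      refine h3.congr_of_eventuallyEq (Eventually.of_forall fun v => ?_)
      exact (Complex.conj_conj (u v)).symm
    rw [dw, h2.fderiv, hI]
    simp only [ContinuousLinearMap.comp_apply, ContinuousLinearMap.coe_restrictScalars', map_smul,
      sg, cond_false]
    change ((starRingEnd ℂ) _ + -Complex.I * (starRingEnd ℂ) _) / 2 = 0
    simp only [smul_eq_mul, map_mul, Complex.conj_I]
    linear_combination (starRingEnd ℂ (fderiv ℂ (fun v => cj true (u v)) w (Pi.single l 1))) / 2 *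
      Complex.I_mul_I
  · have h2 : HasFDerivAt u ((fderiv ℂ (fun v => cj false (u v)) w).restrictScalars ℝ) w := h1
    rw [dw, h2.fderiv, hI]
    simp only [ContinuousLinearMap.coe_restrictScalars', map_smul, sg, cond_true, smul_eq_mul]
    linear_combination (fderiv ℂ (fun v => cj false (u v)) w (Pi.single l 1)) / 2 *
      Complex.I_mul_I

theorem eventually_dw_eq_zero (hφ : φ ∈ holCharts n M) {x : M} (hx : x ∈ φ.source) {a : M → ℂ}
    (ha : HolomorphicNear (n := n) (fun y => cj (!σ) (a y)) x) :
    ∀ᶠ y in 𝓝 x, ∀ l, dw σ l (a ∘ φ.symm) (φ y) = 0 := by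
  filter_upwards [ha, φ.open_source.mem_nhds hx] with y hy hys l
  refine dw_eq_zero_of_differentiableAt ?_ l
  have h1 : MDifferentiableAt 𝓘(ℂ, Cn n) 𝓘(ℂ, Cn n) φ.symm (φ y) :=
    (contMDiffAt_symm_of_mem_maximalAtlas hφ (φ.map_source hys)).mdifferentiableAt (by simp)
  rw [← φ.left_inv hys] at hy
  exact mdifferentiableAt_iff_differentiableAt.1 (hy.comp (φ y) h1)

/-- Where `a` is holomorphic (antiholomorphic for `σ = false`), its lift with zero `ε`-part solves
the same equations with the same restriction, so local uniqueness applies. -/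
theorem sol_agreeNear (hg : IsKahlerPoisson g) (hh : IsInfinitesimalDeformation g h) {x : M}
    {a : CM n M} (ha : HolomorphicNear (n := n) (fun y => cj (!σ) (a.1 y)) x) :
    AgreeNear x (sol hg hh σ (TrivSqZeroExt.inl a)).fst (toFormal n M (pullback n M a)) ∧
      AgreeNear x (sol hg hh σ (TrivSqZeroExt.inl a)).snd 0 := by
  have hφ := chartAt_mem_holCharts (n := n) x
  have hxs := mem_chart_source (Cn n) x
  set φ := chartAt (Cn n) x
  obtain ⟨V, hV, hVo, hVx⟩ := eventually_nhds_iff.1 (eventually_dw_eq_zero hφ hxs ha)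
  let O : Opens M := ⟨φ.source ∩ V, φ.open_source.inter hVo⟩
  have hO : ∀ y ∈ O, SrcOver g h σ (pullback n M a) 0 y := fun y hy => by
    refine SrcOver.of_chart hφ hy.1 (sourceAt_base (u := a.1 ∘ φ.symm) ?_)
    have hm : φ y ∈ tgtOn φ ⟨V, hVo⟩ := ⟨φ.map_source hy.1, by
      rw [mem_preimage, φ.left_inv hy.1]
      exact hy.2⟩
    filter_upwards [(tgtOn φ ⟨V, hVo⟩).isOpen.mem_nhds hm] with w hw
    refine ⟨((contDiffOn_comp_symm hφ a).contDiffAt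
      (φ.open_target.mem_nhds hw.1)).differentiableAt (by simp), fun l => ?_⟩
    rw [← φ.right_inv hw.1]
    exact hV _ hw.2 l
  obtain ⟨h1, h2, h3⟩ := sol_spec hg hh σ (TrivSqZeroExt.inl a)
  obtain ⟨F₀, hF₀⟩ := toFormal_surjective (sol hg hh σ (TrivSqZeroExt.inl a)).fst
  obtain ⟨F₁, hF₁⟩ := toFormal_surjective (sol hg hh σ (TrivSqZeroExt.inl a)).snd
  have e : epsMk (toFormal n M F₀) (toFormal n M F₁) = sol hg hh σ (TrivSqZeroExt.inl a) :=
    TrivSqZeroExt.ext hF₀ hF₁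
  rw [← e, isSrc_iff] at h1
  rw [← hF₀] at h2
  rw [← hF₁] at h3
  have h4 := SrcOver.flatOver_sub (O := O) (fun y _ => h1 y) hO
    (fun y _ => congrFun (congrArg Subtype.val h2) y)
    (fun y _ => congrFun (congrArg Subtype.val h3) y)
  rw [← hF₀, ← hF₁, ← map_zero (toFormal n M)]
  exact ⟨agreeNear_of_flatOver (O := O) ⟨hxs, hVx⟩ fun y hy => (h4 y hy).1,
    agreeNear_of_flatOver (O := O) ⟨hxs, hVx⟩ fun y hy => (h4 y hy).2⟩

theorem groupoid_separationOfVariables (hg : IsKahlerPoisson g)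
    (hh : IsInfinitesimalDeformation g h) : (groupoid hg hh).SeparationOfVariables :=
  ⟨fun _ _ ha => sol_agreeNear (σ := true) hg hh ha,
    fun _ _ ha => sol_agreeNear (σ := false) hg hh ha⟩

end Separation

/-! ### Uniqueness -/

section Uniqueness

open Set Filter TopologicalSpace

theorem algBracket_antisymm {n : ℕ} {R : Type*} [CommRing R] [Algebra ℂ R]
    (dz dzb dt dtb : Fin n → Derivation ℂ R R) (a b : R) :
    algBracket dz dzb dt dtb a b = -algBracket dz dzb dt dtb b a := by
  rw [algBracket, algBracket, ← Finset.sum_neg_distrib]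
  exact Finset.sum_congr rfl fun k _ => by ring

variable {n : ℕ} {U : Opens (Cn n)}

/-- The bracket is a differential operator in each argument, hence local in the base; this lets
global functions stand in for local coordinates. -/
theorem coef_tubeBracket_congr (a : FormalTube U) {F G : SmoothTube U} {V : Opens (Cn n)}
    (h : EqOn F.1 G.1 (tube V)) {w : U} (hw : (w : Cn n) ∈ V) (r : ℕ) (ζ : Cn n) :
    coef r w ζ (tubeBracket a (tubeMk U F)) = coef r w ζ (tubeBracket a (tubeMk U G)) := by
  obtain ⟨A, rfl⟩ := tubeMk_surjective a
  rw [tubeBracket_tubeMk, tubeBracket_tubeMk, coef_tubeMk, coef_tubeMk]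
  refine fibreTaylor_congr (U := V) (fun p hp => ?_) hw r ζ
  have e : F.1 =ᶠ[𝓝 p] G.1 := by
    filter_upwards [(isOpen_tube V).mem_nhds hp] with q hq using h hq
  simp only [poisson, wirt, e.fderiv_eq]

/-- The coordinate functions `z^k` (`true`) and `z̄^k` (`false`). -/
def coordSmooth (σ : Bool) (k : Fin n) : SmoothTube U :=
  ⟨fun p => fibL σ k p.1, ((fibL σ k).contDiff.comp contDiff_fst).contDiffOn⟩

theorem wirt_coord (s : ℂ) (σ : Bool) (k : Fin n) (v p : Cn n × Cn n) :
    wirt s v (fun p => fibL σ k p.1) p = (fibL σ k v.1 + s * fibL σ k (Complex.I • v.1)) / 2 := by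
  rw [wirt_comp_fst (fibL σ k).differentiableAt, (fibL σ k).fderiv]

/-- Coordinates on the base have constant derivatives, and the bracket with one of them is the
derivative along the dual fibre coordinate. -/
theorem tubeBracket_coord (σ : Bool) (k : Fin n) (a : FormalTube U) :
    tubeBracket a (tubeMk U (coordSmooth σ k)) = dF (!σ) k a := by
  obtain ⟨A, rfl⟩ := tubeMk_surjective a
  rw [tubeBracket_tubeMk, wirtD_tubeMk]
  refine congrArg _ (Subtype.ext (funext fun p => ?_))
  change poisson A.1 (fun p => fibL σ k p.1) p = wirt (sg (!σ)) (fibreVec k) A.1 p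
  rw [poisson, Finset.sum_eq_single k]
  · simp only [wirt_coord]
    cases σ <;> simp [fibL_true, fibL_false, baseVec, fibreVec, sg]
  · intro j _ hj
    simp only [wirt_coord]
    cases σ <;> simp [fibL_true, fibL_false, baseVec, fibreVec, hj.symm]
  · simp

variable {M : Type*} [TopologicalSpace M] [ChartedSpace (Cn n) M]
  [IsManifold 𝓘(ℂ, Cn n) ω M] {φ ψ : OpenPartialHomeomorph M (Cn n)} {g h : Tensor11 n M}
  {σ : Bool}

theorem AgreeNear.coef_tubeBracket (hφ : φ ∈ holCharts n M) {w : tgt φ} {P Q : CTZ n M}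
    (h : AgreeNear (φ.symm w) P Q) (a : FormalTube (tgt φ)) (r : ℕ) (ζ : Cn n) :
    coef r w ζ (tubeBracket a (loc hφ P)) = coef r w ζ (tubeBracket a (loc hφ Q)) := by
  obtain ⟨F, G, rfl, rfl, h⟩ := h
  obtain ⟨V, hV, hVo, hVx⟩ := eventually_nhds_iff.1 h
  exact coef_tubeBracket_congr (V := tgtOn φ ⟨V, hVo⟩) a
    (fun p hp => hV _ (mem_tube.1 hp).2 _ rfl) ⟨w.2, hVx⟩ r ζ

theorem coef_tubeBracket_pullback (hφ : φ ∈ holCharts n M) {w : tgt φ} {f : CM n M} {k : Fin n}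
    (hf : ∀ᶠ y in 𝓝 (φ.symm w), f.1 y = fibL σ k (φ y)) (a : FormalTube (tgt φ)) (r : ℕ)
    (ζ : Cn n) : coef r w ζ (tubeBracket a (loc hφ (toFormal n M (pullback n M f)))) =
      coef r w ζ (dF (!σ) k a) := by
  obtain ⟨V, hV, hVo, hVx⟩ := eventually_nhds_iff.1 hf
  rw [← tubeBracket_coord]
  refine coef_tubeBracket_congr (V := tgtOn φ ⟨V, hVo⟩) a (fun p hp => ?_) ⟨w.2, hVx⟩ r ζ
  have h1 := hV _ (mem_tube.1 hp).2
  rw [φ.right_inv (mem_tube.1 hp).1] at h1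
  exact h1

theorem fibL_eq_cj (σ : Bool) (k : Fin n) (ζ : Cn n) : fibL σ k ζ = cj (!σ) (ζ k) := by
  cases σ <;> rfl

variable [T2Space M]

/-- Groupoid maps act on global functions, so a coordinate is cut off away from `x`; it remains
holomorphic or antiholomorphic near `x`. -/
theorem exists_coordinate (hφ : φ ∈ holCharts n M) {x : M} (hx : x ∈ φ.source) (σ : Bool)
    (k : Fin n) : ∃ a : CM n M, (∀ᶠ y in 𝓝 x, a.1 y = fibL σ k (φ y)) ∧
      HolomorphicNear (n := n) (fun y => cj (!σ) (a.1 y)) x := by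
  obtain ⟨χ, hχ, hχO, hχ1⟩ := exists_bump (n := n) (φ.open_source.mem_nhds hx)
  have hs : ContMDiff 𝓘(ℝ, Cn n) 𝓘(ℝ, ℂ) ∞ (fun y => χ y • fibL σ k (φ y)) := by
    refine contMDiff_of_tsupport fun y hy => ?_
    have hsub : Function.support (fun y => χ y • fibL σ k (φ y)) ⊆ Function.support χ :=
      fun z hz h0 => hz (by
        change χ z • _ = 0
        rw [h0, zero_smul])
    have hy' : y ∈ tsupport χ := closure_mono hsub hy
    exact hχ.contMDiffAt.smul (ContMDiffAt.comp y (fibL σ k).contDiff.contMDiff.contMDiffAt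
      ((contMDiffOn_chart hφ).contMDiffAt (φ.open_source.mem_nhds (hχO hy'))))
  have hev : ∀ᶠ y in 𝓝 x, χ y • fibL σ k (φ y) = fibL σ k (φ y) := by
    filter_upwards [hχ1] with y hy
    rw [hy, one_smul]
  refine ⟨⟨_, hs⟩, hev, ?_⟩
  filter_upwards [eventually_eventually_nhds.2 hev, φ.open_source.mem_nhds hx] with y hy hys
  have h1 : MDifferentiableAt 𝓘(ℂ, Cn n) 𝓘(ℂ, ℂ) (fun y => φ y k) y :=
    MDifferentiableAt.comp (I' := 𝓘(ℂ, Cn n)) (g := fun v : Cn n => v k) y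
      (ContinuousLinearMap.proj (R := ℂ) (φ := fun _ : Fin n => ℂ) k).differentiableAt.mdifferentiableAt
      ((contMDiffAt_of_mem_maximalAtlas hφ hys).mdifferentiableAt (by simp))
  refine h1.congr_of_eventuallyEq ?_
  filter_upwards [hy] with z hz
  rw [hz, fibL_eq_cj, cj_cj]

theorem IsBracket.unique {u v b b' : CM n M} (hb : IsBracket g u v b) (hb' : IsBracket g u v b') :
    b = b' := Subtype.ext (funext fun x => by
  have hφ := chartAt_mem_holCharts (n := n) x
  have hx := mem_chart_source (Cn n) x
  have h1 := (hb _ hφ _ ((chartAt (Cn n) x).map_source hx)).trans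
    (hb' _ hφ _ ((chartAt (Cn n) x).map_source hx)).symm
  rwa [(chartAt (Cn n) x).left_inv hx] at h1)

theorem IsBracketEps.unique {u v b b' : (CM n M)[ε]} (hb : IsBracketEps g h u v b)
    (hb' : IsBracketEps g h u v b') : b = b' := by
  obtain ⟨h0, b₁, b₂, b₃, h1, h2, h3, e⟩ := hb
  obtain ⟨k0, c₁, c₂, c₃, k1, k2, k3, e'⟩ := hb'
  refine TrivSqZeroExt.ext (h0.unique k0) ?_
  rw [e, e', h1.unique k1, h2.unique k2, h3.unique k3]

variable [SecondCountableTopology M]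

/-- The source (`true`) or target (`false`) map of a groupoid. -/
def DeformationGroupoid.map (G : DeformationGroupoid g h) (σ : Bool) :
    (CM n M)[ε] →ₗ[ℂ] (CTZ n M)[ε] := cond σ G.S G.T

theorem DeformationGroupoid.unit_map (G : DeformationGroupoid g h) (σ : Bool) (f : (CM n M)[ε]) :
    unitMap n M (G.map σ f).fst = f.fst ∧ unitMap n M (G.map σ f).snd = f.snd := by
  cases σ
  · exact G.unit_T f
  · exact G.unit_S f

theorem DeformationGroupoid.map_bracket (G : DeformationGroupoid g h) (σ : Bool)
    (f₁ f₂ : (CM n M)[ε]) : ∃ b, IsBracketEps g h f₁ f₂ b ∧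
      IsCotangentBracketEps (G.map σ f₁) (G.map σ f₂) (sn σ • G.map σ b) := by
  cases σ
  · obtain ⟨b, hb, hb'⟩ := G.T_bracket f₁ f₂
    have e : sn false • G.T b = -G.T b := TrivSqZeroExt.ext (neg_one_smul_algebra (A := CTZ n M) _)
      (neg_one_smul_algebra (A := CTZ n M) _)
    exact ⟨b, hb, by rwa [← e] at hb'⟩
  · obtain ⟨b, hb, hb'⟩ := G.S_bracket f₁ f₂
    exact ⟨b, hb, by simpa [sn, DeformationGroupoid.map] using hb'⟩

theorem locE_zero (hφ : φ ∈ holCharts n M) : locE hφ (0 : (CTZ n M)[ε]) = 0 :=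
  TrivSqZeroExt.ext (map_zero (loc hφ)) (map_zero (loc hφ))

theorem DeformationGroupoid.map_not_bracket (G : DeformationGroupoid g h) (σ : Bool)
    (f₁ f₂ : (CM n M)[ε]) : IsCotangentBracketEps (G.map σ f₁) (G.map (!σ) f₂) 0 := by
  cases σ
  · refine isCotangentBracketEps_iff.2 fun φ hφ => ?_
    have h1 := isCotangentBracketEps_iff.1 (G.S_T_bracket f₂ f₁) φ hφ
    rw [locE_zero] at h1 ⊢
    rw [tubeBracketE, algBracket_antisymm, neg_eq_zero]
    exact h1
  · exact G.S_T_bracket f₁ f₂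

theorem DeformationGroupoid.SeparationOfVariables.map_agreeNear {G : DeformationGroupoid g h}
    (hG : G.SeparationOfVariables) {σ : Bool} {x : M} {a : CM n M}
    (ha : HolomorphicNear (n := n) (fun y => cj (!σ) (a.1 y)) x) :
    AgreeNear x (G.map σ (TrivSqZeroExt.inl a)).fst (toFormal n M (pullback n M a)) ∧
      AgreeNear x (G.map σ (TrivSqZeroExt.inl a)).snd 0 := by
  cases σ
  · exact hG.2 x a ha
  · exact hG.1 x a ha

/-- The bracket with an element that coincides near a point with a coordinate function. -/
theorem IsCotangentBracketEps.coef_coord {P Q R : (CTZ n M)[ε]}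
    (hR : IsCotangentBracketEps P Q R) (hφ : φ ∈ holCharts n M) {w : tgt φ} {a : CM n M}
    {k : Fin n} (ha : ∀ᶠ y in 𝓝 (φ.symm w), a.1 y = fibL σ k (φ y))
    (h₀ : AgreeNear (φ.symm w) Q.fst (toFormal n M (pullback n M a)))
    (h₁ : AgreeNear (φ.symm w) Q.snd 0) (r : ℕ) (ζ : Cn n) :
    coef r w ζ (dF (!σ) k (loc hφ P.fst)) = coef r w ζ (loc hφ R.fst) ∧
      coef r w ζ (dF (!σ) k (loc hφ P.snd)) = coef r w ζ (loc hφ R.snd) := by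
  have h2 := isCotangentBracketEps_iff.1 hR φ hφ
  have e0 := congrArg (coef r w ζ) (congrArg TrivSqZeroExt.fst h2)
  have e1 := congrArg (coef r w ζ) (congrArg TrivSqZeroExt.snd h2)
  rw [fst_tubeBracketE] at e0
  rw [snd_tubeBracketE, map_add] at e1
  simp only [locE, fst_epsMk, snd_epsMk, h₀.coef_tubeBracket hφ, h₁.coef_tubeBracket hφ,
    coef_tubeBracket_pullback hφ ha] at e0 e1
  have hz : ∀ p : FormalTube (tgt φ), tubeBracket p (loc hφ 0) = 0 := fun p => by
    simp [tubeBracket, algBracket]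
  rw [hz, map_zero, zero_add] at e1
  exact ⟨e0, e1⟩

/-- By Euler's formula the coefficient of degree `r + 1` reduces to coefficients of degree `r` of
fibre derivatives. One family of these derivatives is, up to sign, the image of `{f, z^k}` or `{f,
z̄^k}` under the same map; the other vanishes since source and target commute. The induction has to
run over all `f` simultaneously because `f` is replaced by its bracket with a coordinate. -/
theorem DeformationGroupoid.SeparationOfVariables.coef_map_eq {G G' : DeformationGroupoid g h}
    (hG : G.SeparationOfVariables) (hG' : G'.SeparationOfVariables) (σ : Bool)
    (hφ : φ ∈ holCharts n M) (r : ℕ) (w : tgt φ) (ζ : Cn n) (f : (CM n M)[ε]) :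
    coef r w ζ (loc hφ (G.map σ f).fst) = coef r w ζ (loc hφ (G'.map σ f).fst) ∧
      coef r w ζ (loc hφ (G.map σ f).snd) = coef r w ζ (loc hφ (G'.map σ f).snd) := by
  induction r generalizing f with
  | zero =>
    simp only [coef_zero_loc, (G.unit_map σ f).1, (G.unit_map σ f).2, (G'.unit_map σ f).1,
      (G'.unit_map σ f).2, and_self]
  | succ r ih =>
    have hx : φ.symm w ∈ φ.source := φ.map_target w.2
    have h1 : ∀ k,
        coef r w ζ (dF (!σ) k (loc hφ (G.map σ f).fst)) =
          coef r w ζ (dF (!σ) k (loc hφ (G'.map σ f).fst)) ∧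
        coef r w ζ (dF (!σ) k (loc hφ (G.map σ f).snd)) =
          coef r w ζ (dF (!σ) k (loc hφ (G'.map σ f).snd)) := fun k => by
      obtain ⟨a, ha, ha'⟩ := exists_coordinate hφ hx σ k
      obtain ⟨b, hb, hb'⟩ := G.map_bracket σ f (TrivSqZeroExt.inl a)
      obtain ⟨c, hc, hc'⟩ := G'.map_bracket σ f (TrivSqZeroExt.inl a)
      -- The bracket on the base depends only on `g` and `h`, so both groupoids produce the same `b`
      -- and the induction hypothesis applies to it.
      obtain rfl := hb.unique hc
      obtain ⟨e0, e1⟩ := hb'.coef_coord hφ ha (hG.map_agreeNear ha').1 (hG.map_agreeNear ha').2 r ζ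
      obtain ⟨d0, d1⟩ := hc'.coef_coord hφ ha (hG'.map_agreeNear ha').1 (hG'.map_agreeNear ha').2 r ζ
      have hsm : ∀ Q : CTZ n M, coef r w ζ (loc hφ (sn σ • Q)) = sn σ * coef r w ζ (loc hφ Q) :=
        fun Q => by rw [map_smul, map_smul, smul_eq_mul]
      refine ⟨e0.trans (Eq.trans ?_ d0.symm), e1.trans (Eq.trans ?_ d1.symm)⟩
      · exact (hsm _).trans ((congrArg (sn σ * ·) (ih b).1).trans (hsm _).symm)
      · exact (hsm _).trans ((congrArg (sn σ * ·) (ih b).2).trans (hsm _).symm)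
    -- Here the coordinate of the opposite type is used: the other map fixes it, and images of the
    -- two maps commute.
    have h2 : ∀ {G : DeformationGroupoid g h}, G.SeparationOfVariables → ∀ k,
        coef r w ζ (dF σ k (loc hφ (G.map σ f).fst)) = 0 ∧
        coef r w ζ (dF σ k (loc hφ (G.map σ f).snd)) = 0 := fun {G} hG k => by
      obtain ⟨a, ha, ha'⟩ := exists_coordinate hφ hx (!σ) k
      have h3 := (G.map_not_bracket σ f (TrivSqZeroExt.inl a)).coef_coord hφ ha
        (hG.map_agreeNear ha').1 (hG.map_agreeNear ha').2 r ζ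
      rw [Bool.not_not] at h3
      exact ⟨h3.1.trans ((congrArg (coef r w ζ) (map_zero (loc hφ))).trans (map_zero _)),
        h3.2.trans ((congrArg (coef r w ζ) (map_zero (loc hφ))).trans (map_zero _))⟩
    simp only [coef_succ_fib σ, h1, h2 hG, h2 hG', and_self]

theorem DeformationGroupoid.SeparationOfVariables.eq {G G' : DeformationGroupoid g h}
    (hG : G.SeparationOfVariables) (hG' : G'.SeparationOfVariables) : G = G' := by
  have h1 : ∀ σ, G.map σ = G'.map σ := fun σ => LinearMap.ext fun f => TrivSqZeroExt.ext
    (CTZ_ext fun φ hφ => formalTube_ext fun r w ζ => (hG.coef_map_eq hG' σ hφ r w ζ f).1)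
    (CTZ_ext fun φ hφ => formalTube_ext fun r w ζ => (hG.coef_map_eq hG' σ hφ r w ζ f).2)
  exact DeformationGroupoid.ext (h1 true) (h1 false)

end Uniqueness

end KahlerPoisson

end

/-! ### The theorem on deformation groupoids with separation of variables. -/

theorem mainTheorem4 {n : ℕ} {M : Type*} [TopologicalSpace M] [T2Space M]
    [SecondCountableTopology M] [ChartedSpace (KahlerPoisson.Cn n) M]
    [IsManifold 𝓘(ℂ, KahlerPoisson.Cn n) ω M] (g h : KahlerPoisson.Tensor11 n M)
    (hg : KahlerPoisson.IsKahlerPoisson g)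
    (hh : KahlerPoisson.IsInfinitesimalDeformation g h) :
    ∃ G : KahlerPoisson.DeformationGroupoid g h,
      G.SeparationOfVariables ∧
      (∀ G' : KahlerPoisson.DeformationGroupoid g h, G'.SeparationOfVariables → G' = G) ∧
      ∀ φ ∈ KahlerPoisson.holCharts n M, ∀ f : (KahlerPoisson.CM n M)[ε],
        KahlerPoisson.IsExpSeries φ (KahlerPoisson.opD g φ) (KahlerPoisson.opD h φ) f (G.S f) ∧
        KahlerPoisson.IsExpSeries φ (KahlerPoisson.opDbar g φ) (KahlerPoisson.opDbar h φ) f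
          (G.T f) := by
  refine ⟨KahlerPoisson.groupoid hg hh, KahlerPoisson.groupoid_separationOfVariables hg hh,
    fun G' hG' => hG'.eq (KahlerPoisson.groupoid_separationOfVariables hg hh),
    fun φ hφ f => ⟨KahlerPoisson.isExpSeries_sol hg hh true hφ f, ?_⟩⟩
  -- The source operators unfold to the general ones by definition; for the target the sign in
  -- `∂/∂z` has to be rewritten.
  rw [← KahlerPoisson.opF_comp_false, ← KahlerPoisson.opF_comp_false]
  exact KahlerPoisson.isExpSeries_sol hg hh false hφ f
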